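/- Let $(X,d)$ be a metric space that is geometrically doubling: there is $N\in\mathbb N$ such that every open ball of radius $r>0$ is covered by at most $N$ open balls of radius $r/2$. Let $\mu$ be a Borel measure on $X$ that is upper doubling with dominating function $\lambda:X\times(0,\infty)\to(0,\infty)$: $r\mapsto\lambda(x,r)$ is nondecreasing for every $x$, $\lambda(x,2r)\le C_\lambda\lambda(x,r)$, $\mu(B(x,r))\le\lambda(x,r)$, and $\lambda(x,r)\le C\lambda(y,r)$ whenever $d(x,y)\le r$. Functions are real- or complex-valued. A kernel $K\in L^1_{\rm loc}(X\times X\setminus\{x=y\})$ is a Calderón–Zygmund kernel if, for all $x\neq y$, $$|K(x,y)|\le C\min\Big\{\frac1{\lambda(x,d(x,y))},\frac1{\lambda(y,d(x,y))}\Big\},$$ and there are $\delta\in(0,1]$ and $C,c>0$ with $$|K(x,y)-K(x',y)|+|K(y,x)-K(y,x')|\le C\frac{d(x,x')^\delta}{d(x,y)^\delta\lambda(x,d(x,y))}\quad\text{whenever } x\ne y,\ d(x,x')\le c\,d(x,y).$$ Let $T$ be a Calderón–Zygmund operator with kernel $K$ that is bounded on $L^2(\mu)$; that is, $T$ is a bounded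 linear operator on $L^2(\mu)$ such that for every $f\in L^\infty(\mu)$ with bounded support, $Tf(x)=\int_X K(x,y)f(y)\,d\mu(y)$ for almost every $x\notin\operatorname{supp}f$. Put $$T_\varepsilon f(x)=\int_{d(x,y)\ge\varepsilon}K(x,y)f(y)\,d\mu(y),\qquad T_*f(x)=\sup_{\varepsilon>0}|T_\varepsilon f(x)|,$$ $$M_{\eta,\rho}f(x)=\sup_{Q\ni x}\Big(\frac1{\mu(\rho Q)}\int_Q|f|^\eta\,d\mu\Big)^{1/\eta},\qquad M_{(\rho)}f=M_{1,\rho}f,$$ where the supremum is over all open balls $Q$ containing $x$, $\rho Q$ is the concentric ball of $\rho$ times the radius, and balls with $\mu(\rho Q)=0$ are disregarded. (a) (Cotlar inequality) For every $\eta\in(0,1)$ there is a constant $C$ such that for every bounded function $f$ with compact support and every $x\in X$, $$T_*f(x)\le C\big(M_{\eta,6}(Tf)(x)+M_{(5)}f(x)\big).$$ (b) Consequently $T_*$ is bounded on $L^p(\mu)$ for every $1<p<\infty$: for $f\in L^p(\mu)$ the integrals $T_\varepsilon f(x)$ converge absolutely for all $x\in X$ and $\varepsilon>0$, $T_*f$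 is $\mu$-measurable, and $\|T_*f\|_{L^p(\mu)}\le C_p\|f\|_{L^p(\mu)}$ with $C_p$ independent of $f$. -/

import Mathlib

open MeasureTheory Set Filter Topology
open scoped ENNReal NNReal

namespace NonHomog

/-- The metric space `X` is geometrically doubling: for some `N`, every open ball of radius `r`
is covered by at most `N` open balls of radius `r / 2`. -/
def GeometricallyDoubling (X : Type*) [MetricSpace X] : Prop :=
  ∃ N : ℕ, ∀ (x : X) (r : ℝ), 0 < r →
    ∃ s : Finset X, s.card ≤ N ∧ Metric.ball x r ⊆ ⋃ c ∈ s, Metric.ball c (r / 2)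

/-- `lam` is a dominating function for `μ`, so that `μ` is an upper doubling measure. Only the
values `lam x r` with `0 < r` matter. -/
structure IsDominating {X : Type*} [MetricSpace X] [MeasurableSpace X]
    (μ : Measure X) (lam : X → ℝ → ℝ) : Prop where
  pos : ∀ x r, 0 < r → 0 < lam x r
  mono : ∀ x, MonotoneOn (lam x) (Ioi 0)
  doubling : ∃ C : ℝ, 0 < C ∧ ∀ x r, 0 < r → lam x (2 * r) ≤ C * lam x r
  measure_ball_le : ∀ x r, 0 < r → μ (Metric.ball x r) ≤ ENNReal.ofReal (lam x r)
  comparable : ∃ C : ℝ, 0 < C ∧ ∀ x y r, 0 < r → dist x y ≤ r → lam x r ≤ C * lam y r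

/-- `K` is a Calderón–Zygmund kernel with respect to `μ` and the dominating function `lam`.
The values of `K` on the diagonal are irrelevant. -/
structure IsCZKernel {X 𝕜 : Type*} [MetricSpace X] [MeasurableSpace X] [RCLike 𝕜]
    (μ : Measure X) (lam : X → ℝ → ℝ) (K : X → X → 𝕜) : Prop where
  locallyIntegrable :
    LocallyIntegrableOn (fun z : X × X => K z.1 z.2) {z : X × X | z.1 ≠ z.2} (μ.prod μ)
  size : ∃ C : ℝ, 0 < C ∧ ∀ x y, x ≠ y →
    ‖K x y‖ ≤ C * min (1 / lam x (dist x y)) (1 / lam y (dist x y))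
  smooth : ∃ δ : ℝ, 0 < δ ∧ δ ≤ 1 ∧ ∃ C : ℝ, 0 < C ∧ ∃ c : ℝ, 0 < c ∧
    ∀ x x' y, x ≠ y → dist x x' ≤ c * dist x y →
      ‖K x y - K x' y‖ + ‖K y x - K y x'‖ ≤
        C * (dist x x' ^ δ / (dist x y ^ δ * lam x (dist x y)))

/-- The bounded linear operator `T` on `L²(μ)` is a Calderón–Zygmund operator with kernel `K`:
`K` is a Calderón–Zygmund kernel, and for every `f ∈ L^∞(μ)` with bounded support (such `f` lie
in `L²(μ)`), `T f (x) = ∫ K(x, y) f(y) dμ(y)` for almost every `x` outside the support of `f`. -/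
structure IsCZOperator {X 𝕜 : Type*} [MetricSpace X] [MeasurableSpace X] [RCLike 𝕜]
    (μ : Measure X) (lam : X → ℝ → ℝ) (K : X → X → 𝕜)
    (T : Lp 𝕜 2 μ →L[𝕜] Lp 𝕜 2 μ) : Prop where
  kernel : IsCZKernel μ lam K
  representation : ∀ (f : X → 𝕜) (hf : MemLp f 2 μ), MemLp f ∞ μ →
    Bornology.IsBounded (Function.support f) →
      ∀ᵐ x ∂μ, x ∉ tsupport f → T (hf.toLp f) x = ∫ y, K x y * f y ∂μ

/-- The truncated operator `T_ε f (x) = ∫_{d(x, y) ≥ ε} K(x, y) f(y) dμ(y)`. -/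
noncomputable def truncated {X 𝕜 : Type*} [MetricSpace X] [MeasurableSpace X] [RCLike 𝕜]
    (μ : Measure X) (K : X → X → 𝕜) (ε : ℝ) (f : X → 𝕜) (x : X) : 𝕜 :=
  ∫ y in {y : X | ε ≤ dist x y}, K x y * f y ∂μ

/-- The maximal truncated operator `T_* f (x) = sup_{ε > 0} |T_ε f (x)|`, with values in
`[0, ∞]`. -/
noncomputable def maximalTruncated {X 𝕜 : Type*} [MetricSpace X] [MeasurableSpace X] [RCLike 𝕜]
    (μ : Measure X) (K : X → X → 𝕜) (f : X → 𝕜) (x : X) : ℝ≥0∞ :=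
  ⨆ (ε : ℝ) (_ : 0 < ε), ‖truncated μ K ε f x‖ₑ

/-- The non-centred maximal function
`M_{p, ρ} f (x) = sup_{Q ∋ x} (μ(ρ Q)⁻¹ ∫_Q |f|^p dμ)^{1/p}`, the supremum being over all open
balls `Q = B(c, r)` containing `x`. Balls with `μ(ρ Q) = 0` contribute `∞ * 0 = 0`. -/
noncomputable def maximalFun {X 𝕜 : Type*} [MetricSpace X] [MeasurableSpace X] [RCLike 𝕜]
    (μ : Measure X) (p ρ : ℝ) (f : X → 𝕜) (x : X) : ℝ≥0∞ :=
  ⨆ (c : X) (r : ℝ) (_ : x ∈ Metric.ball c r),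
    ((μ (Metric.ball c (ρ * r)))⁻¹ * ∫⁻ y in Metric.ball c r, ‖f y‖ₑ ^ p ∂μ) ^ (1 / p)

/-- An essentially bounded function with compact support is in `L²(μ)`. -/
theorem IsDominating.memLp_two {X 𝕜 : Type*} [MetricSpace X] [MeasurableSpace X] [RCLike 𝕜]
    {μ : Measure X} {lam : X → ℝ → ℝ} (hlam : IsDominating μ lam) {f : X → 𝕜}
    (hf : MemLp f ∞ μ) (hs : HasCompactSupport f) : MemLp f 2 μ := by
  rcases (tsupport f).eq_empty_or_nonempty with h | ⟨x, -⟩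
  · refine hf.mono_exponent_of_measure_support_ne_top (s := ∅) (fun x _ => ?_) (by simp) le_top
    exact image_eq_zero_of_notMem_tsupport (by simp [h])
  · obtain ⟨r, hr, hsub⟩ := hs.isCompact.isBounded.subset_ball_lt 0 x
    refine hf.mono_exponent_of_measure_support_ne_top (s := Metric.ball x r) (fun y hy => ?_)
      ((hlam.measure_ball_le x r hr).trans_lt ENNReal.ofReal_lt_top).ne le_top
    exact image_eq_zero_of_notMem_tsupport fun h => hy (hsub h)

end NonHomog

/-! ### Separability from geometric doubling -/

namespace NonHomog

/-! The measure need not be doubling, but doubling balls can be found at every point. Along the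
radii $A^j r$ the density $\mu(B)/\lambda$ never exceeds $1$. If no step with positive mass were
doubling, the density would double forever once positive. Stopping at the first doubling ball
$B(x,R)$ makes the earlier densities sum like a geometric series. The kernel over the shell $r\le
d(x,y)<AR$ therefore costs only a multiple of $M_{(5)}f(x)$ (`IsDominating.exists_doubling_radius`).
Smoothness of the kernel then compares $T_rf(x)$ with $Tf(x')-T(f1_{B(x,aR)})(x')$ for almost every
$x'\in B(x,R)$ (`IsCZOperator.exists_pointwise_bound`). Averaging $\eta$-th powers over $x'$ reduces
Cotlar's inequality to a bound for the average of $|T(f1_{B(x,aR)})|^\eta$ on $B(x,R)$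
(`IsCZOperator.cotlar_of_local`).

This local bound is supplied twice. With $\eta=2$ it needs only $L^2$ boundedness and costs an extra
$M_{2,5}f$, which is harmless for $|f|\le1$ (`IsCZOperator.cotlar_two`). With $\eta<1$ it follows by
Kolmogorov's inequality from the weak type $(1,1)$ bound (`IsCZOperator.weakType`), whose proof uses
the case $\eta=2$ for the adjoint, so nothing is circular.

For the weak type bound, $f$ on $\{|f|>t\}$ is cut into pieces concentrated near points $x_i$. Each
piece is compensated by $t v_i$ with $|v_i|\le w_i$, where the weight $w_i$ has mass
$t^{-1}\int_{Q_i}|f|$ and is poured around $x_i$ greedily, subject to $\sum w_i\le1$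
(`exists_saturating_weights`, `exists_decomposition`). The good part is controlled in $L^2$. The bad
part $b$ is tested against the phase $\varphi$ of $Tb$ on a set $S$ off the exceptional set:
$T^*\varphi$ is within a constant of a truncation at $x_i$ on the $i$-th piece, and is controlled on
$w_i$ by $|T^*\varphi|+T^*_*\varphi$, where $T^*_*$ is the maximal truncation of the adjoint kernel.
Cotlar with $\eta=2$ bounds the weighted integral of the latter, and the resulting multiple of
$\mu(S)$ is absorbed (`IsCZOperator.exists_bad_part_bound`).

Interpolation gives $L^p$ bounds for $T$ with $p<2$ and duality gives $p>2$. Cotlar with $\eta=1/2$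
and the maximal theorem then bound $T_*$ on bounded functions of bounded support. For general $f\in
L^p$, Hölder gives absolute convergence because $K(x,\cdot)$ lies in every $L^q$, $q>1$, away from
$x$, and Fatou transfers the bound. -/

/-- Iterating the halving covers a ball by finitely many balls of arbitrarily small radius, so balls
are totally bounded and $X$ is separable. Countable coverings and measurability on products rely on
this. -/
theorem GeometricallyDoubling.secondCountableTopology {X : Type*} [MetricSpace X]
    (hX : GeometricallyDoubling X) : SecondCountableTopology X := by
  obtain ⟨N, hN⟩ := hX
  have key : ∀ k : ℕ, ∀ (x : X) (r : ℝ), 0 < r →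
      ∃ s : Set X, s.Finite ∧ Metric.ball x r ⊆ ⋃ c ∈ s, Metric.ball c (r / 2 ^ k) := by
    intro k
    induction k with
    | zero => exact fun x r _ => ⟨{x}, finite_singleton x, by simp⟩
    | succ k ih =>
      intro x r hr
      obtain ⟨s, hs, hsub⟩ := ih x r hr
      choose F hF using fun c => (hN c (r / 2 ^ k) (by positivity))
      refine ⟨⋃ c ∈ s, (F c : Set X), hs.biUnion fun c _ => (F c).finite_toSet, fun y hy => ?_⟩
      obtain ⟨c, hc, hyc⟩ := mem_iUnion₂.1 (hsub hy)
      obtain ⟨d, hd, hyd⟩ := mem_iUnion₂.1 ((hF c).2 hyc)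
      refine mem_iUnion₂.2 ⟨d, mem_iUnion₂.2 ⟨c, hc, hd⟩, ?_⟩
      rwa [pow_succ, ← div_div]
  have htb : ∀ (x : X) (n : ℕ), TotallyBounded (Metric.ball x ((n : ℝ) + 1)) := by
    intro x n
    refine Metric.totallyBounded_iff.2 fun ε hε => ?_
    obtain ⟨k, hk⟩ := pow_unbounded_of_one_lt (((n : ℝ) + 1) / ε) (one_lt_two : (1 : ℝ) < 2)
    obtain ⟨s, hs, hsub⟩ := key k x ((n : ℝ) + 1) (by positivity)
    refine ⟨s, hs, hsub.trans (iUnion₂_mono fun c _ => Metric.ball_subset_ball ?_)⟩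
    rw [div_le_iff₀ (by positivity)]
    rw [div_lt_iff₀ hε] at hk
    linarith [mul_comm ε ((2 : ℝ) ^ k)]
  have hsep : TopologicalSpace.SeparableSpace X := by
    rcases isEmpty_or_nonempty X with h | ⟨⟨x⟩⟩
    · infer_instance
    · rw [← TopologicalSpace.isSeparable_univ_iff]
      have : (univ : Set X) = ⋃ n : ℕ, Metric.ball x ((n : ℝ) + 1) := by
        refine (eq_univ_of_forall fun y => ?_).symm
        obtain ⟨n, hn⟩ := exists_nat_gt (dist y x)
        exact mem_iUnion.2 ⟨n, by rw [Metric.mem_ball]; linarith⟩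
      rw [this]
      exact TopologicalSpace.IsSeparable.iUnion fun n => (htb x n).isSeparable
  exact UniformSpace.secondCountable_of_separable X

/-! ### Layer-cake formulas for `ℝ≥0∞`-valued functions -/

theorem measurable_ofReal_rpow (q : ℝ) : Measurable fun s : ℝ => ENNReal.ofReal (s ^ q) :=
  (measurable_id.pow_const q).ennreal_ofReal

theorem lintegral_Ioo_rpow {q b : ℝ} (hq : 0 < q) (hb : 0 ≤ b) :
    ∫⁻ s in Ioo (0 : ℝ) b, ENNReal.ofReal (s ^ (q - 1)) = ENNReal.ofReal (b ^ q / q) := by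
  have hint : IntervalIntegrable (fun s : ℝ => s ^ (q - 1)) volume 0 b :=
    intervalIntegral.intervalIntegrable_rpow' (by linarith)
  rw [← ofReal_integral_eq_lintegral_ofReal]
  · congr 1
    rw [← integral_Ioc_eq_integral_Ioo, ← intervalIntegral.integral_of_le hb,
      integral_rpow (Or.inl (by linarith))]
    simp [Real.zero_rpow hq.ne']
  · exact ((intervalIntegrable_iff_integrableOn_Ioo_of_le hb).1 hint)
  · filter_upwards [ae_restrict_mem measurableSet_Ioo] with s hs
    exact Real.rpow_nonneg hs.1.le _

theorem lintegral_Ioi_rpow {q b : ℝ} (hq : 0 < q) (hb : 0 < b) :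
    ∫⁻ s in Ioi b, ENNReal.ofReal (s ^ (-q - 1)) = ENNReal.ofReal (b ^ (-q) / q) := by
  rw [← ofReal_integral_eq_lintegral_ofReal]
  · congr 1
    rw [integral_Ioi_rpow_of_lt (by linarith) hb]
    simp [neg_div_neg_eq]
  · exact integrableOn_Ioi_rpow_of_lt (by linarith) hb
  · filter_upwards [ae_restrict_mem measurableSet_Ioi] with s hs
    exact Real.rpow_nonneg (hb.trans hs).le _

theorem lintegral_indicator_lt_rpow {q : ℝ} (hq : 0 < q) (u : ℝ≥0∞) :
    ∫⁻ s in Ioi (0 : ℝ), {s : ℝ | ENNReal.ofReal s < u}.indicator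
      (fun s => ENNReal.ofReal (s ^ (q - 1))) s = u ^ q / ENNReal.ofReal q := by
  have hm : MeasurableSet {s : ℝ | ENNReal.ofReal s < u} :=
    measurableSet_lt ENNReal.measurable_ofReal measurable_const
  have hfin : ∀ b : ℝ, 0 ≤ b → ∫⁻ s in Ioi (0 : ℝ),
      {s : ℝ | ENNReal.ofReal s < ENNReal.ofReal b}.indicator
      (fun s => ENNReal.ofReal (s ^ (q - 1))) s = ENNReal.ofReal b ^ q / ENNReal.ofReal q := by
    intro b hb
    rw [lintegral_indicator (measurableSet_lt ENNReal.measurable_ofReal measurable_const),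
      Measure.restrict_restrict (measurableSet_lt ENNReal.measurable_ofReal measurable_const)]
    have : {s : ℝ | ENNReal.ofReal s < ENNReal.ofReal b} ∩ Ioi 0 = Ioo 0 b := by
      ext s
      simp only [mem_inter_iff, mem_ofPred_eq, mem_Ioi, mem_Ioo]
      constructor
      · rintro ⟨h1, h2⟩
        exact ⟨h2, (ENNReal.ofReal_lt_ofReal_iff_of_nonneg h2.le).1 h1⟩
      · rintro ⟨h1, h2⟩
        exact ⟨(ENNReal.ofReal_lt_ofReal_iff_of_nonneg h1.le).2 h2, h1⟩
    rw [this, lintegral_Ioo_rpow hq hb, ENNReal.ofReal_div_of_pos hq,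
      ENNReal.ofReal_rpow_of_nonneg hb hq.le]
  rcases eq_or_ne u ∞ with rfl | hu
  · rw [ENNReal.top_rpow_of_pos hq, ENNReal.top_div_of_ne_top ENNReal.ofReal_ne_top]
    -- The cut-off $b=(rq)^{1/q}$ is chosen so that the integral up to $b$ is exactly $r$; the full
    -- integral exceeds each such value.
    refine ENNReal.eq_top_of_forall_nnreal_le fun r => ?_
    have hb : (0 : ℝ) ≤ ((r : ℝ) * q) ^ (1 / q) := by positivity
    have h := hfin _ hb
    have h2 : ENNReal.ofReal (((r : ℝ) * q) ^ (1 / q)) ^ q / ENNReal.ofReal q = r := by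
      rw [ENNReal.ofReal_rpow_of_nonneg hb hq.le, ← Real.rpow_mul (by positivity),
        one_div_mul_cancel hq.ne', Real.rpow_one, ← ENNReal.ofReal_div_of_pos hq,
        mul_div_cancel_right₀ _ hq.ne', ENNReal.ofReal_coe_nnreal]
    rw [← h2, ← h]
    refine lintegral_mono fun s => indicator_le_indicator_of_subset (fun s hs => ?_) (by simp) _
    exact lt_of_lt_of_le (show ENNReal.ofReal s < _ from hs) le_top
  · have := hfin u.toReal ENNReal.toReal_nonneg
    rwa [ENNReal.ofReal_toReal hu] at this

theorem lintegral_indicator_le_rpow {q : ℝ} (hq : 0 < q) {u : ℝ≥0∞} (hu : u ≠ 0) (hu' : u ≠ ∞) :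
    ∫⁻ s in Ioi (0 : ℝ), {s : ℝ | u ≤ ENNReal.ofReal s}.indicator
      (fun s => ENNReal.ofReal (s ^ (-q - 1))) s = u ^ (-q) / ENNReal.ofReal q := by
  have hb : 0 < u.toReal := ENNReal.toReal_pos hu hu'
  rw [← ENNReal.ofReal_toReal hu']
  set b := u.toReal
  rw [lintegral_indicator (measurableSet_le measurable_const ENNReal.measurable_ofReal),
      Measure.restrict_restrict (measurableSet_le measurable_const ENNReal.measurable_ofReal)]
  have : {s : ℝ | ENNReal.ofReal b ≤ ENNReal.ofReal s} ∩ Ioi 0 = Ici b := by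
    ext s
    simp only [mem_inter_iff, mem_ofPred_eq, mem_Ioi, mem_Ici]
    constructor
    · rintro ⟨h1, h2⟩
      exact (ENNReal.ofReal_le_ofReal_iff h2.le).1 h1
    · intro h
      exact ⟨ENNReal.ofReal_le_ofReal h, hb.trans_le h⟩
  rw [this, setLIntegral_congr Ioi_ae_eq_Ici.symm, lintegral_Ioi_rpow hq hb,
    ENNReal.ofReal_div_of_pos hq, ENNReal.ofReal_rpow_of_pos hb]

variable {X : Type*} [MeasurableSpace X]

theorem lintegral_rpow_eq_lintegral_meas {μ : Measure X} [SFinite μ] {g : X → ℝ≥0∞}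
    (hg : AEMeasurable g μ) {p : ℝ} (hp : 0 < p) :
    ∫⁻ x, g x ^ p ∂μ = ENNReal.ofReal p *
      ∫⁻ s in Ioi (0 : ℝ), ENNReal.ofReal (s ^ (p - 1)) * μ {x | ENNReal.ofReal s < g x} := by
  wlog hgm : Measurable g generalizing g
  · have h1 : ∫⁻ x, g x ^ p ∂μ = ∫⁻ x, hg.mk g x ^ p ∂μ :=
      lintegral_congr_ae (hg.ae_eq_mk.mono fun x hx => by simp only [hx])
    rw [h1, this hg.measurable_mk.aemeasurable hg.measurable_mk]
    congr 1
    refine lintegral_congr fun s => ?_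
    congr 1
    exact measure_congr (hg.ae_eq_mk.symm.mono fun x hx => by
      simp only [eq_iff_iff]; change _ < _ ↔ _ < _; rw [hx])
  have hp0 : ENNReal.ofReal p ≠ 0 := by simpa using hp
  have h1 : ∀ s : ℝ, ENNReal.ofReal (s ^ (p - 1)) * μ {x | ENNReal.ofReal s < g x} =
      ∫⁻ x, {s : ℝ | ENNReal.ofReal s < g x}.indicator
        (fun s => ENNReal.ofReal (s ^ (p - 1))) s ∂μ := by
    intro s
    rw [← lintegral_indicator_const (measurableSet_lt measurable_const hgm)]
    rfl
  simp only [h1]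
  rw [lintegral_lintegral_swap]
  · simp only [lintegral_indicator_lt_rpow hp]
    rw [← lintegral_const_mul' _ _ ENNReal.ofReal_ne_top]
    refine lintegral_congr fun x => ?_
    rw [ENNReal.mul_div_cancel hp0 ENNReal.ofReal_ne_top]
  · have hS : MeasurableSet {z : ℝ × X | ENNReal.ofReal z.1 < g z.2} :=
      measurableSet_lt (ENNReal.measurable_ofReal.comp measurable_fst) (hgm.comp measurable_snd)
    have : Measurable ({z : ℝ × X | ENNReal.ofReal z.1 < g z.2}.indicator
        (fun z => ENNReal.ofReal (z.1 ^ (p - 1)))) :=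
      (Measurable.ennreal_ofReal (measurable_fst.pow_const _)).indicator hS
    exact this.aemeasurable

theorem lintegral_rpow_mul_setLIntegral_lt {μ : Measure X} [SFinite μ] {u v : X → ℝ≥0∞}
    (hu : Measurable u) (hv : Measurable v) {q : ℝ} (hq : 0 < q) :
    ∫⁻ s in Ioi (0 : ℝ), ENNReal.ofReal (s ^ (q - 1)) * ∫⁻ x in {x | ENNReal.ofReal s < u x}, v x ∂μ
      = ∫⁻ x, u x ^ q / ENNReal.ofReal q * v x ∂μ := by
  have h1 : ∀ s : ℝ, ENNReal.ofReal (s ^ (q - 1)) * ∫⁻ x in {x | ENNReal.ofReal s < u x}, v x ∂μ =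
      ∫⁻ x, {s : ℝ | ENNReal.ofReal s < u x}.indicator
        (fun s => ENNReal.ofReal (s ^ (q - 1))) s * v x ∂μ := by
    intro s
    rw [← lintegral_const_mul' _ _ ENNReal.ofReal_ne_top,
      ← lintegral_indicator (measurableSet_lt measurable_const hu)]
    refine lintegral_congr fun x => ?_
    by_cases h : ENNReal.ofReal s < u x <;> simp [indicator, h]
  simp only [h1]
  rw [lintegral_lintegral_swap]
  · refine lintegral_congr fun x => ?_
    rw [lintegral_mul_const _, lintegral_indicator_lt_rpow hq]
    exact (measurable_ofReal_rpow _).indicator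
      (measurableSet_lt ENNReal.measurable_ofReal measurable_const)
  · have hS : MeasurableSet {z : ℝ × X | ENNReal.ofReal z.1 < u z.2} :=
      measurableSet_lt (ENNReal.measurable_ofReal.comp measurable_fst) (hu.comp measurable_snd)
    have : Measurable ({z : ℝ × X | ENNReal.ofReal z.1 < u z.2}.indicator
        (fun z => ENNReal.ofReal (z.1 ^ (q - 1)))) :=
      (Measurable.ennreal_ofReal (measurable_fst.pow_const _)).indicator hS
    exact (this.mul (hv.comp measurable_snd)).aemeasurable

/-- Tonelli's theorem. The inner integral stays unevaluated because it diverges where $u=0$; in the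
application $v=u^2$ vanishes there. -/
theorem lintegral_rpow_mul_setLIntegral_le {μ : Measure X} [SFinite μ] {u v : X → ℝ≥0∞}
    (hu : Measurable u) (hv : Measurable v) (q : ℝ) :
    ∫⁻ s in Ioi (0 : ℝ), ENNReal.ofReal (s ^ (-q - 1)) *
        ∫⁻ x in {x | u x ≤ ENNReal.ofReal s}, v x ∂μ
      = ∫⁻ x, (∫⁻ s in Ioi (0 : ℝ), {s : ℝ | u x ≤ ENNReal.ofReal s}.indicator
      (fun s => ENNReal.ofReal (s ^ (-q - 1))) s) * v x ∂μ := by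
  have h1 : ∀ s : ℝ, ENNReal.ofReal (s ^ (-q - 1)) *
      ∫⁻ x in {x | u x ≤ ENNReal.ofReal s}, v x ∂μ =
      ∫⁻ x, {s : ℝ | u x ≤ ENNReal.ofReal s}.indicator
        (fun s => ENNReal.ofReal (s ^ (-q - 1))) s * v x ∂μ := by
    intro s
    rw [← lintegral_const_mul' _ _ ENNReal.ofReal_ne_top,
      ← lintegral_indicator (measurableSet_le hu measurable_const)]
    refine lintegral_congr fun x => ?_
    by_cases h : u x ≤ ENNReal.ofReal s <;> simp [indicator, h]
  simp only [h1]
  rw [lintegral_lintegral_swap]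
  · refine lintegral_congr fun x => ?_
    rw [lintegral_mul_const _]
    exact (measurable_ofReal_rpow _).indicator
      (measurableSet_le measurable_const ENNReal.measurable_ofReal)
  · have hS : MeasurableSet {z : ℝ × X | u z.2 ≤ ENNReal.ofReal z.1} :=
      measurableSet_le (hu.comp measurable_snd) (ENNReal.measurable_ofReal.comp measurable_fst)
    have : Measurable ({z : ℝ × X | u z.2 ≤ ENNReal.ofReal z.1}.indicator
        (fun z => ENNReal.ofReal (z.1 ^ (-q - 1)))) :=
      (Measurable.ennreal_ofReal (measurable_fst.pow_const _)).indicator hS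
    exact (this.mul (hv.comp measurable_snd)).aemeasurable

/-- Kolmogorov's inequality. -/
theorem lintegral_rpow_le_of_weakType {ν : Measure X} [SFinite ν] {g : X → ℝ≥0∞}
    (hg : AEMeasurable g ν) {q η : ℝ} (hη : 0 < η) (hηq : η < q) {P : ℝ≥0∞}
    (hweak : ∀ s : ℝ, 0 < s → ν {x | ENNReal.ofReal s < g x} ≤ ENNReal.ofReal (s ^ (-q)) * P)
    {s₀ : ℝ} (hs₀ : 0 < s₀) :
    ∫⁻ x, g x ^ η ∂ν ≤ ENNReal.ofReal (s₀ ^ η) * ν univ +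
      ENNReal.ofReal (η / (q - η)) * ENNReal.ofReal (s₀ ^ (η - q)) * P := by
  have hq : 0 < q - η := by linarith
  rw [lintegral_rpow_eq_lintegral_meas hg hη]
  -- Below $s_0$ the trivial bound $\nu(X)$ is used, above it the weak type bound; $\eta<q$ makes
  -- the second integral converge.
  have hsplit : Ioi (0 : ℝ) = Ioc 0 s₀ ∪ Ioi s₀ := (Ioc_union_Ioi_eq_Ioi hs₀.le).symm
  rw [hsplit]
  refine (mul_le_mul_right (lintegral_union_le _ _ _) _).trans ?_
  rw [mul_add]
  gcongr ?_ + ?_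
  · calc ENNReal.ofReal η * ∫⁻ s in Ioc 0 s₀,
        ENNReal.ofReal (s ^ (η - 1)) * ν {x | ENNReal.ofReal s < g x}
        ≤ ENNReal.ofReal η * ∫⁻ s in Ioc 0 s₀, ENNReal.ofReal (s ^ (η - 1)) * ν univ := by
          gcongr; exact subset_univ _
      _ = ENNReal.ofReal (s₀ ^ η) * ν univ := by
          rw [lintegral_mul_const _ (measurable_ofReal_rpow _),
            setLIntegral_congr Ioo_ae_eq_Ioc.symm, lintegral_Ioo_rpow hη hs₀.le, ← mul_assoc,
            ← ENNReal.ofReal_mul hη.le, mul_div_cancel₀ _ hη.ne']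
  · calc ENNReal.ofReal η * ∫⁻ s in Ioi s₀,
        ENNReal.ofReal (s ^ (η - 1)) * ν {x | ENNReal.ofReal s < g x}
        ≤ ENNReal.ofReal η * ∫⁻ s in Ioi s₀, ENNReal.ofReal (s ^ (-(q - η) - 1)) * P := by
          refine mul_le_mul_right (setLIntegral_mono' measurableSet_Ioi fun s hs => ?_) _
          have hs0 : 0 < s := hs₀.trans hs
          refine (mul_le_mul_right (hweak s hs0) _).trans ?_
          rw [← mul_assoc, ← ENNReal.ofReal_mul (by positivity), ← Real.rpow_add hs0]
          apply le_of_eq; congr 3; ring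
      _ = ENNReal.ofReal (η / (q - η)) * ENNReal.ofReal (s₀ ^ (η - q)) * P := by
          rw [lintegral_mul_const _ (measurable_ofReal_rpow _),
            lintegral_Ioi_rpow hq hs₀, ← mul_assoc,
            ← ENNReal.ofReal_mul hη.le, ← ENNReal.ofReal_mul (by positivity), neg_sub]
          congr 2; ring

/-- Boundedness empties the level sets above $b$, and on $(0,b)$ the weak bound leaves $s^{q-2}$,
which is integrable at $0$ because $q>1$. -/
theorem lintegral_rpow_lt_top_of_weakType_of_le {ν : Measure X} [SFinite ν] {g : X → ℝ≥0∞}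
    (hg : AEMeasurable g ν) {q : ℝ} (hq : 1 < q) {P : ℝ≥0∞} (hP : P ≠ ∞)
    (hweak : ∀ s : ℝ, 0 < s → ν {x | ENNReal.ofReal s < g x} ≤ ENNReal.ofReal s⁻¹ * P)
    {b : ℝ} (hb : 0 ≤ b) (hgb : ∀ x, g x ≤ ENNReal.ofReal b) :
    ∫⁻ x, g x ^ q ∂ν < ∞ := by
  rw [lintegral_rpow_eq_lintegral_meas hg (by linarith)]
  refine ENNReal.mul_lt_top ENNReal.ofReal_lt_top ?_
  calc ∫⁻ s in Ioi (0 : ℝ), ENNReal.ofReal (s ^ (q - 1)) * ν {x | ENNReal.ofReal s < g x}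
      ≤ ∫⁻ s in Ioi (0 : ℝ), (Ioo 0 b).indicator
          (fun s => ENNReal.ofReal (s ^ ((q - 1) - 1)) * P) s := by
        refine setLIntegral_mono' measurableSet_Ioi fun s (hs : 0 < s) => ?_
        by_cases hsb : s < b
        · rw [indicator_of_mem (show s ∈ Ioo 0 b from ⟨hs, hsb⟩)]
          refine (mul_le_mul_right (hweak s hs) _).trans ?_
          rw [← mul_assoc, ← ENNReal.ofReal_mul (by positivity), ← Real.rpow_neg_one s,
            ← Real.rpow_add hs]
          rfl
        · have : {x | ENNReal.ofReal s < g x} = ∅ := by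
            refine eq_empty_of_forall_notMem fun x hx => hsb ?_
            exact (ENNReal.ofReal_lt_ofReal_iff_of_nonneg hs.le).1 (lt_of_lt_of_le hx (hgb x))
          simp [this]
    _ ≤ ∫⁻ s, (Ioo 0 b).indicator
          (fun s => ENNReal.ofReal (s ^ ((q - 1) - 1)) * P) s := setLIntegral_le_lintegral _ _
    _ = ENNReal.ofReal (b ^ (q - 1) / (q - 1)) * P := by
        rw [lintegral_indicator measurableSet_Ioo,
          lintegral_mul_const _ (measurable_ofReal_rpow _),
          lintegral_Ioo_rpow (by linarith) hb]
    _ < ∞ := ENNReal.mul_lt_top ENNReal.ofReal_lt_top hP.lt_top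

end NonHomog

namespace NonHomog

/-! ### The maximal function -/

/-- The supremum of `μ(ρ Q)⁻¹ ∫_Q u dμ` over the open balls `Q` containing `x`. -/
noncomputable def ballAvgSup {X : Type*} [MetricSpace X] [MeasurableSpace X]
    (μ : Measure X) (ρ : ℝ) (u : X → ℝ≥0∞) (x : X) : ℝ≥0∞ :=
  ⨆ (c : X) (r : ℝ) (_ : x ∈ Metric.ball c r),
    (μ (Metric.ball c (ρ * r)))⁻¹ * ∫⁻ y in Metric.ball c r, u y ∂μ

section Maximal

variable {X : Type*} [MetricSpace X] [MeasurableSpace X] {μ : Measure X}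

theorem maximalFun_eq {𝕜 : Type*} [RCLike 𝕜] {p : ℝ} (hp : 0 < p) (ρ : ℝ) (f : X → 𝕜) (x : X) :
    maximalFun μ p ρ f x = ballAvgSup μ ρ (fun y => ‖f y‖ₑ ^ p) x ^ (1 / p) := by
  change _ = ENNReal.orderIsoRpow (1 / p) (one_div_pos.2 hp) _
  simp only [ballAvgSup, OrderIso.map_iSup]
  rfl

theorem le_ballAvgSup (ρ : ℝ) (u : X → ℝ≥0∞) {x c : X} {r : ℝ} (hx : x ∈ Metric.ball c r) :
    (μ (Metric.ball c (ρ * r)))⁻¹ * ∫⁻ y in Metric.ball c r, u y ∂μ ≤ ballAvgSup μ ρ u x :=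
  le_iSup_of_le c (le_iSup_of_le r (le_iSup_of_le hx le_rfl))

/-- Since the balls are not required to be centred at $x$, a ball with large average lies entirely
in the superlevel set. This makes maximal functions measurable for arbitrary $u$. -/
theorem isOpen_lt_ballAvgSup (ρ : ℝ) (u : X → ℝ≥0∞) (s : ℝ≥0∞) :
    IsOpen {x | s < ballAvgSup μ ρ u x} := by
  have : {x | s < ballAvgSup μ ρ u x} = ⋃ (c : X) (r : ℝ)
      (_ : s < (μ (Metric.ball c (ρ * r)))⁻¹ * ∫⁻ y in Metric.ball c r, u y ∂μ),
        Metric.ball c r := by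
    ext x
    simp only [ballAvgSup, mem_ofPred_eq, lt_iSup_iff, mem_iUnion]
    constructor
    · rintro ⟨c, r, h1, h2⟩
      exact ⟨c, r, h2, h1⟩
    · rintro ⟨c, r, h1, h2⟩
      exact ⟨c, r, h2, h1⟩
  rw [this]
  exact isOpen_iUnion fun c => isOpen_iUnion fun r => isOpen_iUnion fun _ => Metric.isOpen_ball

theorem measurable_ballAvgSup [BorelSpace X] (ρ : ℝ) (u : X → ℝ≥0∞) :
    Measurable (ballAvgSup μ ρ u) :=
  measurable_of_Ioi fun s => (isOpen_lt_ballAvgSup ρ u s).measurableSet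

theorem measurable_maximalFun [BorelSpace X] {𝕜 : Type*} [RCLike 𝕜] {p : ℝ} (hp : 0 < p) (ρ : ℝ)
    (f : X → 𝕜) : Measurable (maximalFun μ p ρ f) := by
  have : maximalFun μ p ρ f = fun x => ballAvgSup μ ρ (fun y => ‖f y‖ₑ ^ p) x ^ (1 / p) :=
    funext fun x => maximalFun_eq hp ρ f x
  rw [this]
  exact (measurable_ballAvgSup ρ _).pow_const _

theorem ballAvgSup_anti {ρ ρ' : ℝ} (h : ρ ≤ ρ') (u : X → ℝ≥0∞) (x : X) :
    ballAvgSup μ ρ' u x ≤ ballAvgSup μ ρ u x := by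
  refine iSup_le fun c => iSup_le fun r => iSup_le fun hx => ?_
  refine le_trans ?_ (le_ballAvgSup ρ u hx)
  have : 0 < r := Metric.pos_of_mem_ball hx
  gcongr

/-- Because $\rho\ge1$, a constant has normalised average at most itself. This permits truncating
$u$ at height $s$. -/
theorem ballAvgSup_le_add (u : X → ℝ≥0∞) {ρ : ℝ} (hρ : 1 ≤ ρ) {v : X → ℝ≥0∞} (hv : Measurable v)
    {s : ℝ≥0∞} (huv : ∀ y, u y ≤ v y + s) (x : X) :
    ballAvgSup μ ρ u x ≤ ballAvgSup μ ρ v x + s := by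
  refine iSup_le fun c => iSup_le fun r => iSup_le fun hx => ?_
  have hr : 0 < r := Metric.pos_of_mem_ball hx
  calc (μ (Metric.ball c (ρ * r)))⁻¹ * ∫⁻ y in Metric.ball c r, u y ∂μ
      ≤ (μ (Metric.ball c (ρ * r)))⁻¹ * ∫⁻ y in Metric.ball c r, (v y + s) ∂μ := by
        gcongr with y; exact huv y
    _ = (μ (Metric.ball c (ρ * r)))⁻¹ * ∫⁻ y in Metric.ball c r, v y ∂μ
        + (μ (Metric.ball c (ρ * r)))⁻¹ * (s * μ (Metric.ball c r)) := by
        rw [lintegral_add_left hv, setLIntegral_const, mul_add]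
    _ ≤ ballAvgSup μ ρ v x + s := by
        refine add_le_add (le_ballAvgSup ρ v hx) ?_
        have h1 : μ (Metric.ball c r) ≤ μ (Metric.ball c (ρ * r)) :=
          measure_mono (Metric.ball_subset_ball (by nlinarith))
        calc (μ (Metric.ball c (ρ * r)))⁻¹ * (s * μ (Metric.ball c r))
            ≤ (μ (Metric.ball c (ρ * r)))⁻¹ * (s * μ (Metric.ball c (ρ * r))) := by gcongr
          _ = s * ((μ (Metric.ball c (ρ * r)))⁻¹ * μ (Metric.ball c (ρ * r))) := by ring
          _ ≤ s * 1 := by gcongr; exact ENNReal.inv_mul_le_one _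
          _ = s := mul_one s

/-- Vitali's covering lemma: disjoint balls are selected whose fivefold dilations cover. The
normalisation is by $\mu(5Q)$, so the measure of those dilations is controlled with no doubling
hypothesis. -/
theorem mul_meas_ballAvgSup_le [BorelSpace X] [SecondCountableTopology X] {ρ : ℝ} (hρ : 5 ≤ ρ)
    (u : X → ℝ≥0∞) (s : ℝ≥0∞) :
    s * μ {x | s < ballAvgSup μ ρ u x} ≤ ∫⁻ x, u x ∂μ := by
  wlog h5 : ρ = 5 generalizing ρ
  · refine le_trans ?_ (this le_rfl rfl)
    gcongr
    exact ballAvgSup_anti hρ u _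
  subst h5
  rcases eq_or_ne s 0 with rfl | hs
  · simp
  -- Vitali selection needs bounded radii; the cap $n$ is removed at the end by monotone
  -- convergence.
  let V : ℕ → Set (X × ℝ) := fun n => {a | a.2 ≤ n ∧
    s < (μ (Metric.ball a.1 (5 * a.2)))⁻¹ * ∫⁻ y in Metric.ball a.1 a.2, u y ∂μ}
  let W : ℕ → Set X := fun n => ⋃ a ∈ V n, Metric.ball a.1 a.2
  have hW : {x | s < ballAvgSup μ 5 u x} = ⋃ n, W n := by
    ext x
    simp only [ballAvgSup, mem_ofPred_eq, lt_iSup_iff, mem_iUnion, W]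
    constructor
    · rintro ⟨c, r, h1, h2⟩
      obtain ⟨n, hn⟩ := exists_nat_ge r
      exact ⟨n, (c, r), ⟨hn, h2⟩, h1⟩
    · rintro ⟨n, a, ha, h1⟩
      exact ⟨a.1, a.2, h1, ha.2⟩
  have hmono : Monotone W := by
    intro m n hmn
    refine biUnion_subset_biUnion_left fun a ha => ⟨ha.1.trans (by exact_mod_cast hmn), ha.2⟩
  have hWn : ∀ n, s * μ (W n) ≤ ∫⁻ x, u x ∂μ := by
    intro n
    obtain ⟨t, htV, hdisj, hcov⟩ := Vitali.exists_disjoint_subfamily_covering_enlargement_ball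
      (V n) (fun a => a.1) (fun a => a.2) n (fun a ha => ha.1) 5 (by norm_num)
    have hpos : ∀ a ∈ t, (Metric.ball a.1 a.2).Nonempty := by
      intro a ha
      by_contra hne
      rw [not_nonempty_iff_eq_empty] at hne
      have := (htV ha).2
      simp [hne] at this
    have hcount : t.Countable :=
      hdisj.countable_of_isOpen (fun a _ => Metric.isOpen_ball) hpos
    have hsub : W n ⊆ ⋃ a ∈ t, Metric.ball a.1 (5 * a.2) := by
      intro x hx
      obtain ⟨a, ha, hxa⟩ := mem_iUnion₂.1 hx
      obtain ⟨b, hb, hab⟩ := hcov a ha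
      exact mem_iUnion₂.2 ⟨b, hb, hab hxa⟩
    calc s * μ (W n) ≤ s * ∑' a : t, μ (Metric.ball a.1.1 (5 * a.1.2)) := by
          gcongr
          exact (measure_mono hsub).trans (measure_biUnion_le μ hcount _)
      _ = ∑' a : t, s * μ (Metric.ball a.1.1 (5 * a.1.2)) := ENNReal.tsum_mul_left.symm
      _ ≤ ∑' a : t, ∫⁻ y in Metric.ball a.1.1 a.1.2, u y ∂μ := by
          refine ENNReal.tsum_le_tsum fun a => ?_
          have h2 := (htV a.2).2
          rw [mul_comm, ← div_eq_mul_inv] at h2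
          exact (ENNReal.mul_lt_of_lt_div h2).le
      _ = ∫⁻ y in ⋃ a ∈ t, Metric.ball a.1 a.2, u y ∂μ :=
          (lintegral_biUnion hcount (fun a _ => Metric.isOpen_ball.measurableSet) hdisj u).symm
      _ ≤ ∫⁻ x, u x ∂μ := setLIntegral_le_lintegral _ _
  rw [hW, hmono.measure_iUnion, ENNReal.mul_iSup]
  exact iSup_le hWn

theorem meas_ballAvgSup_le [BorelSpace X] [SecondCountableTopology X] {ρ : ℝ} (hρ : 5 ≤ ρ)
    (u : X → ℝ≥0∞) {s : ℝ} (hs : 0 < s) :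
    μ {x | ENNReal.ofReal s < ballAvgSup μ ρ u x} ≤ ENNReal.ofReal s⁻¹ * ∫⁻ x, u x ∂μ := by
  have := mul_meas_ballAvgSup_le (μ := μ) hρ u (ENNReal.ofReal s)
  rw [ENNReal.ofReal_inv_of_pos hs, mul_comm, ← div_eq_mul_inv]
  rw [ENNReal.le_div_iff_mul_le (Or.inl (by simpa using hs)) (Or.inl ENNReal.ofReal_ne_top)]
  rwa [mul_comm]

/-- The maximal function of exponent `p` is of weak type `(p, p)`. -/
theorem meas_maximalFun_le [BorelSpace X] [SecondCountableTopology X] {𝕜 : Type*} [RCLike 𝕜]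
    {p : ℝ} (hp : 0 < p) {ρ : ℝ} (hρ : 5 ≤ ρ) (f : X → 𝕜) {s : ℝ} (hs : 0 < s) :
    μ {x | ENNReal.ofReal s < maximalFun μ p ρ f x} ≤
      ENNReal.ofReal (s ^ (-p)) * ∫⁻ x, ‖f x‖ₑ ^ p ∂μ := by
  have h := meas_ballAvgSup_le (μ := μ) hρ (fun y => ‖f y‖ₑ ^ p) (Real.rpow_pos_of_pos hs p)
  rw [← Real.rpow_neg hs.le] at h
  refine le_trans (measure_mono fun x hx => ?_) h
  rw [mem_ofPred_eq, maximalFun_eq hp] at hx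
  have h2 := ENNReal.rpow_lt_rpow hx hp
  rwa [← ENNReal.rpow_mul, one_div_mul_cancel hp.ne', ENNReal.rpow_one,
    ENNReal.ofReal_rpow_of_pos hs] at h2

/-- Marcinkiewicz interpolation with the trivial $L^\infty$ bound: if $Mu>2s$ then the part of $u$
above height $s$ has maximal function above $s$. The factor $2^q$ comes from this halving, $q/(q-1)$
from the layer-cake integrals. -/
theorem lintegral_ballAvgSup_rpow_le [BorelSpace X] [SecondCountableTopology X] [SFinite μ]
    {q : ℝ} (hq : 1 < q) : ∃ C : ℝ≥0, ∀ {ρ : ℝ}, 5 ≤ ρ → ∀ {u : X → ℝ≥0∞}, AEMeasurable u μ →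
      ∫⁻ x, ballAvgSup μ ρ u x ^ q ∂μ ≤ C * ∫⁻ x, u x ^ q ∂μ := by
  have hq0 : 0 < q := by linarith
  have hq1 : 0 < q - 1 := by linarith
  refine ⟨(2 ^ q * q / (q - 1)).toNNReal, fun {ρ} hρ {u} hu => ?_⟩
  wlog hum : Measurable u generalizing u
  · have h1 : ∫⁻ x, u x ^ q ∂μ = ∫⁻ x, hu.mk u x ^ q ∂μ :=
      lintegral_congr_ae (hu.ae_eq_mk.mono fun x hx => by simp only [hx])
    have h2 : ballAvgSup μ ρ u = ballAvgSup μ ρ (hu.mk u) := by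
      funext x
      simp only [ballAvgSup]
      congr! 6 with c r hx
      exact lintegral_congr_ae (ae_restrict_of_ae hu.ae_eq_mk)
    rw [h1, h2]
    exact this hu.measurable_mk.aemeasurable hu.measurable_mk
  have hweak : ∀ s : ℝ, 0 < s → μ {x | ENNReal.ofReal s < ballAvgSup μ ρ u x / 2} ≤
      ENNReal.ofReal s⁻¹ * ∫⁻ x in {x | ENNReal.ofReal s < u x}, u x ∂μ := by
    intro s hs
    set S := {x | ENNReal.ofReal s < u x} with hS
    have hSm : MeasurableSet S := measurableSet_lt measurable_const hum
    have h := meas_ballAvgSup_le (μ := μ) hρ (S.indicator u) hs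
    rw [lintegral_indicator hSm] at h
    refine le_trans (measure_mono fun x hx => ?_) h
    rw [mem_ofPred_eq] at hx
    have h1 : ballAvgSup μ ρ u x ≤ ballAvgSup μ ρ (S.indicator u) x + ENNReal.ofReal s := by
      refine ballAvgSup_le_add u (by linarith) (hum.indicator hSm) (fun y => ?_) x
      by_cases hy : y ∈ S
      · simp [hy]
      · rw [indicator_of_notMem hy, zero_add]
        exact not_lt.1 hy
    rw [ENNReal.lt_div_iff_mul_lt (by simp) (by simp), mul_two] at hx
    have := hx.trans_le h1
    exact (ENNReal.add_lt_add_iff_right ENNReal.ofReal_ne_top).1 this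
  have hmeas : AEMeasurable (fun x => ballAvgSup μ ρ u x / 2) μ :=
    ((measurable_ballAvgSup ρ u).div_const 2).aemeasurable
  have h1 : ∫⁻ x, (ballAvgSup μ ρ u x / 2) ^ q ∂μ ≤
      ENNReal.ofReal (q / (q - 1)) * ∫⁻ x, u x ^ q ∂μ := by
    rw [lintegral_rpow_eq_lintegral_meas hmeas hq0]
    calc ENNReal.ofReal q * ∫⁻ s in Ioi (0 : ℝ), ENNReal.ofReal (s ^ (q - 1)) *
          μ {x | ENNReal.ofReal s < ballAvgSup μ ρ u x / 2}
        ≤ ENNReal.ofReal q * ∫⁻ s in Ioi (0 : ℝ), ENNReal.ofReal (s ^ ((q - 1) - 1)) *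
            ∫⁻ x in {x | ENNReal.ofReal s < u x}, u x ∂μ := by
          refine mul_le_mul_right (setLIntegral_mono' measurableSet_Ioi fun s (hs : 0 < s) => ?_) _
          refine (mul_le_mul_right (hweak s hs) _).trans ?_
          rw [← mul_assoc, ← ENNReal.ofReal_mul (by positivity), ← Real.rpow_neg_one s,
            ← Real.rpow_add hs]
          rfl
      _ = ENNReal.ofReal q * ∫⁻ x, u x ^ (q - 1) / ENNReal.ofReal (q - 1) * u x ∂μ := by
          rw [lintegral_rpow_mul_setLIntegral_lt hum hum hq1]
      _ ≤ ENNReal.ofReal q * ∫⁻ x, (ENNReal.ofReal (q - 1))⁻¹ * u x ^ q ∂μ := by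
          refine mul_le_mul_right (lintegral_mono fun x => ?_) _
          rw [div_eq_mul_inv, mul_comm (u x ^ (q - 1)), mul_assoc]
          refine mul_le_mul_right (le_of_eq ?_) _
          have : q = (q - 1) + 1 := by ring
          conv_rhs => rw [this, ENNReal.rpow_add_of_nonneg _ _ hq1.le zero_le_one, ENNReal.rpow_one]
      _ = ENNReal.ofReal (q / (q - 1)) * ∫⁻ x, u x ^ q ∂μ := by
          rw [lintegral_const_mul _ (hum.pow_const _), ← mul_assoc,
            ENNReal.ofReal_div_of_pos hq1, div_eq_mul_inv]
  calc ∫⁻ x, ballAvgSup μ ρ u x ^ q ∂μ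
      = ∫⁻ x, 2 ^ q * (ballAvgSup μ ρ u x / 2) ^ q ∂μ := by
        refine lintegral_congr fun x => ?_
        rw [← ENNReal.mul_rpow_of_nonneg _ _ hq0.le, ENNReal.mul_div_cancel (by simp) (by simp)]
    _ = 2 ^ q * ∫⁻ x, (ballAvgSup μ ρ u x / 2) ^ q ∂μ := by
        rw [lintegral_const_mul' _ _ (by simp)]
    _ ≤ 2 ^ q * (ENNReal.ofReal (q / (q - 1)) * ∫⁻ x, u x ^ q ∂μ) := by gcongr
    _ = _ := by
        rw [← mul_assoc]
        congr 1
        have h2 : (2 : ℝ≥0∞) ^ q = ENNReal.ofReal (2 ^ q) := by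
          rw [← ENNReal.ofReal_rpow_of_pos (by norm_num)]; simp
        rw [h2, ← ENNReal.ofReal_mul (by positivity), ENNReal.ofReal, mul_div_assoc]

/-- The $p$-th power is the maximal function of $|f|^\eta$ raised to $p/\eta>1$, so the previous
bound applies. -/
theorem lintegral_maximalFun_rpow_le [BorelSpace X] [SecondCountableTopology X] [SFinite μ]
    {η p : ℝ} (hη : 0 < η) (hp : η < p) : ∃ C : ℝ≥0, ∀ {𝕜 : Type*} [RCLike 𝕜] {ρ : ℝ}, 5 ≤ ρ →
      ∀ {f : X → 𝕜}, AEStronglyMeasurable f μ →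
      ∫⁻ x, maximalFun μ η ρ f x ^ p ∂μ ≤ C * ∫⁻ x, ‖f x‖ₑ ^ p ∂μ := by
  obtain ⟨C, hC⟩ := lintegral_ballAvgSup_rpow_le (μ := μ) ((one_lt_div hη).2 hp)
  refine ⟨C, fun {𝕜} _ {ρ} hρ {f} hf => ?_⟩
  have := hC hρ (hf.enorm.pow_const η)
  simp only [← ENNReal.rpow_mul, mul_div_cancel₀ _ hη.ne'] at this
  convert this using 3 with x
  rw [maximalFun_eq hη, ← ENNReal.rpow_mul, one_div_mul_eq_div]

end Maximal

end NonHomog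

namespace NonHomog

/-! ### The dominating function and kernel estimates -/

/-- The dominating function with values in `[0, ∞]`. -/
noncomputable def edom {X : Type*} (lam : X → ℝ → ℝ) (x : X) (r : ℝ) : ℝ≥0∞ :=
  ENNReal.ofReal (lam x r)

section Dominating

variable {X : Type*} [MetricSpace X] [MeasurableSpace X] {μ : Measure X} {lam : X → ℝ → ℝ}

theorem measurableSet_le_dist [BorelSpace X] (x : X) (ε : ℝ) : MeasurableSet {y | ε ≤ dist x y} :=
  (isClosed_le continuous_const (continuous_const.dist continuous_id)).measurableSet

theorem measurableSet_dist_lt [BorelSpace X] (x : X) (ε : ℝ) : MeasurableSet {y | dist x y < ε} :=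
  (isOpen_lt (continuous_const.dist continuous_id) continuous_const).measurableSet

theorem IsDominating.edom_ne_zero (h : IsDominating μ lam) (x : X) {r : ℝ} (hr : 0 < r) :
    edom lam x r ≠ 0 := by
  simpa [edom] using h.pos x r hr

omit [MetricSpace X] [MeasurableSpace X] in
theorem edom_ne_top (x : X) (r : ℝ) : edom lam x r ≠ ∞ := ENNReal.ofReal_ne_top

theorem IsDominating.edom_mono (h : IsDominating μ lam) (x : X) {r s : ℝ} (hr : 0 < r)
    (hrs : r ≤ s) : edom lam x r ≤ edom lam x s :=
  ENNReal.ofReal_le_ofReal (h.mono x hr (hr.trans_le hrs) hrs)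

theorem IsDominating.inv_edom_anti (h : IsDominating μ lam) (x : X) {r s : ℝ} (hr : 0 < r)
    (hrs : r ≤ s) : (edom lam x s)⁻¹ ≤ (edom lam x r)⁻¹ :=
  ENNReal.inv_le_inv.2 (h.edom_mono x hr hrs)

theorem IsDominating.measure_ball_lt_top (h : IsDominating μ lam) (x : X) (r : ℝ) :
    μ (Metric.ball x r) < ∞ := by
  rcases le_or_gt r 0 with hr | hr
  · simp [Metric.ball_eq_empty.2 hr]
  · exact (h.measure_ball_le x r hr).trans_lt ENNReal.ofReal_lt_top

theorem IsDominating.isLocallyFiniteMeasure (h : IsDominating μ lam) :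
    IsLocallyFiniteMeasure μ :=
  ⟨fun x => ⟨Metric.ball x 1, Metric.ball_mem_nhds x one_pos, h.measure_ball_lt_top x 1⟩⟩

theorem IsDominating.measure_lt_top_of_isBounded (h : IsDominating μ lam) {s : Set X}
    (hs : Bornology.IsBounded s) : μ s < ∞ := by
  rcases s.eq_empty_or_nonempty with rfl | ⟨x, -⟩
  · simp
  · obtain ⟨r, hr⟩ := hs.subset_ball x
    exact (measure_mono hr).trans_lt (h.measure_ball_lt_top x r)

theorem IsDominating.exists_dilation (h : IsDominating μ lam) {a : ℝ} (ha : 0 < a) :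
    ∃ D : ℝ≥0, 1 ≤ D ∧ ∀ x r, 0 < r → edom lam x (a * r) ≤ D * edom lam x r := by
  obtain ⟨C, hC, hd⟩ := h.doubling
  obtain ⟨n, hn⟩ := pow_unbounded_of_one_lt (max a 1) (one_lt_two : (1 : ℝ) < 2)
  have key : ∀ n : ℕ, ∀ x r, 0 < r → lam x (2 ^ n * r) ≤ C ^ n * lam x r := by
    intro n x r hr
    induction n with
    | zero => simp
    | succ n ih =>
      calc lam x (2 ^ (n + 1) * r) = lam x (2 * (2 ^ n * r)) := by ring_nf
        _ ≤ C * lam x (2 ^ n * r) := hd x _ (by positivity)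
        _ ≤ C * (C ^ n * lam x r) := by gcongr
        _ = C ^ (n + 1) * lam x r := by ring
  refine ⟨max 1 (C ^ n).toNNReal, le_max_left _ _, fun x r hr => ?_⟩
  have ha2 : a ≤ 2 ^ n := (le_max_left a 1).trans hn.le
  calc edom lam x (a * r) ≤ edom lam x (2 ^ n * r) :=
        h.edom_mono x (by positivity) (by gcongr)
    _ ≤ ENNReal.ofReal (C ^ n * lam x r) := ENNReal.ofReal_le_ofReal (key n x r hr)
    _ = ((C ^ n).toNNReal : ℝ≥0∞) * edom lam x r := by
        rw [ENNReal.ofReal_mul (by positivity)]; rfl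
    _ ≤ _ := by gcongr; exact le_max_right _ _

theorem IsDominating.mul_inv_edom_le (h : IsDominating μ lam) {a : ℝ} {D : ℝ≥0}
    (hD : ∀ x r, 0 < r → edom lam x (a * r) ≤ D * edom lam x r) {x : X} {r : ℝ} (hr : 0 < r)
    {m N : ℝ≥0∞} (hm : m ≤ N * edom lam x (a * r)) : (edom lam x r)⁻¹ * m ≤ D * N := by
  calc (edom lam x r)⁻¹ * m ≤ (edom lam x r)⁻¹ * (N * (D * edom lam x r)) := by
        gcongr; exact hm.trans (by gcongr; exact hD x r hr)
    _ = D * N * ((edom lam x r)⁻¹ * edom lam x r) := by ring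
    _ = D * N := by
        rw [ENNReal.inv_mul_cancel (h.edom_ne_zero x hr) (edom_ne_top x r), mul_one]

/-- On the annulus $1/\lambda(x,d(x,y))$ is at most $1/\lambda(x,s)$, which dilation makes
comparable to $1/\lambda(x,as)$, the normalisation of the hypothesis. -/
theorem IsDominating.exists_annulus_bound [BorelSpace X] (h : IsDominating μ lam) {a : ℝ}
    (ha : 0 < a) :
    ∃ C : ℝ≥0, ∀ (u : X → ℝ≥0∞) (N : ℝ≥0∞) (x : X) (s : ℝ), 0 < s →
      ∫⁻ y in Metric.ball x (a * s), u y ∂μ ≤ N * edom lam x (a * s) →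
      ∫⁻ y in {y | s ≤ dist x y ∧ dist x y < a * s}, (edom lam x (dist x y))⁻¹ * u y ∂μ
        ≤ C * N := by
  obtain ⟨D, -, hD⟩ := h.exists_dilation ha
  refine ⟨D, fun u N x s hs hN => ?_⟩
  have hm : MeasurableSet {y | s ≤ dist x y ∧ dist x y < a * s} :=
    (measurableSet_le_dist x _).inter (measurableSet_dist_lt x _)
  calc ∫⁻ y in {y | s ≤ dist x y ∧ dist x y < a * s}, (edom lam x (dist x y))⁻¹ * u y ∂μ
      ≤ ∫⁻ y in {y | s ≤ dist x y ∧ dist x y < a * s}, (edom lam x s)⁻¹ * u y ∂μ := by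
        refine setLIntegral_mono' hm fun y hy => ?_
        gcongr
        exact h.edom_mono x hs hy.1
    _ = (edom lam x s)⁻¹ * ∫⁻ y in {y | s ≤ dist x y ∧ dist x y < a * s}, u y ∂μ :=
        lintegral_const_mul' _ _ (ENNReal.inv_ne_top.2 (h.edom_ne_zero x hs))
    _ ≤ (edom lam x s)⁻¹ * ∫⁻ y in Metric.ball x (a * s), u y ∂μ := by
        gcongr
        intro y hy
        rw [Metric.mem_ball, dist_comm]
        exact hy.2
    _ ≤ D * N := h.mul_inv_edom_le hD hs hN

/-- The set is cut into dyadic annuli. Each contributes a bounded multiple of $N$ times the decay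
$2^{-j\delta}$, and the series is geometric. -/
theorem IsDominating.exists_tail_bound [BorelSpace X] (h : IsDominating μ lam) {δ : ℝ}
    (hδ : 0 < δ) :
    ∃ C : ℝ≥0, ∀ (u : X → ℝ≥0∞) (N : ℝ≥0∞) (x : X) (s : ℝ), 0 < s →
      (∀ ρ, s ≤ ρ → ∫⁻ y in Metric.ball x ρ, u y ∂μ ≤ N * edom lam x ρ) →
      ∫⁻ y in {y | s ≤ dist x y},
        ENNReal.ofReal ((s / dist x y) ^ δ) * (edom lam x (dist x y))⁻¹ * u y ∂μ ≤ C * N := by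
  obtain ⟨C, hC⟩ := h.exists_annulus_bound (a := 2) two_pos
  set q : ℝ≥0∞ := ENNReal.ofReal ((2 : ℝ)⁻¹ ^ δ) with hq
  have hq1 : q < 1 := by
    rw [hq, ENNReal.ofReal_lt_one]
    exact Real.rpow_lt_one (by norm_num) (by norm_num) hδ
  have hqs : (1 - q)⁻¹ ≠ ∞ := by
    rw [ENNReal.inv_ne_top]
    exact (tsub_pos_of_lt hq1).ne'
  refine ⟨(1 - q)⁻¹.toNNReal * C, fun u N x s hs hN => ?_⟩
  set A : ℕ → Set X := fun j => {y | 2 ^ j * s ≤ dist x y ∧ dist x y < 2 * (2 ^ j * s)}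
  have hcov : {y | s ≤ dist x y} ⊆ ⋃ j, A j := by
    intro y hy
    rw [mem_ofPred_eq] at hy
    obtain ⟨n, hn1, hn2⟩ := exists_nat_pow_near ((one_le_div hs).2 hy)
      (one_lt_two : (1 : ℝ) < 2)
    rw [le_div_iff₀ hs] at hn1
    rw [div_lt_iff₀ hs, pow_succ, mul_comm _ (2 : ℝ), mul_assoc] at hn2
    exact mem_iUnion.2 ⟨n, hn1, hn2⟩
  have hAm : ∀ j, MeasurableSet (A j) := fun j =>
    (measurableSet_le_dist x _).inter (measurableSet_dist_lt x _)
  have hA : ∀ j, ∫⁻ y in A j,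
      ENNReal.ofReal ((s / dist x y) ^ δ) * (edom lam x (dist x y))⁻¹ * u y ∂μ
      ≤ q ^ j * (C * N) := by
    intro j
    have hsj : 0 < 2 ^ j * s := by positivity
    calc ∫⁻ y in A j,
      ENNReal.ofReal ((s / dist x y) ^ δ) * (edom lam x (dist x y))⁻¹ * u y ∂μ
        ≤ ∫⁻ y in A j, q ^ j * ((edom lam x (dist x y))⁻¹ * u y) ∂μ := by
          refine setLIntegral_mono' (hAm j) fun y hy => ?_
          rw [mul_assoc]
          gcongr
          rw [hq, ← ENNReal.ofReal_pow (by positivity), ← Real.rpow_mul_natCast (by positivity),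
            mul_comm δ, Real.rpow_natCast_mul (by positivity)]
          gcongr
          rw [div_le_iff₀ (hsj.trans_le hy.1), inv_pow, inv_mul_eq_div, le_div_iff₀ (by positivity),
            mul_comm]
          exact hy.1
      _ = q ^ j * ∫⁻ y in A j, (edom lam x (dist x y))⁻¹ * u y ∂μ :=
          lintegral_const_mul' _ _ (ENNReal.pow_ne_top ENNReal.ofReal_ne_top)
      _ ≤ q ^ j * (C * N) := by
          gcongr
          refine hC u N x _ hsj (hN _ ?_)
          have : (1 : ℝ) ≤ 2 ^ j := one_le_pow₀ one_le_two
          nlinarith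
  calc ∫⁻ y in {y | s ≤ dist x y},
        ENNReal.ofReal ((s / dist x y) ^ δ) * (edom lam x (dist x y))⁻¹ * u y ∂μ
      ≤ ∫⁻ y in ⋃ j, A j,
        ENNReal.ofReal ((s / dist x y) ^ δ) * (edom lam x (dist x y))⁻¹ * u y ∂μ :=
        lintegral_mono_set hcov
    _ ≤ ∑' j, ∫⁻ y in A j,
        ENNReal.ofReal ((s / dist x y) ^ δ) * (edom lam x (dist x y))⁻¹ * u y ∂μ :=
        lintegral_iUnion_le _ _
    _ ≤ ∑' j, q ^ j * (C * N) := ENNReal.tsum_le_tsum hA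
    _ = ((1 - q)⁻¹.toNNReal * C : ℝ≥0) * N := by
        rw [ENNReal.tsum_mul_right, ENNReal.tsum_geometric, ENNReal.coe_mul,
          ENNReal.coe_toNNReal hqs, mul_assoc]

end Dominating

/-- Quantitative size and smoothness bounds for a kernel. -/
structure KernelBounds {X 𝕜 : Type*} [MetricSpace X] [RCLike 𝕜] (lam : X → ℝ → ℝ)
    (K : X → X → 𝕜) (δ a : ℝ) (C : ℝ≥0) : Prop where
  delta_pos : 0 < δ
  two_le : 2 ≤ a
  size_left : ∀ x y, x ≠ y → ‖K x y‖ₑ ≤ C * (edom lam x (dist x y))⁻¹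
  size_right : ∀ x y, x ≠ y → ‖K x y‖ₑ ≤ C * (edom lam y (dist x y))⁻¹
  smooth_left : ∀ x x' y s, x ≠ y → dist x x' ≤ s → a * s ≤ dist x y →
    ‖K x y - K x' y‖ₑ ≤ C * (ENNReal.ofReal ((s / dist x y) ^ δ) * (edom lam x (dist x y))⁻¹)
  smooth_right : ∀ x x' y s, x ≠ y → dist x x' ≤ s → a * s ≤ dist x y →
    ‖K y x - K y x'‖ₑ ≤ C * (ENNReal.ofReal ((s / dist x y) ^ δ) * (edom lam x (dist x y))⁻¹)

/-! ### Continuity and integral estimates for the kernel -/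

section Kernel

variable {X 𝕜 : Type*} [MetricSpace X] [MeasurableSpace X] [RCLike 𝕜] {μ : Measure X}
  {lam : X → ℝ → ℝ} {K : X → X → 𝕜}

theorem IsCZKernel.exists_kernelBounds (h : IsDominating μ lam) (hK : IsCZKernel μ lam K) :
    ∃ δ a C, KernelBounds lam K δ a C := by
  obtain ⟨C₁, hC₁, hsize⟩ := hK.size
  obtain ⟨δ, hδ, -, C₂, hC₂, c, hc, hsm⟩ := hK.smooth
  have hinv : ∀ x y : X, x ≠ y → ∀ z, ENNReal.ofReal (1 / lam z (dist x y)) =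
      (edom lam z (dist x y))⁻¹ := by
    intro x y hxy z
    rw [one_div, ENNReal.ofReal_inv_of_pos (h.pos z _ (dist_pos.2 hxy))]; rfl
  have hsize' : ∀ x y, x ≠ y → ‖K x y‖ₑ ≤ ENNReal.ofReal C₁ *
      min (edom lam x (dist x y))⁻¹ (edom lam y (dist x y))⁻¹ := by
    intro x y hxy
    rw [← hinv x y hxy x, ← hinv x y hxy y, ← ENNReal.ofReal_min, ← ENNReal.ofReal_mul hC₁.le,
      ← ofReal_norm]
    exact ENNReal.ofReal_le_ofReal (hsize x y hxy)
  have hsm' : ∀ x x' y s, x ≠ y → dist x x' ≤ s → max 2 c⁻¹ * s ≤ dist x y →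
      ENNReal.ofReal (C₂ * (dist x x' ^ δ / (dist x y ^ δ * lam x (dist x y)))) ≤
      ENNReal.ofReal C₂ * (ENNReal.ofReal ((s / dist x y) ^ δ) * (edom lam x (dist x y))⁻¹) := by
    intro x x' y s hxy hs _
    have hd : 0 < dist x y := dist_pos.2 hxy
    rw [← hinv x y hxy x, ← ENNReal.ofReal_mul (by have hs0 : 0 ≤ s := dist_nonneg.trans hs; positivity),
      ← ENNReal.ofReal_mul hC₂.le]
    refine ENNReal.ofReal_le_ofReal (mul_le_mul_of_nonneg_left ?_ hC₂.le)
    have hl := h.pos x _ hd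
    have hs0 : 0 ≤ s := dist_nonneg.trans hs
    rw [Real.div_rpow hs0 hd.le, div_mul_div_comm, mul_one]
    gcongr
  have hcd : ∀ (x x' y : X) (s : ℝ), dist x x' ≤ s → max 2 c⁻¹ * s ≤ dist x y →
      dist x x' ≤ c * dist x y := by
    intro x x' y s hs has
    have h0 : 0 ≤ s := dist_nonneg.trans hs
    have : c⁻¹ * s ≤ dist x y := le_trans (by gcongr; exact le_max_right _ _) has
    rw [inv_mul_le_iff₀ hc] at this
    exact hs.trans this
  have e1 : ENNReal.ofReal C₁ ≤ (max C₁.toNNReal C₂.toNNReal : ℝ≥0) :=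
    ENNReal.coe_le_coe.2 (le_max_left _ _)
  have e2 : ENNReal.ofReal C₂ ≤ (max C₁.toNNReal C₂.toNNReal : ℝ≥0) :=
    ENNReal.coe_le_coe.2 (le_max_right _ _)
  -- The entry $c^{-1}$ turns $as\le d(x,y)$ into the smoothness condition $d(x,x')\le c\,d(x,y)$;
  -- the entry $2$ keeps $x'$ well separated from $y$ as well.
  refine ⟨δ, max 2 c⁻¹, max C₁.toNNReal C₂.toNNReal, hδ, le_max_left _ _, ?_, ?_, ?_, ?_⟩
  · exact fun x y hxy => (hsize' x y hxy).trans (mul_le_mul' e1 (min_le_left _ _))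
  · exact fun x y hxy => (hsize' x y hxy).trans (mul_le_mul' e1 (min_le_right _ _))
  · intro x x' y s hxy hs has
    refine le_trans ?_ ((hsm' x x' y s hxy hs has).trans (mul_le_mul' e2 le_rfl))
    rw [← ofReal_norm]
    refine ENNReal.ofReal_le_ofReal (le_trans ?_ (hsm x x' y hxy (hcd x x' y s hs has)))
    exact le_add_of_nonneg_right (norm_nonneg _)
  · intro x x' y s hxy hs has
    refine le_trans ?_ ((hsm' x x' y s hxy hs has).trans (mul_le_mul' e2 le_rfl))
    rw [← ofReal_norm]
    refine ENNReal.ofReal_le_ofReal (le_trans ?_ (hsm x x' y hxy (hcd x x' y s hs has)))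
    exact le_add_of_nonneg_left (norm_nonneg _)

variable {δ a : ℝ} {C : ℝ≥0}

/-- Moving one variable at a time, both increments are controlled by smoothness and tend to $0$.
Continuity gives measurability of $K(x,\cdot)$ for every $x$, which is needed for pointwise
statements about truncations. -/
theorem KernelBounds.continuousOn (h : IsDominating μ lam) (hK : KernelBounds lam K δ a C) :
    ContinuousOn (fun z : X × X => K z.1 z.2) {z : X × X | z.1 ≠ z.2} := by
  rintro ⟨x₀, y₀⟩ (hne : x₀ ≠ y₀)
  refine ContinuousAt.continuousWithinAt ?_
  set d := dist x₀ y₀ with hd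
  have hd0 : 0 < d := dist_pos.2 hne
  have ha := hK.two_le
  have hδ := hK.delta_pos
  rw [ContinuousAt, tendsto_iff_edist_tendsto_0]
  set B : X × X → ℝ≥0∞ := fun z =>
    C * (ENNReal.ofReal ((dist x₀ z.1 / (d / 2)) ^ δ) * (edom lam x₀ (d / 2))⁻¹) +
    C * (ENNReal.ofReal ((dist y₀ z.2 / d) ^ δ) * (edom lam y₀ d)⁻¹) with hB
  have hBlim : Tendsto B (𝓝 (x₀, y₀)) (𝓝 0) := by
    have h1 : Tendsto (fun z : X × X => ENNReal.ofReal ((dist x₀ z.1 / (d / 2)) ^ δ))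
        (𝓝 (x₀, y₀)) (𝓝 0) := by
      have : Continuous (fun z : X × X => ENNReal.ofReal ((dist x₀ z.1 / (d / 2)) ^ δ)) :=
        ENNReal.continuous_ofReal.comp
          (((continuous_const.dist continuous_fst).div_const _).rpow_const fun _ => Or.inr hδ.le)
      have h0 := this.tendsto (x₀, y₀)
      simpa [Real.zero_rpow hδ.ne'] using h0
    have h2 : Tendsto (fun z : X × X => ENNReal.ofReal ((dist y₀ z.2 / d) ^ δ))
        (𝓝 (x₀, y₀)) (𝓝 0) := by
      have : Continuous (fun z : X × X => ENNReal.ofReal ((dist y₀ z.2 / d) ^ δ)) :=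
        ENNReal.continuous_ofReal.comp
          (((continuous_const.dist continuous_snd).div_const _).rpow_const fun _ => Or.inr hδ.le)
      have h0 := this.tendsto (x₀, y₀)
      simpa [Real.zero_rpow hδ.ne'] using h0
    have h3 := ENNReal.Tendsto.const_mul (a := (C : ℝ≥0∞)) (ENNReal.Tendsto.mul_const
      (b := (edom lam x₀ (d / 2))⁻¹) h1
      (Or.inr (ENNReal.inv_ne_top.2 (h.edom_ne_zero x₀ (by positivity)))))
      (Or.inr ENNReal.coe_ne_top)
    have h4 := ENNReal.Tendsto.const_mul (a := (C : ℝ≥0∞)) (ENNReal.Tendsto.mul_const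
      (b := (edom lam y₀ d)⁻¹) h2
      (Or.inr (ENNReal.inv_ne_top.2 (h.edom_ne_zero y₀ hd0))))
      (Or.inr ENNReal.coe_ne_top)
    have h5 := h3.add h4
    simpa using h5
  refine tendsto_of_tendsto_of_tendsto_of_le_of_le' tendsto_const_nhds hBlim
    (Eventually.of_forall fun _ => zero_le) ?_
  have ev1 : ∀ᶠ z : X × X in 𝓝 (x₀, y₀), dist x₀ z.1 * a < d / 2 := by
    have : Continuous fun z : X × X => dist x₀ z.1 * a := by fun_prop
    exact this.continuousAt.eventually_lt continuousAt_const (by simpa using hd0)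
  have ev2 : ∀ᶠ z : X × X in 𝓝 (x₀, y₀), dist y₀ z.2 * a < d / 2 := by
    have : Continuous fun z : X × X => dist y₀ z.2 * a := by fun_prop
    exact this.continuousAt.eventually_lt continuousAt_const (by simpa using hd0)
  filter_upwards [ev1, ev2] with z hz1 hz2
  have hy2 : dist y₀ z.2 < d / 2 := by nlinarith [dist_nonneg (x := y₀) (y := z.2)]
  -- The first increment is taken with second variable $z_2$ rather than $y_0$, hence the radius
  -- $d/2$ in the first term of $B$.
  have hx2 : d / 2 ≤ dist x₀ z.2 := by
    have := dist_triangle x₀ z.2 y₀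
    rw [dist_comm z.2 y₀] at this
    linarith
  have hne2 : x₀ ≠ z.2 := dist_pos.1 (by linarith)
  calc edist (K z.1 z.2) (K x₀ y₀) ≤ edist (K z.1 z.2) (K x₀ z.2) + edist (K x₀ z.2) (K x₀ y₀) :=
        edist_triangle _ _ _
    _ = ‖K x₀ z.2 - K z.1 z.2‖ₑ + ‖K x₀ y₀ - K x₀ z.2‖ₑ := by
        rw [edist_comm, edist_comm (K x₀ z.2) (K x₀ y₀), edist_eq_enorm_sub, edist_eq_enorm_sub]
    _ ≤ B z := by
        refine add_le_add ?_ ?_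
        · refine (hK.smooth_left x₀ z.1 z.2 (dist x₀ z.1) hne2 le_rfl (by linarith)).trans ?_
          gcongr
          exact h.edom_mono _ (by positivity) hx2
        · refine (hK.smooth_right y₀ z.2 x₀ (dist y₀ z.2) hne.symm le_rfl ?_).trans ?_
          · rw [dist_comm y₀ x₀]; linarith
          · rw [dist_comm y₀ x₀]

variable [BorelSpace X]

theorem KernelBounds.aestronglyMeasurable [SecondCountableTopology X] (h : IsDominating μ lam)
    (hK : KernelBounds lam K δ a C) (x : X) {s : Set X} (hs : MeasurableSet s) (hxs : x ∉ s) :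
    AEStronglyMeasurable (K x) (μ.restrict s) := by
  have : ContinuousOn (K x) s :=
    (hK.continuousOn h).comp (f := fun y => (x, y)) (by fun_prop)
      fun y hy => fun (hxy : x = y) => hxs (hxy ▸ hy)
  exact this.aestronglyMeasurable hs

theorem KernelBounds.integrableOn [SecondCountableTopology X] (h : IsDominating μ lam)
    (hK : KernelBounds lam K δ a C) {f : X → 𝕜} (hf : Integrable f μ) (x : X) {ε : ℝ}
    (hε : 0 < ε) : IntegrableOn (fun y => K x y * f y) {y | ε ≤ dist x y} μ := by
  refine Integrable.bdd_mul (c := ((C : ℝ≥0∞) * (edom lam x ε)⁻¹).toReal) hf.integrableOn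
    (hK.aestronglyMeasurable h x (measurableSet_le_dist x ε) (by simpa using hε)) ?_
  filter_upwards [ae_restrict_mem (measurableSet_le_dist x ε)] with y hy
  have htop : (C : ℝ≥0∞) * (edom lam x ε)⁻¹ ≠ ∞ :=
    ENNReal.mul_ne_top ENNReal.coe_ne_top (ENNReal.inv_ne_top.2 (h.edom_ne_zero x hε))
  rw [← toReal_enorm]
  refine ENNReal.toReal_mono htop ((hK.size_left x y (dist_pos.1 (hε.trans_le hy))).trans ?_)
  gcongr
  exact h.edom_mono x hε hy

theorem KernelBounds.exists_annulus_bound (h : IsDominating μ lam)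
    (hK : KernelBounds lam K δ a C) {b : ℝ} (hb : 0 < b) :
    ∃ C' : ℝ≥0, ∀ (f : X → 𝕜) (N : ℝ≥0∞) (x : X) (s : ℝ), 0 < s →
      ∫⁻ y in Metric.ball x (b * s), ‖f y‖ₑ ∂μ ≤ N * edom lam x (b * s) →
      ∫⁻ y in {y | s ≤ dist x y ∧ dist x y < b * s}, ‖K x y * f y‖ₑ ∂μ ≤ C' * N := by
  obtain ⟨D, hD⟩ := h.exists_annulus_bound hb
  refine ⟨C * D, fun f N x s hs hN => ?_⟩
  have hm : MeasurableSet {y | s ≤ dist x y ∧ dist x y < b * s} :=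
    (measurableSet_le_dist x s).inter (measurableSet_dist_lt x _)
  calc ∫⁻ y in {y | s ≤ dist x y ∧ dist x y < b * s}, ‖K x y * f y‖ₑ ∂μ
      ≤ ∫⁻ y in {y | s ≤ dist x y ∧ dist x y < b * s},
          C * ((edom lam x (dist x y))⁻¹ * ‖f y‖ₑ) ∂μ := by
        refine setLIntegral_mono' hm fun y hy => ?_
        rw [enorm_mul, ← mul_assoc]
        gcongr
        exact hK.size_left x y (dist_pos.1 (hs.trans_le hy.1))
    _ = C * ∫⁻ y in {y | s ≤ dist x y ∧ dist x y < b * s},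
          (edom lam x (dist x y))⁻¹ * ‖f y‖ₑ ∂μ := lintegral_const_mul' _ _ ENNReal.coe_ne_top
    _ ≤ (C * D : ℝ≥0) * N := by
        rw [ENNReal.coe_mul, mul_assoc]
        gcongr
        exact hD (fun y => ‖f y‖ₑ) N x s hs hN

/-- The smoothness bound gives the factor $(s/d(x,y))^\delta/\lambda(x,d(x,y))$, exactly the
integrand of the tail estimate. -/
theorem KernelBounds.exists_diff_bound (h : IsDominating μ lam)
    (hK : KernelBounds lam K δ a C) :
    ∃ C' : ℝ≥0, ∀ (f : X → 𝕜) (N : ℝ≥0∞) (x x' : X) (s : ℝ), 0 < s → dist x x' ≤ s →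
      (∀ ρ, s ≤ ρ → ∫⁻ y in Metric.ball x ρ, ‖f y‖ₑ ∂μ ≤ N * edom lam x ρ) →
      ∫⁻ y in {y | a * s ≤ dist x y}, ‖K x y * f y - K x' y * f y‖ₑ ∂μ ≤ C' * N := by
  obtain ⟨D, hD⟩ := h.exists_tail_bound hK.delta_pos
  refine ⟨C * D, fun f N x x' s hs hxx' hN => ?_⟩
  have ha := hK.two_le
  have hsub : {y | a * s ≤ dist x y} ⊆ {y | s ≤ dist x y} := by
    intro y hy
    rw [mem_ofPred_eq] at hy ⊢
    nlinarith
  calc ∫⁻ y in {y | a * s ≤ dist x y}, ‖K x y * f y - K x' y * f y‖ₑ ∂μ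
      ≤ ∫⁻ y in {y | a * s ≤ dist x y}, C * (ENNReal.ofReal ((s / dist x y) ^ δ) *
          (edom lam x (dist x y))⁻¹ * ‖f y‖ₑ) ∂μ := by
        refine setLIntegral_mono' (measurableSet_le_dist x _) fun y hy => ?_
        rw [← sub_mul, enorm_mul, ← mul_assoc]
        gcongr
        exact hK.smooth_left x x' y s (dist_pos.1 (hs.trans_le (hsub hy))) hxx' hy
    _ = C * ∫⁻ y in {y | a * s ≤ dist x y}, ENNReal.ofReal ((s / dist x y) ^ δ) *
          (edom lam x (dist x y))⁻¹ * ‖f y‖ₑ ∂μ := lintegral_const_mul' _ _ ENNReal.coe_ne_top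
    _ ≤ C * ∫⁻ y in {y | s ≤ dist x y}, ENNReal.ofReal ((s / dist x y) ^ δ) *
          (edom lam x (dist x y))⁻¹ * ‖f y‖ₑ ∂μ := by gcongr
    _ ≤ (C * D : ℝ≥0) * N := by
        rw [ENNReal.coe_mul, mul_assoc]
        gcongr
        exact hD (fun y => ‖f y‖ₑ) N x s hs hN

end Kernel

end NonHomog

namespace NonHomog

/-! ### Doubling radii and the Cotlar inequality -/

section Doubling

variable {X : Type*} [MetricSpace X] [MeasurableSpace X] {μ : Measure X} {lam : X → ℝ → ℝ}

theorem IsDominating.inv_edom_le (h : IsDominating μ lam) {a : ℝ} (ha : 0 < a) {D : ℝ≥0}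
    (hD : ∀ x r, 0 < r → edom lam x (a * r) ≤ D * edom lam x r) (x : X) {r : ℝ} (hr : 0 < r) :
    (edom lam x r)⁻¹ ≤ D * (edom lam x (a * r))⁻¹ := by
  have := h.mul_inv_edom_le hD (x := x) hr (m := 1) (N := (edom lam x (a * r))⁻¹)
    (by rw [ENNReal.inv_mul_cancel (h.edom_ne_zero x (by positivity)) (edom_ne_top x _)])
  rwa [mul_one] at this

theorem setLIntegral_ball_le_maximalFun {𝕜 : Type*} [RCLike 𝕜] (h : IsDominating μ lam) {p ρ : ℝ}
    (hp : 0 < p) (hρ : 1 ≤ ρ) (g : X → 𝕜) {x c : X} {r : ℝ} (hx : x ∈ Metric.ball c r) :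
    ∫⁻ y in Metric.ball c r, ‖g y‖ₑ ^ p ∂μ ≤
      μ (Metric.ball c (ρ * r)) * maximalFun μ p ρ g x ^ p := by
  have hr : 0 < r := Metric.pos_of_mem_ball hx
  rw [maximalFun_eq hp, ← ENNReal.rpow_mul, one_div_mul_cancel hp.ne', ENNReal.rpow_one]
  rcases eq_or_ne (μ (Metric.ball c (ρ * r))) 0 with h0 | h0
  · have h1 : μ (Metric.ball c r) = 0 :=
      measure_mono_null (Metric.ball_subset_ball (by nlinarith)) h0
    rw [Measure.restrict_eq_zero.2 h1]
    simp
  · rw [← ENNReal.inv_mul_le_iff h0 (h.measure_ball_lt_top _ _).ne]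
    exact le_ballAvgSup ρ _ hx

/-- The ratios $b_j=\mu(B(x,A^jr))/\lambda(x,A^jr)$ are at most $1$. A non-doubling step multiplies
$b_j$ by at least $2$ because the threshold is $2D$ and $\lambda$ grows by at most $D$. So a
doubling step with nonzero mass must occur, and up to the first one the $b_j$ are dominated by a
geometric series ending at a value at most $1$. The shell integral over $[A^jr,A^{j+1}r)$ is a
multiple of $Mb_{j+2}$, so the total is bounded independently of the stopping index. -/
theorem IsDominating.exists_doubling_radius [BorelSpace X] (h : IsDominating μ lam) (hμ : μ ≠ 0)
    {A : ℝ} (hA : 5 ≤ A) : ∃ Λ C : ℝ≥0, ∀ (x : X) (r : ℝ), 0 < r → ∃ R, r ≤ R ∧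
      μ (Metric.ball x R) ≠ 0 ∧ μ (Metric.ball x (A * R)) ≤ Λ * μ (Metric.ball x R) ∧
      ∀ (u : X → ℝ≥0∞) (M : ℝ≥0∞),
        (∀ ρ, 0 < ρ → ∫⁻ y in Metric.ball x ρ, u y ∂μ ≤ M * μ (Metric.ball x (5 * ρ))) →
        ∫⁻ y in {y | r ≤ dist x y ∧ dist x y < A * R}, (edom lam x (dist x y))⁻¹ * u y ∂μ
          ≤ C * M := by
  have hA0 : 0 < A := by linarith
  obtain ⟨D, hD1, hD⟩ := h.exists_dilation hA0
  obtain ⟨C, hC⟩ := h.exists_annulus_bound hA0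
  refine ⟨2 * D, C * (D * 4), fun x r hr => ?_⟩
  set m : ℕ → ℝ≥0∞ := fun j => μ (Metric.ball x (A ^ j * r)) with hm
  set e : ℕ → ℝ≥0∞ := fun j => edom lam x (A ^ j * r) with he
  have hpos : ∀ j : ℕ, 0 < A ^ j * r := fun j => by positivity
  have hsucc : ∀ j : ℕ, A ^ (j + 1) * r = A * (A ^ j * r) := fun j => by ring
  have he1 : ∀ j, (e j)⁻¹ ≤ D * (e (j + 1))⁻¹ := by
    intro j
    have := h.inv_edom_le hA0 hD x (hpos j)
    simpa only [he, hsucc j] using this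
  set b : ℕ → ℝ≥0∞ := fun j => (e j)⁻¹ * m j with hb
  have hb1 : ∀ j, b j ≤ 1 := by
    intro j
    calc b j ≤ (e j)⁻¹ * e j := by
          simp only [hb]; gcongr; exact h.measure_ball_le x _ (hpos j)
      _ ≤ 1 := ENNReal.inv_mul_le_one _
  have hstep : ∀ j, ((2 * D : ℝ≥0) : ℝ≥0∞) * m j ≤ m (j + 1) → 2 * b j ≤ b (j + 1) := by
    intro j hj
    calc 2 * b j ≤ 2 * (D * (e (j + 1))⁻¹ * m j) := by
          simp only [hb]; gcongr; exact he1 j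
      _ = (e (j + 1))⁻¹ * (((2 * D : ℝ≥0) : ℝ≥0∞) * m j) := by push_cast; ring
      _ ≤ b (j + 1) := by simp only [hb]; gcongr
  have hex : ∃ j, m j ≠ 0 ∧ m (j + 1) ≤ ((2 * D : ℝ≥0) : ℝ≥0∞) * m j := by
    by_contra! hcon
    have hall : ∀ j, 2 * b j ≤ b (j + 1) := by
      intro j
      refine hstep j ?_
      by_cases h0 : m j = 0
      · simp [h0]
      · exact (hcon j h0).le
    have hne : ∃ j, m j ≠ 0 := by
      by_contra! hz
      refine hμ (Measure.measure_univ_eq_zero.1 ?_)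
      have : (univ : Set X) = ⋃ j : ℕ, Metric.ball x (A ^ j * r) := by
        refine (eq_univ_of_forall fun y => ?_).symm
        obtain ⟨n, hn⟩ := pow_unbounded_of_one_lt (dist y x / r) (show 1 < A by linarith)
        exact mem_iUnion.2 ⟨n, by rwa [Metric.mem_ball, ← div_lt_iff₀ hr]⟩
      rw [this]
      exact measure_iUnion_null hz
    obtain ⟨j, hj⟩ := hne
    have hgrow : ∀ i : ℕ, 2 ^ i * b j ≤ b (j + i) := by
      intro i
      induction i with
      | zero => simp
      | succ i ih =>
        calc 2 ^ (i + 1) * b j = 2 * (2 ^ i * b j) := by ring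
          _ ≤ 2 * b (j + i) := by gcongr
          _ ≤ b (j + i + 1) := hall _
    have hbj : b j ≠ 0 := mul_ne_zero (ENNReal.inv_ne_zero.2 (edom_ne_top _ _)) hj
    obtain ⟨i, hi⟩ := ENNReal.exists_nat_mul_gt hbj ENNReal.one_ne_top
    have hi2 : ((i : ℕ) : ℝ≥0∞) ≤ 2 ^ i := by exact_mod_cast Nat.lt_two_pow_self.le
    exact absurd ((hgrow i).trans (hb1 _)) (not_le.2 (hi.trans_le (by gcongr)))
  classical
  set k := Nat.find hex with hk
  obtain ⟨hk0, hkd⟩ := Nat.find_spec hex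
  rw [← hk] at hk0 hkd
  have hlow : ∀ j < k, 2 * b j ≤ b (j + 1) := by
    intro j hj
    refine hstep j ?_
    by_cases h0 : m j = 0
    · simp [h0]
    · have := Nat.find_min hex hj
      push Not at this
      exact (this h0).le
  have hsum : ∀ n ≤ k, ∑ j ∈ Finset.range n, b j ≤ b n := by
    intro n hn
    induction n with
    | zero => simp
    | succ n ih =>
      rw [Finset.sum_range_succ]
      calc _ ≤ b n + b n := by gcongr; exact ih (by omega)
        _ = 2 * b n := (two_mul _).symm
        _ ≤ b (n + 1) := hlow n (by omega)
  -- The shift by $2$ counts one dilation to reach the outer radius of the shell and one more to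
  -- absorb the factor $5\le A$. The terms before $k$ sum to at most $b_k\le1$;
  -- $b_k,b_{k+1},b_{k+2}$ add at most $3$.
  have hsum2 : ∑ j ∈ Finset.range (k + 1), b (j + 2) ≤ 4 := by
    have h1 : ∑ j ∈ Finset.range (k + 3), b j ≤ 4 := by
      rw [Finset.sum_range_succ, Finset.sum_range_succ, Finset.sum_range_succ]
      calc _ ≤ (1 : ℝ≥0∞) + 1 + 1 + 1 :=
            add_le_add (add_le_add (add_le_add ((hsum k le_rfl).trans (hb1 _)) (hb1 _)) (hb1 _))
              (hb1 _)
        _ = 4 := by norm_num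
    refine le_trans ?_ h1
    rw [Finset.sum_range_succ' b (k + 2), Finset.sum_range_succ' _ (k + 1)]
    exact le_add_right (le_add_right le_rfl)
  have h1A : ∀ j : ℕ, 1 ≤ A ^ j := fun j => one_le_pow₀ (by linarith)
  refine ⟨A ^ k * r, by nlinarith [h1A k], hk0, ?_, fun u M hu => ?_⟩
  · rw [← hsucc]; exact hkd
  set S : ℕ → Set X := fun j => {y | A ^ j * r ≤ dist x y ∧ dist x y < A * (A ^ j * r)}
  have hcov : {y | r ≤ dist x y ∧ dist x y < A * (A ^ k * r)} ⊆
      ⋃ j : Fin (k + 1), S j := by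
    intro y hy
    obtain ⟨n, hn1, hn2⟩ := exists_nat_pow_near ((one_le_div hr).2 hy.1) (show 1 < A by linarith)
    rw [le_div_iff₀ hr] at hn1
    rw [div_lt_iff₀ hr, hsucc] at hn2
    refine mem_iUnion.2 ⟨⟨n, ?_⟩, hn1, hn2⟩
    by_contra hnk
    have h3 : A ^ (k + 1) ≤ A ^ n := pow_le_pow_right₀ (by linarith) (not_lt.1 hnk)
    have h4 := hy.2
    rw [← hsucc] at h4
    nlinarith
  have hS : ∀ j, ∫⁻ y in S j, (edom lam x (dist x y))⁻¹ * u y ∂μ ≤ C * (M * (D * b (j + 2))) := by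
    intro j
    refine hC u _ x _ (hpos j) ?_
    rw [← hsucc]
    calc ∫⁻ y in Metric.ball x (A ^ (j + 1) * r), u y ∂μ
        ≤ M * μ (Metric.ball x (5 * (A ^ (j + 1) * r))) := hu _ (hpos _)
      _ ≤ M * m (j + 2) := by
          refine mul_le_mul_right (measure_mono (Metric.ball_subset_ball ?_)) _
          rw [show j + 2 = (j + 1) + 1 by rfl, hsucc (j + 1)]
          have := hpos (j + 1)
          gcongr
      _ = M * ((e (j + 1))⁻¹ * m (j + 2)) * e (j + 1) := by
          rw [mul_comm (e (j + 1))⁻¹, ← mul_assoc, mul_assoc (M * m (j + 2)),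
            ENNReal.inv_mul_cancel (h.edom_ne_zero x (hpos _)) (edom_ne_top _ _), mul_one]
      _ ≤ M * (D * b (j + 2)) * e (j + 1) := by
          refine mul_le_mul_left (mul_le_mul_right ?_ _) _
          change _ ≤ D * ((e (j + 2))⁻¹ * m (j + 2))
          rw [← mul_assoc]
          exact mul_le_mul_left (he1 (j + 1)) _
  calc ∫⁻ y in {y | r ≤ dist x y ∧ dist x y < A * (A ^ k * r)}, (edom lam x (dist x y))⁻¹ * u y ∂μ
      ≤ ∫⁻ y in ⋃ j : Fin (k + 1), S j, (edom lam x (dist x y))⁻¹ * u y ∂μ :=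
        lintegral_mono_set hcov
    _ ≤ ∑ j ∈ Finset.range (k + 1), ∫⁻ y in S j, (edom lam x (dist x y))⁻¹ * u y ∂μ := by
        refine (lintegral_iUnion_le (fun j : Fin (k + 1) => S j) _).trans (le_of_eq ?_)
        rw [tsum_fintype, Finset.sum_range]
    _ ≤ ∑ j ∈ Finset.range (k + 1), C * (M * (D * b (j + 2))) := Finset.sum_le_sum fun j _ => hS j
    _ = C * (M * (D * ∑ j ∈ Finset.range (k + 1), b (j + 2))) := by
        simp only [Finset.mul_sum]
    _ ≤ C * (M * (D * 4)) := by gcongr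
    _ = (C * (D * 4) : ℝ≥0) * M := by push_cast; ring

end Doubling

/-! ### Pointwise comparison and averaging over doubling balls -/

section Cotlar

variable {X 𝕜 : Type*} [MetricSpace X] [MeasurableSpace X] [RCLike 𝕜]
  {μ : Measure X} {lam : X → ℝ → ℝ} {K : X → X → 𝕜}

theorem IsDominating.memLp_of_isBounded_support (h : IsDominating μ lam) {f : X → 𝕜}
    (hf : MemLp f ∞ μ) (hb : Bornology.IsBounded (Function.support f)) (p : ℝ≥0∞) :
    MemLp f p μ :=
  hf.mono_exponent_of_measure_support_ne_top (s := Function.support f)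
    (fun _ hy => Function.notMem_support.1 hy) (h.measure_lt_top_of_isBounded hb).ne le_top

variable [BorelSpace X] [SecondCountableTopology X] {T : Lp 𝕜 2 μ →L[𝕜] Lp 𝕜 2 μ}

/-- With $f=f_1+f_2$ split at distance $aR$, $Tf_2(x')$ is given by the kernel because $x'$ is far
from the support of $f_2$. Replacing $x'$ by $x$ costs the smoothness tail, and the remaining shell
from $r$ to $aR$ is cheap by the choice of $R$. Both errors are multiples of $M_{(5)}f(x)$. -/
theorem IsCZOperator.exists_pointwise_bound (h : IsDominating μ lam)
    (hT : IsCZOperator μ lam K T) (hμ : μ ≠ 0) :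
    ∃ a : ℝ, 2 ≤ a ∧ ∃ Λ C : ℝ≥0, ∀ (f : X → 𝕜), MemLp f ∞ μ →
      Bornology.IsBounded (Function.support f) → ∀ (hf2 : MemLp f 2 μ) (x : X) (r : ℝ), 0 < r →
      ∃ R, 0 < R ∧ μ (Metric.ball x R) ≠ 0 ∧
        μ (Metric.ball x (5 * (a * R))) ≤ Λ * μ (Metric.ball x R) ∧
        ∃ hf1 : MemLp ((Metric.ball x (a * R)).indicator f) 2 μ, ∀ᵐ x' ∂μ, x' ∈ Metric.ball x R →
          ‖truncated μ K r f x‖ₑ ≤ ‖T (hf2.toLp f) x'‖ₑ + ‖T (hf1.toLp _) x'‖ₑ +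
            C * maximalFun μ 1 5 f x := by
  obtain ⟨δ, a, C₁, hK⟩ := hT.kernel.exists_kernelBounds h
  have ha := hK.two_le
  -- With $A=5a$ the doubling step covers $B(x,5aR)$, the ball that normalises averages of $f$ over
  -- $B(x,aR)$ in the maximal function.
  obtain ⟨Λ, C₂, hdr⟩ := h.exists_doubling_radius hμ (A := 5 * a) (by linarith)
  obtain ⟨C₃, hdiff⟩ := hK.exists_diff_bound h
  obtain ⟨D, -, hD⟩ := h.exists_dilation (a := 5) (by norm_num)
  refine ⟨a, ha, Λ, C₁ * C₂ + C₃ * D, fun f hf hb hf2 x r hr => ?_⟩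
  have hf1 : Integrable f μ := memLp_one_iff_integrable.1 (h.memLp_of_isBounded_support hf hb 1)
  obtain ⟨R, hrR, hR0, hRΛ, hshell⟩ := hdr x r hr
  have hR : 0 < R := hr.trans_le hrR
  set M := maximalFun μ 1 5 f x with hM
  have hball : ∀ ρ, 0 < ρ → ∫⁻ y in Metric.ball x ρ, ‖f y‖ₑ ∂μ ≤ M * μ (Metric.ball x (5 * ρ)) := by
    intro ρ hρ
    have := setLIntegral_ball_le_maximalFun h (p := 1) (ρ := 5) one_pos (by norm_num) f
      (Metric.mem_ball_self (x := x) hρ)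
    simp only [ENNReal.rpow_one] at this
    rwa [mul_comm]
  set F : Set X := {y | a * R ≤ dist x y} with hF
  have hFm : MeasurableSet F := measurableSet_le_dist x _
  set f₁ := (Metric.ball x (a * R)).indicator f with hf₁
  set f₂ := F.indicator f with hf₂
  have hff : f = f₁ + f₂ := by
    have : F = (Metric.ball x (a * R))ᶜ := by
      ext y; simp [hF, dist_comm]
    rw [hf₁, hf₂, this, indicator_self_add_compl]
  have hf₁2 : MemLp f₁ 2 μ := hf2.indicator Metric.isOpen_ball.measurableSet
  have hf₂2 : MemLp f₂ 2 μ := hf2.indicator hFm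
  refine ⟨R, hR, hR0, by rwa [← mul_assoc], hf₁2, ?_⟩
  have hadd : hf2.toLp f = hf₁2.toLp f₁ + hf₂2.toLp f₂ := by
    rw [← MemLp.toLp_add]
    exact MemLp.toLp_congr _ _ (Eventually.of_forall fun y => congrFun hff y)
  have hTadd : ∀ᵐ x' ∂μ, T (hf2.toLp f) x' = T (hf₁2.toLp f₁) x' + T (hf₂2.toLp f₂) x' := by
    rw [hadd, map_add]
    exact Lp.coeFn_add _ _
  have hrep := hT.representation f₂ hf₂2 (hf.indicator hFm)
    (hb.subset (by rw [hf₂, support_indicator]; exact inter_subset_right))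
  have hts : tsupport f₂ ⊆ F := closure_minimal support_indicator_subset
    (isClosed_le continuous_const (continuous_const.dist continuous_id))
  filter_upwards [hTadd, hrep] with x' hx1 hx2 hx'
  rw [Metric.mem_ball, dist_comm] at hx'
  have hx'F : x' ∉ F := fun hc => by
    have : a * R ≤ dist x x' := hc
    nlinarith
  have hT2 : T (hf₂2.toLp f₂) x' = ∫ y in F, K x' y * f y ∂μ := by
    rw [hx2 fun hc => hx'F (hts hc), ← integral_indicator hFm]
    refine integral_congr_ae (Eventually.of_forall fun y => ?_)
    by_cases hy : y ∈ F <;> simp [hf₂, hy]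
  have hint1 : IntegrableOn (fun y => K x y * f y) {y | r ≤ dist x y} μ :=
    hK.integrableOn h hf1 x hr
  have hintF : IntegrableOn (fun y => K x y * f y) F μ :=
    hK.integrableOn h hf1 x (by positivity)
  have hintF' : IntegrableOn (fun y => K x' y * f y) F μ := by
    refine (hK.integrableOn h hf1 x' hR).mono_set fun y hy => ?_
    have h1 : a * R ≤ dist x y := hy
    have h2 := dist_triangle x x' y
    change R ≤ dist x' y
    nlinarith
  set G : Set X := {y | r ≤ dist x y ∧ dist x y < a * R} with hG
  have hGm : MeasurableSet G := (measurableSet_le_dist x _).inter (measurableSet_dist_lt x _)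
  have hunion : {y | r ≤ dist x y} = G ∪ F := by
    ext y
    simp only [hG, hF, mem_union, mem_ofPred_eq]
    constructor
    · intro hy
      rcases lt_or_ge (dist x y) (a * R) with h1 | h1
      · exact Or.inl ⟨hy, h1⟩
      · exact Or.inr h1
    · rintro (⟨h1, -⟩ | h1)
      · exact h1
      · nlinarith
  have hdisj : Disjoint G F := disjoint_left.2 fun y hy hy' => not_le.2 hy.2 hy'
  have htr : truncated μ K r f x = ∫ y in G, K x y * f y ∂μ + ∫ y in F, K x y * f y ∂μ := by
    rw [truncated, hunion]
    rw [hunion] at hint1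
    exact setIntegral_union hdisj hFm (hint1.mono_set subset_union_left) hintF
  have hG1 : ‖∫ y in G, K x y * f y ∂μ‖ₑ ≤ C₁ * C₂ * M := by
    calc ‖∫ y in G, K x y * f y ∂μ‖ₑ ≤ ∫⁻ y in G, ‖K x y * f y‖ₑ ∂μ :=
          enorm_integral_le_lintegral_enorm _
      _ ≤ ∫⁻ y in G, C₁ * ((edom lam x (dist x y))⁻¹ * ‖f y‖ₑ) ∂μ := by
          refine setLIntegral_mono' hGm fun y hy => ?_
          rw [enorm_mul, ← mul_assoc]
          gcongr
          exact hK.size_left x y (dist_pos.1 (hr.trans_le hy.1))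
      _ = C₁ * ∫⁻ y in G, (edom lam x (dist x y))⁻¹ * ‖f y‖ₑ ∂μ :=
          lintegral_const_mul' _ _ ENNReal.coe_ne_top
      _ ≤ C₁ * ∫⁻ y in {y | r ≤ dist x y ∧ dist x y < 5 * a * R},
            (edom lam x (dist x y))⁻¹ * ‖f y‖ₑ ∂μ := by
          gcongr
          intro y hy
          refine ⟨hy.1, hy.2.trans_le ?_⟩
          nlinarith
      _ ≤ C₁ * (C₂ * M) := by gcongr; exact hshell (fun y => ‖f y‖ₑ) M hball
      _ = C₁ * C₂ * M := by ring
  have hF1 : ‖∫ y in F, K x y * f y ∂μ - ∫ y in F, K x' y * f y ∂μ‖ₑ ≤ C₃ * D * M := by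
    rw [← integral_sub hintF hintF']
    calc _ ≤ ∫⁻ y in F, ‖K x y * f y - K x' y * f y‖ₑ ∂μ := enorm_integral_le_lintegral_enorm _
      _ ≤ C₃ * (D * M) := by
          refine hdiff f _ x x' R hR hx'.le fun ρ hρ => ?_
          have hρ0 : 0 < ρ := hR.trans_le hρ
          calc _ ≤ M * μ (Metric.ball x (5 * ρ)) := hball ρ hρ0
            _ ≤ M * (D * edom lam x ρ) := by
                gcongr
                exact (h.measure_ball_le x _ (by positivity)).trans (hD x ρ hρ0)
            _ = D * M * edom lam x ρ := by ring
      _ = C₃ * D * M := by ring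
  have hfinal : truncated μ K r f x = ∫ y in G, K x y * f y ∂μ +
      (∫ y in F, K x y * f y ∂μ - ∫ y in F, K x' y * f y ∂μ) +
      T (hf2.toLp f) x' - T (hf₁2.toLp f₁) x' := by
    rw [htr, hx1, hT2]; ring
  rw [hfinal]
  calc _ ≤ ‖∫ y in G, K x y * f y ∂μ‖ₑ +
      ‖∫ y in F, K x y * f y ∂μ - ∫ y in F, K x' y * f y ∂μ‖ₑ +
      ‖T (hf2.toLp f) x'‖ₑ + ‖T (hf₁2.toLp f₁) x'‖ₑ := by
        refine enorm_sub_le.trans (add_le_add_left ?_ _)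
        exact (enorm_add_le _ _).trans (add_le_add_left (enorm_add_le _ _) _)
    _ ≤ C₁ * C₂ * M + C₃ * D * M + ‖T (hf2.toLp f) x'‖ₑ + ‖T (hf₁2.toLp f₁) x'‖ₑ := by gcongr
    _ = _ := by push_cast; ring

omit [MetricSpace X] [BorelSpace X] [SecondCountableTopology X] in
-- The $\eta$-th powers are averaged over $B$. One factor $3$ comes from
-- $(a+b+c)^\eta\le3^\eta(a^\eta+b^\eta+c^\eta)$, valid for all $\eta>0$; the factor $3^{1/\eta}$
-- comes from recombining the three terms.
theorem le_of_ae_le_add_of_setLIntegral_rpow_le {B : Set X} (hB0 : μ B ≠ 0) (hB : μ B ≠ ∞)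
    {η : ℝ} (hη : 0 < η) {u v : X → ℝ≥0∞} (hv : AEMeasurable v μ)
    {S U V w : ℝ≥0∞} (hS : ∀ᵐ y ∂μ.restrict B, S ≤ u y + v y + w)
    (hU : ∫⁻ y in B, u y ^ η ∂μ ≤ μ B * U ^ η) (hV : ∫⁻ y in B, v y ^ η ∂μ ≤ μ B * V ^ η) :
    S ≤ 3 * 3 ^ η⁻¹ * (U + V + w) := by
  have hmax : ∀ a b c : ℝ≥0∞, (a + b + c) ^ η ≤ 3 ^ η * (a ^ η + b ^ η + c ^ η) := by
    intro a b c
    have h3 : a + b + c ≤ 3 * max (max a b) c := by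
      calc a + b + c ≤ max (max a b) c + max (max a b) c + max (max a b) c :=
            add_le_add (add_le_add ((le_max_left a b).trans (le_max_left _ _))
              ((le_max_right a b).trans (le_max_left _ _))) (le_max_right _ _)
        _ = 3 * max (max a b) c := by ring
    calc (a + b + c) ^ η ≤ (3 * max (max a b) c) ^ η := by gcongr
      _ = 3 ^ η * max (max a b) c ^ η := ENNReal.mul_rpow_of_nonneg _ _ hη.le
      _ ≤ _ := by
        gcongr
        rcases max_choice (max a b) c with h1 | h1 <;> rw [h1]
        · rcases max_choice a b with h2 | h2 <;> rw [h2]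
          · rw [add_assoc]; exact le_self_add
          · rw [add_comm (a ^ η), add_assoc]; exact le_self_add
        · exact le_add_self
  have h1 : μ B * S ^ η ≤ μ B * (3 ^ η * (3 * (U + V + w) ^ η)) := by
    calc μ B * S ^ η = ∫⁻ y in B, S ^ η ∂μ := by rw [setLIntegral_const, mul_comm]
      _ ≤ ∫⁻ y in B, 3 ^ η * (u y ^ η + v y ^ η + w ^ η) ∂μ := by
          refine lintegral_mono_ae (hS.mono fun y hy => ?_)
          exact (ENNReal.rpow_le_rpow hy hη.le).trans (hmax _ _ _)
      _ = 3 ^ η * (∫⁻ y in B, u y ^ η ∂μ + ∫⁻ y in B, v y ^ η ∂μ + w ^ η * μ B) := by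
          rw [lintegral_const_mul' _ _ (by simp), lintegral_add_right' _ aemeasurable_const,
            lintegral_add_right' _ (hv.restrict.pow_const η), setLIntegral_const]
      _ ≤ 3 ^ η * (μ B * U ^ η + μ B * V ^ η + w ^ η * μ B) := by gcongr
      _ = μ B * (3 ^ η * (U ^ η + V ^ η + w ^ η)) := by ring
      _ ≤ μ B * (3 ^ η * (3 * (U + V + w) ^ η)) := by
          gcongr
          calc U ^ η + V ^ η + w ^ η
              ≤ (U + V + w) ^ η + (U + V + w) ^ η + (U + V + w) ^ η := by
                gcongr
                · rw [add_assoc]; exact le_self_add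
                · rw [add_comm U, add_assoc]; exact le_self_add
                · exact le_add_self
            _ = _ := by ring
  have h2 := (ENNReal.mul_le_mul_iff_right hB0 hB).1 h1
  have h3 := ENNReal.rpow_le_rpow h2 (inv_pos.2 hη).le
  rw [ENNReal.rpow_rpow_inv hη.ne', ENNReal.mul_rpow_of_nonneg _ _ (inv_pos.2 hη).le,
    ENNReal.rpow_rpow_inv hη.ne', ENNReal.mul_rpow_of_nonneg _ _ (inv_pos.2 hη).le,
    ENNReal.rpow_rpow_inv hη.ne', ← mul_assoc] at h3
  exact h3

/-- The Cotlar inequality, given a local bound for `T` on doubling balls. -/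
theorem IsCZOperator.cotlar_of_local (h : IsDominating μ lam) (hT : IsCZOperator μ lam K T)
    {η : ℝ} (hη : 0 < η) (M' : (X → 𝕜) → X → ℝ≥0∞)
    (hloc : ∀ (a : ℝ) (Λ : ℝ≥0), 2 ≤ a → ∃ Cl : ℝ≥0, ∀ (f : X → 𝕜), MemLp f ∞ μ →
      Bornology.IsBounded (Function.support f) → ∀ (x : X) (R : ℝ), 0 < R →
      μ (Metric.ball x R) ≠ 0 → μ (Metric.ball x (5 * (a * R))) ≤ Λ * μ (Metric.ball x R) →
      ∀ hf1 : MemLp ((Metric.ball x (a * R)).indicator f) 2 μ,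
      ∫⁻ y in Metric.ball x R, ‖T (hf1.toLp _) y‖ₑ ^ η ∂μ ≤
        μ (Metric.ball x R) * (Cl * M' f x) ^ η) :
    ∃ C : ℝ≥0, ∀ (f : X → 𝕜), MemLp f ∞ μ → Bornology.IsBounded (Function.support f) →
      ∀ (hf2 : MemLp f 2 μ) (x : X), maximalTruncated μ K f x ≤
        C * (maximalFun μ η 6 (T (hf2.toLp f)) x + M' f x + maximalFun μ 1 5 f x) := by
  rcases eq_or_ne μ 0 with rfl | hμ
  · exact ⟨0, fun f _ _ _ x => by simp [maximalTruncated, truncated]⟩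
  obtain ⟨a, ha, Λ, C, hpt⟩ := hT.exists_pointwise_bound h hμ
  obtain ⟨Cl, hCl⟩ := hloc a Λ ha
  set C₀ : ℝ≥0 := max (Λ ^ η⁻¹) (max Cl C)
  refine ⟨3 * 3 ^ η⁻¹ * C₀, fun f hf hb hf2 x => ?_⟩
  refine iSup_le fun r => iSup_le fun hr => ?_
  obtain ⟨R, hR, hR0, hRΛ, hf1, hae⟩ := hpt f hf hb hf2 x r hr
  have hRtop := (h.measure_ball_lt_top x R).ne
  have hU : ∫⁻ y in Metric.ball x R, ‖T (hf2.toLp f) y‖ₑ ^ η ∂μ ≤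
      μ (Metric.ball x R) * ((Λ ^ η⁻¹ : ℝ≥0) * maximalFun μ η 6 (T (hf2.toLp f)) x) ^ η := by
    refine (setLIntegral_ball_le_maximalFun h (ρ := 6) hη (by norm_num) (T (hf2.toLp f))
      (Metric.mem_ball_self hR)).trans ?_
    have e1 : (((Λ ^ η⁻¹ : ℝ≥0) : ℝ≥0∞)) ^ η = Λ := by
      rw [← ENNReal.coe_rpow_of_nonneg _ hη.le, ← NNReal.rpow_mul, inv_mul_cancel₀ hη.ne',
        NNReal.rpow_one]
    rw [ENNReal.mul_rpow_of_nonneg _ _ hη.le, e1, ← mul_assoc]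
    gcongr
    rw [mul_comm _ (Λ : ℝ≥0∞)]
    -- Since $a\ge2$, $6R\le5aR$, so the dilation $6$ is covered by the same doubling estimate.
    refine le_trans (measure_mono (Metric.ball_subset_ball ?_)) hRΛ
    nlinarith
  have hV := hCl f hf hb x R hR hR0 hRΛ hf1
  have hmain := le_of_ae_le_add_of_setLIntegral_rpow_le hR0 hRtop hη
    (Lp.aestronglyMeasurable _).enorm
    ((ae_restrict_iff' Metric.isOpen_ball.measurableSet).2 hae) hU hV
  refine hmain.trans ?_
  have c1 : ((Λ ^ η⁻¹ : ℝ≥0) : ℝ≥0∞) ≤ C₀ := ENNReal.coe_le_coe.2 (le_max_left _ _)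
  have c2 : (Cl : ℝ≥0∞) ≤ C₀ :=
    ENNReal.coe_le_coe.2 ((le_max_left _ _).trans (le_max_right _ _))
  have c3 : (C : ℝ≥0∞) ≤ C₀ :=
    ENNReal.coe_le_coe.2 ((le_max_right _ _).trans (le_max_right _ _))
  have c4 : ((3 * 3 ^ η⁻¹ * C₀ : ℝ≥0) : ℝ≥0∞) = 3 * 3 ^ η⁻¹ * C₀ := by
    rw [ENNReal.coe_mul, ENNReal.coe_mul, ENNReal.coe_rpow_of_nonneg _ (inv_pos.2 hη).le]
    rfl
  rw [c4, mul_assoc (3 * 3 ^ η⁻¹)]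
  gcongr
  calc _ ≤ (C₀ : ℝ≥0∞) * maximalFun μ η 6 (T (hf2.toLp f)) x + C₀ * M' f x +
        C₀ * maximalFun μ 1 5 f x := by gcongr
    _ = _ := by ring

omit [MetricSpace X] [BorelSpace X] [SecondCountableTopology X] in
theorem lintegral_enorm_rpow_two_apply_le (T : Lp 𝕜 2 μ →L[𝕜] Lp 𝕜 2 μ) :
    ∃ B : ℝ≥0, ∀ (f : X → 𝕜) (hf : MemLp f 2 μ),
      ∫⁻ x, ‖T (hf.toLp f) x‖ₑ ^ (2 : ℝ) ∂μ ≤ B * ∫⁻ x, ‖f x‖ₑ ^ (2 : ℝ) ∂μ := by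
  refine ⟨‖T‖₊ ^ (2 : ℝ), fun f hf => ?_⟩
  have h1 : ‖T (hf.toLp f)‖ₑ ≤ ‖T‖₊ * ‖hf.toLp f‖ₑ := T.le_opENorm _
  rw [Lp.enorm_def, Lp.enorm_def, eLpNorm_congr_ae hf.coeFn_toLp,
    eLpNorm_eq_lintegral_rpow_enorm_toReal (by norm_num) (by norm_num),
    eLpNorm_eq_lintegral_rpow_enorm_toReal (by norm_num) (by norm_num)] at h1
  have h2 := ENNReal.rpow_le_rpow h1 (zero_le_two (α := ℝ))
  rw [ENNReal.mul_rpow_of_nonneg _ _ zero_le_two] at h2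
  simp only [ENNReal.toReal_ofNat, ← ENNReal.rpow_mul] at h2
  norm_num at h2
  rw [ENNReal.coe_rpow_of_nonneg _ zero_le_two]
  simpa using h2

/-- The local bound comes from $L^2$ boundedness alone, at the cost of $M_{2,5}f$. This version is
available before any weak type estimate and serves to prove one. -/
theorem IsCZOperator.cotlar_two (h : IsDominating μ lam) (hT : IsCZOperator μ lam K T) :
    ∃ C : ℝ≥0, ∀ (f : X → 𝕜), MemLp f ∞ μ → Bornology.IsBounded (Function.support f) →
      ∀ (hf2 : MemLp f 2 μ) (x : X), maximalTruncated μ K f x ≤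
        C * (maximalFun μ 2 6 (T (hf2.toLp f)) x + maximalFun μ 2 5 f x +
          maximalFun μ 1 5 f x) := by
  refine hT.cotlar_of_local h two_pos (fun f x => maximalFun μ 2 5 f x) fun a Λ ha => ?_
  obtain ⟨B, hB⟩ := lintegral_enorm_rpow_two_apply_le T
  refine ⟨(B * Λ) ^ (2 : ℝ)⁻¹, fun f hf hb x R hR hR0 hRΛ hf1 => ?_⟩
  have haR : 0 < a * R := by positivity
  have e1 : ((((B * Λ) ^ (2 : ℝ)⁻¹ : ℝ≥0) : ℝ≥0∞)) ^ (2 : ℝ) = B * Λ := by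
    rw [← ENNReal.coe_rpow_of_nonneg _ zero_le_two, ← NNReal.rpow_mul,
      inv_mul_cancel₀ two_ne_zero, NNReal.rpow_one, ENNReal.coe_mul]
  calc ∫⁻ y in Metric.ball x R, ‖T (hf1.toLp _) y‖ₑ ^ (2 : ℝ) ∂μ
      ≤ ∫⁻ y, ‖T (hf1.toLp _) y‖ₑ ^ (2 : ℝ) ∂μ := setLIntegral_le_lintegral _ _
    _ ≤ B * ∫⁻ y, ‖(Metric.ball x (a * R)).indicator f y‖ₑ ^ (2 : ℝ) ∂μ := hB _ hf1
    _ = B * ∫⁻ y in Metric.ball x (a * R), ‖f y‖ₑ ^ (2 : ℝ) ∂μ := by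
        rw [← lintegral_indicator Metric.isOpen_ball.measurableSet]
        congr 2 with y
        by_cases hy : y ∈ Metric.ball x (a * R) <;> simp [hy]
    _ ≤ B * (μ (Metric.ball x (5 * (a * R))) * maximalFun μ 2 5 f x ^ (2 : ℝ)) := by
        gcongr
        exact setLIntegral_ball_le_maximalFun h two_pos (by norm_num) f (Metric.mem_ball_self haR)
    _ ≤ B * (Λ * μ (Metric.ball x R) * maximalFun μ 2 5 f x ^ (2 : ℝ)) := by gcongr
    _ = _ := by
        rw [ENNReal.mul_rpow_of_nonneg _ _ zero_le_two, e1]; ring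

end Cotlar

end NonHomog

namespace NonHomog

/-! ### The adjoint operator -/

section Adjoint

variable {X 𝕜 : Type*} [MetricSpace X] [MeasurableSpace X] [RCLike 𝕜]
  {μ : Measure X} {lam : X → ℝ → ℝ} {K : X → X → 𝕜}

/-- Comparability of $\lambda$ at nearby centres transfers the bound from $x_0$. It makes the kernel
bounded when one variable stays in a ball and the two are separated, as Fubini's theorem needs
below. -/
theorem IsDominating.exists_inv_edom_le_of_mem_ball (h : IsDominating μ lam) (x₀ : X) (R : ℝ)
    {ε : ℝ} (hε : 0 < ε) :
    ∃ B : ℝ≥0, ∀ x ∈ Metric.ball x₀ R, ∀ d, ε ≤ d → (edom lam x d)⁻¹ ≤ B := by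
  obtain ⟨C, hC, hcomp⟩ := h.comparable
  set ρ := max R ε with hρ
  have hρ0 : 0 < ρ := hε.trans_le (le_max_right _ _)
  obtain ⟨D, -, hD⟩ := h.exists_dilation (a := ρ / ε) (by positivity)
  have hne : (edom lam x₀ ρ)⁻¹ ≠ ∞ := ENNReal.inv_ne_top.2 (h.edom_ne_zero x₀ hρ0)
  refine ⟨D * (C.toNNReal * (edom lam x₀ ρ)⁻¹.toNNReal), fun x hx d hd => ?_⟩
  have hx' : dist x₀ x ≤ ρ := by
    rw [dist_comm]; exact (Metric.mem_ball.1 hx).le.trans (le_max_left _ _)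
  have h1 : edom lam x₀ ρ ≤ C.toNNReal * edom lam x ρ := by
    calc edom lam x₀ ρ ≤ ENNReal.ofReal (C * lam x ρ) :=
          ENNReal.ofReal_le_ofReal (hcomp x₀ x ρ hρ0 hx')
      _ = _ := by rw [ENNReal.ofReal_mul hC.le]; rfl
  have h2 : (edom lam x ρ)⁻¹ ≤ C.toNNReal * (edom lam x₀ ρ)⁻¹ := by
    have h0 := h.edom_ne_zero x hρ0
    have h0' := h.edom_ne_zero x₀ hρ0
    calc (edom lam x ρ)⁻¹ = (edom lam x ρ)⁻¹ * ((edom lam x₀ ρ)⁻¹ * edom lam x₀ ρ) := by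
          rw [ENNReal.inv_mul_cancel h0' (edom_ne_top _ _), mul_one]
      _ ≤ (edom lam x ρ)⁻¹ * ((edom lam x₀ ρ)⁻¹ * (C.toNNReal * edom lam x ρ)) := by gcongr
      _ = C.toNNReal * (edom lam x₀ ρ)⁻¹ * ((edom lam x ρ)⁻¹ * edom lam x ρ) := by ring
      _ = _ := by rw [ENNReal.inv_mul_cancel h0 (edom_ne_top _ _), mul_one]
  calc (edom lam x d)⁻¹ ≤ (edom lam x ε)⁻¹ := h.inv_edom_anti x hε hd
    _ ≤ D * (edom lam x (ρ / ε * ε))⁻¹ := h.inv_edom_le (by positivity) hD x hε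
    _ = D * (edom lam x ρ)⁻¹ := by rw [div_mul_cancel₀ _ hε.ne']
    _ ≤ D * (C.toNNReal * (edom lam x₀ ρ)⁻¹) := by gcongr
    _ = _ := by rw [ENNReal.coe_mul, ENNReal.coe_mul, ENNReal.coe_toNNReal hne]

variable [BorelSpace X] [SecondCountableTopology X] {T : Lp 𝕜 2 μ →L[𝕜] Lp 𝕜 2 μ}

theorem IsCZKernel.adjoint (h : IsDominating μ lam) (hK : IsCZKernel μ lam K) :
    IsCZKernel μ lam fun x y => (starRingEnd 𝕜) (K y x) := by
  have := h.isLocallyFiniteMeasure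
  refine ⟨?_, ?_, ?_⟩
  · obtain ⟨δ, a, C, hb⟩ := hK.exists_kernelBounds h
    refine ContinuousOn.locallyIntegrableOn ?_ ?_
    · refine RCLike.continuous_conj.comp_continuousOn ?_
      exact (hb.continuousOn h).comp (f := Prod.swap) continuous_swap.continuousOn
        fun z hz => Ne.symm hz
    · exact (isClosed_eq continuous_fst continuous_snd).measurableSet.compl
  · obtain ⟨C, hC, hs⟩ := hK.size
    refine ⟨C, hC, fun x y hxy => ?_⟩
    rw [RCLike.norm_conj, dist_comm, min_comm]
    exact hs y x hxy.symm
  · obtain ⟨δ, hδ, hδ1, C, hC, c, hc, hs⟩ := hK.smooth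
    refine ⟨δ, hδ, hδ1, C, hC, c, hc, fun x x' y hxy hd => ?_⟩
    rw [← map_sub, ← map_sub, RCLike.norm_conj, RCLike.norm_conj, add_comm]
    exact hs x x' y hxy hd

/-- For $D$ of finite measure and away from $\operatorname{supp}f$, $\langle1_D,T^*f\rangle=\langle
T1_D,f\rangle$. On the support of $f$ the function $T1_D$ is given by the kernel, and Fubini gives
$\int_DT^*f$. Since $D$ is arbitrary, the two functions agree almost everywhere off the support. -/
theorem IsCZOperator.adjoint (h : IsDominating μ lam) (hT : IsCZOperator μ lam K T) :
    IsCZOperator μ lam (fun x y => (starRingEnd 𝕜) (K y x)) (ContinuousLinearMap.adjoint T) := by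
  have := h.isLocallyFiniteMeasure
  refine ⟨hT.kernel.adjoint h, fun f hf hfb hsupp => ?_⟩
  rcases isEmpty_or_nonempty X with hX | ⟨⟨x₀⟩⟩
  · exact Eventually.of_forall fun x => (hX.false x).elim
  obtain ⟨δ, a, C, hK⟩ := hT.kernel.exists_kernelBounds h
  have hf1 : Integrable f μ := memLp_one_iff_integrable.1 (h.memLp_of_isBounded_support hfb hsupp 1)
  set Z := tsupport f with hZ
  -- These bounded sets have distance at least $1/(n+1)$ from the support and exhaust its
  -- complement; boundedness and separation give integrability of the double integral.
  set V : ℕ → Set X := fun n => (Metric.thickening (1 / ((n : ℝ) + 1)) Z)ᶜ ∩ Metric.ball x₀ n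
  have hVm : ∀ n, MeasurableSet (V n) := fun n =>
    Metric.isOpen_thickening.measurableSet.compl.inter Metric.isOpen_ball.measurableSet
  have hcover : ∀ x, x ∉ Z → ∃ n, x ∈ V n := by
    intro x hx
    obtain ⟨ε, hε, hball⟩ := Metric.isOpen_iff.1 (isClosed_tsupport f).isOpen_compl x hx
    obtain ⟨m, hm⟩ := exists_nat_one_div_lt hε
    obtain ⟨k, hk⟩ := exists_nat_gt (dist x x₀)
    refine ⟨max m k, fun hc => ?_, ?_⟩
    · obtain ⟨z, hz, hxz⟩ := Metric.mem_thickening_iff.1 hc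
      refine hball (Metric.mem_ball.2 ?_) hz
      rw [dist_comm]
      refine hxz.trans (lt_of_le_of_lt ?_ hm)
      have : (m : ℝ) ≤ ((max m k : ℕ) : ℝ) := by exact_mod_cast le_max_left m k
      gcongr
    · rw [Metric.mem_ball]
      refine hk.trans_le ?_
      exact_mod_cast le_max_right m k
  suffices hmain : ∀ n, ∀ᵐ x ∂μ.restrict (V n), ContinuousLinearMap.adjoint T (hf.toLp f) x =
      ∫ y, (starRingEnd 𝕜) (K y x) * f y ∂μ by
    have h1 : ∀ᵐ x ∂μ, ∀ n, x ∈ V n → ContinuousLinearMap.adjoint T (hf.toLp f) x =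
        ∫ y, (starRingEnd 𝕜) (K y x) * f y ∂μ :=
      ae_all_iff.2 fun n => (ae_restrict_iff' (hVm n)).1 (hmain n)
    filter_upwards [h1] with x hx hxZ
    obtain ⟨n, hn⟩ := hcover x hxZ
    exact hx n hn
  intro n
  set ε : ℝ := 1 / ((n : ℝ) + 1) with hε
  have hε0 : 0 < ε := by positivity
  have hVfin : μ (V n) < ∞ := (measure_mono inter_subset_right).trans_lt (h.measure_ball_lt_top _ _)
  have hsep : ∀ x ∈ V n, ∀ y ∈ Z, ε ≤ dist x y := by
    intro x hx y hy
    by_contra hlt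
    exact hx.1 (Metric.mem_thickening_iff.2 ⟨y, hy, not_le.1 hlt⟩)
  obtain ⟨B, hB⟩ := h.exists_inv_edom_le_of_mem_ball x₀ n hε0
  set F : X → X → 𝕜 := fun x y => (starRingEnd 𝕜) (K y x) * f y with hF
  have hFint : ∀ D : Set X, MeasurableSet D → D ⊆ V n →
      Integrable (Function.uncurry F) ((μ.restrict D).prod μ) := by
    intro D hD hDV
    have : IsFiniteMeasure (μ.restrict D) :=
      ⟨by rw [Measure.restrict_apply_univ]; exact (measure_mono hDV).trans_lt hVfin⟩
    have hoff : MeasurableSet {z : X × X | z.1 ≠ z.2} :=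
      (isClosed_eq continuous_fst continuous_snd).measurableSet.compl
    have hmem : ∀ᵐ z ∂(μ.restrict D).prod μ, z.1 ∈ D :=
      Measure.quasiMeasurePreserving_fst.ae (ae_restrict_mem hD)
    have hcont : ContinuousOn (fun z : X × X => (starRingEnd 𝕜) (K z.2 z.1))
        {z : X × X | z.1 ≠ z.2} := by
      refine RCLike.continuous_conj.comp_continuousOn ?_
      exact (hK.continuousOn h).comp (f := Prod.swap) continuous_swap.continuousOn
        fun z hz => Ne.symm hz
    have hmeas : AEStronglyMeasurable
        (fun z : X × X => {z : X × X | z.1 ≠ z.2}.indicator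
          (fun z => (starRingEnd 𝕜) (K z.2 z.1)) z * f z.2) ((μ.restrict D).prod μ) :=
      ((aestronglyMeasurable_indicator_iff hoff).2 (hcont.aestronglyMeasurable hoff)).mul
        hf1.aestronglyMeasurable.comp_snd
    have hz0 : ∀ z : X × X, z.1 ∈ D → f z.2 ≠ 0 → ε ≤ dist z.1 z.2 := fun z hz hfz =>
      hsep z.1 (hDV hz) z.2 (subset_tsupport f hfz)
    refine Integrable.mono' (g := fun z : X × X => (C * B : ℝ≥0) * ‖f z.2‖)
      ((hf1.norm.comp_snd _).const_mul _) (hmeas.congr ?_) ?_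
    · filter_upwards [hmem] with z hz
      by_cases hfz : f z.2 = 0
      · simp [Function.uncurry, hF, hfz]
      · have hzne : z ∈ {z : X × X | z.1 ≠ z.2} := dist_pos.1 (hε0.trans_le (hz0 z hz hfz))
        rw [indicator_of_mem hzne]
        rfl
    · filter_upwards [hmem] with z hz
      by_cases hfz : f z.2 = 0
      · simp [Function.uncurry, hF, hfz]
      · have hd := hz0 z hz hfz
        change ‖(starRingEnd 𝕜) (K z.2 z.1) * f z.2‖ ≤ _
        rw [norm_mul, RCLike.norm_conj]
        gcongr
        have := (hK.size_right z.2 z.1 (dist_pos.1 (hε0.trans_le hd)).symm).trans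
          (mul_le_mul_right (hB z.1 (hDV hz).2 _ (by rwa [dist_comm])) _)
        rw [← ENNReal.coe_mul] at this
        rw [← coe_nnnorm]
        exact NNReal.coe_le_coe.2 (ENNReal.coe_le_coe.1 this)
  have hfinV : IsFiniteMeasure (μ.restrict (V n)) :=
    ⟨by rw [Measure.restrict_apply_univ]; exact hVfin⟩
  refine Integrable.ae_eq_of_forall_setIntegral_eq _ _
    ((Lp.memLp _).restrict (V n) |>.integrable one_le_two) (hFint (V n) (hVm n) subset_rfl).integral_prod_left
    fun s hs _ => ?_
  rw [Measure.restrict_restrict hs]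
  set D := s ∩ V n with hD
  have hDm : MeasurableSet D := hs.inter (hVm n)
  have hDV : D ⊆ V n := inter_subset_right
  have hDfin : μ D ≠ ∞ := ((measure_mono hDV).trans_lt hVfin).ne
  have hrep := hT.representation (D.indicator fun _ => (1 : 𝕜))
    (memLp_indicator_const 2 hDm 1 (Or.inr hDfin)) (memLp_indicator_const ∞ hDm 1 (Or.inr hDfin))
    (Metric.isBounded_ball.subset (support_indicator_subset.trans (hDV.trans inter_subset_right)))
  have hts : ∀ y ∈ Z, y ∉ tsupport (D.indicator fun _ => (1 : 𝕜)) := by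
    intro y hy hy'
    have hcl : tsupport (D.indicator fun _ => (1 : 𝕜)) ⊆ (Metric.thickening ε Z)ᶜ :=
      closure_minimal (support_indicator_subset.trans (hDV.trans inter_subset_left))
        Metric.isOpen_thickening.isClosed_compl
    exact hcl hy' (Metric.self_subset_thickening hε0 Z hy)
  rw [← L2.inner_indicatorConstLp_one hDm hDfin, ContinuousLinearMap.adjoint_inner_right,
    L2.inner_def]
  have hswap := integral_integral_swap (hFint D hDm hDV)
  refine Eq.trans ?_ hswap.symm
  refine integral_congr_ae ?_
  filter_upwards [hrep, hf.coeFn_toLp] with y hy1 hy2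
  rw [hy2]
  by_cases hfy : f y = 0
  · simp [hF, hfy]
  · have h3 : T (indicatorConstLp 2 hDm hDfin (1 : 𝕜)) y = ∫ x in D, K y x ∂μ := by
      refine (hy1 (hts y (subset_tsupport f hfy))).trans ?_
      rw [← integral_indicator hDm]
      refine integral_congr_ae (Eventually.of_forall fun x => ?_)
      by_cases hx : x ∈ D <;> simp [hx]
    rw [h3]
    simp only [hF]
    rw [integral_mul_const, integral_conj, RCLike.inner_apply, mul_comm]

end Adjoint

end NonHomog

namespace NonHomog

/-! ### Saturating weights -/

section Greedy

variable {X : Type*} [MetricSpace X] [MeasurableSpace X] [BorelSpace X]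

/-- The infimum of radii whose closed ball has mass at least $\beta$, with continuity of $\nu$ from
below and above. Only a two-sided bound is possible since spheres may carry mass. -/
theorem exists_radius_of_measure_lt {ν : Measure X} (hν : ∀ x r, ν (Metric.ball x r) < ∞) (x : X)
    {β : ℝ≥0∞} (hβ : β < ν univ) :
    ∃ ρ : ℝ, 0 ≤ ρ ∧ ν (Metric.ball x ρ) ≤ β ∧ β ≤ ν (Metric.closedBall x ρ) := by
  set S : Set ℝ := {ρ | 0 ≤ ρ ∧ β ≤ ν (Metric.closedBall x ρ)} with hS
  have hne : S.Nonempty := by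
    have hmono : Monotone fun n : ℕ => Metric.closedBall x (n : ℝ) :=
      fun m n hmn => Metric.closedBall_subset_closedBall (by exact_mod_cast hmn)
    have hU : ⋃ n : ℕ, Metric.closedBall x (n : ℝ) = univ := by
      refine eq_univ_of_forall fun y => ?_
      obtain ⟨n, hn⟩ := exists_nat_ge (dist y x)
      exact mem_iUnion.2 ⟨n, hn⟩
    rw [← hU, hmono.measure_iUnion, lt_iSup_iff] at hβ
    obtain ⟨n, hn⟩ := hβ
    exact ⟨n, n.cast_nonneg, hn.le⟩
  have hbdd : BddBelow S := ⟨0, fun ρ hρ => hρ.1⟩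
  set ρ := sInf S with hρ
  have hρ0 : 0 ≤ ρ := le_csInf hne fun r hr => hr.1
  refine ⟨ρ, hρ0, ?_, ?_⟩
  · have hmono : Monotone fun n : ℕ => Metric.closedBall x (ρ - 1 / ((n : ℝ) + 1)) := by
      intro m n hmn
      refine Metric.closedBall_subset_closedBall (sub_le_sub_left ?_ _)
      have : (m : ℝ) ≤ n := by exact_mod_cast hmn
      gcongr
    have hU : Metric.ball x ρ ⊆ ⋃ n : ℕ, Metric.closedBall x (ρ - 1 / ((n : ℝ) + 1)) := by
      intro y hy
      obtain ⟨n, hn⟩ := exists_nat_one_div_lt (sub_pos.2 (Metric.mem_ball.1 hy))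
      refine mem_iUnion.2 ⟨n, ?_⟩
      rw [Metric.mem_closedBall]
      linarith
    refine (measure_mono hU).trans ?_
    rw [hmono.measure_iUnion]
    refine iSup_le fun n => ?_
    by_contra hlt
    have hpos : 0 < 1 / ((n : ℝ) + 1) := by positivity
    rcases lt_or_ge (ρ - 1 / ((n : ℝ) + 1)) 0 with h0 | h0
    · rw [Metric.closedBall_eq_empty.2 h0] at hlt
      simp at hlt
    · have : ρ ≤ ρ - 1 / ((n : ℝ) + 1) := csInf_le hbdd ⟨h0, (not_le.1 hlt).le⟩
      linarith
  · have hanti : Antitone fun n : ℕ => Metric.closedBall x (ρ + 1 / ((n : ℝ) + 1)) := by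
      intro m n hmn
      refine Metric.closedBall_subset_closedBall (add_le_add_right ?_ _)
      have : (m : ℝ) ≤ n := by exact_mod_cast hmn
      gcongr
    have hI : ⋂ n : ℕ, Metric.closedBall x (ρ + 1 / ((n : ℝ) + 1)) = Metric.closedBall x ρ := by
      ext y
      rw [mem_iInter, Metric.mem_closedBall]
      constructor
      · intro hy
        refine le_of_forall_pos_le_add fun e he => ?_
        obtain ⟨n, hn⟩ := exists_nat_one_div_lt he
        exact (hy n).trans (by linarith)
      · intro hy n
        rw [Metric.mem_closedBall]
        have : 0 < 1 / ((n : ℝ) + 1) := by positivity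
        linarith
    have hlim := tendsto_measure_iInter_atTop (μ := ν)
      (s := fun n : ℕ => Metric.closedBall x (ρ + 1 / ((n : ℝ) + 1)))
      (fun n => Metric.isClosed_closedBall.measurableSet.nullMeasurableSet) hanti
      ⟨0, ((measure_mono (Metric.closedBall_subset_ball
        (lt_add_one (ρ + 1 / (((0 : ℕ) : ℝ) + 1))))).trans_lt (hν _ _)).ne⟩
    rw [hI] at hlim
    refine ge_of_tendsto' hlim fun n => ?_
    have hpos : 0 < 1 / ((n : ℝ) + 1) := by positivity
    obtain ⟨r, hr, hrlt⟩ := exists_lt_of_csInf_lt hne (show sInf S < ρ + 1 / ((n : ℝ) + 1) by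
      rw [← hρ]; linarith)
    exact hr.2.trans (measure_mono (Metric.closedBall_subset_closedBall hrlt.le))

/-- The free capacity $1-W$ is filled completely in an open ball, and in a constant fraction
$\theta$ on its bounding sphere, so that the total mass is exactly $\beta$. Weights instead of sets
make this possible when $\mu$ has atoms or charged spheres. -/
theorem exists_saturating_weight {μ : Measure X} (hμ : ∀ x r, μ (Metric.ball x r) < ∞)
    {W : X → ℝ≥0∞} (hW : Measurable W) (hW1 : ∀ y, W y ≤ 1) (x : X) {β : ℝ≥0∞}
    (hβ : β < ∫⁻ y, (1 - W y) ∂μ) :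
    ∃ ρ : ℝ, 0 ≤ ρ ∧ ∃ w : X → ℝ≥0∞, Measurable w ∧ (∀ y, W y + w y ≤ 1) ∧ ∫⁻ y, w y ∂μ = β ∧
      (∀ y ∉ Metric.closedBall x ρ, w y = 0) ∧ ∀ y ∈ Metric.ball x ρ, W y + w y = 1 := by
  have hWm : Measurable fun y => 1 - W y := measurable_const.sub hW
  set ν := μ.withDensity fun y => 1 - W y with hν
  have hνμ : ν ≤ μ := by
    refine Measure.le_iff.2 fun s hs => ?_
    rw [hν, withDensity_apply _ hs]
    calc ∫⁻ y in s, (1 - W y) ∂μ ≤ ∫⁻ y in s, 1 ∂μ := lintegral_mono fun y => tsub_le_self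
      _ = μ s := by simp
  have hνfin : ∀ x r, ν (Metric.ball x r) < ∞ := fun x r => (hνμ _).trans_lt (hμ x r)
  have hνu : ν univ = ∫⁻ y, (1 - W y) ∂μ := by
    rw [hν, withDensity_apply _ MeasurableSet.univ, Measure.restrict_univ]
  obtain ⟨ρ, hρ0, hρ1, hρ2⟩ := exists_radius_of_measure_lt hνfin x (hνu ▸ hβ)
  have hBm : MeasurableSet (Metric.ball x ρ) := Metric.isOpen_ball.measurableSet
  have hSm : MeasurableSet (Metric.sphere x ρ) := Metric.isClosed_sphere.measurableSet
  have hdisj : Disjoint (Metric.ball x ρ) (Metric.sphere x ρ) :=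
    Metric.sphere_disjoint_ball.symm
  have hcl : ν (Metric.closedBall x ρ) = ν (Metric.ball x ρ) + ν (Metric.sphere x ρ) := by
    rw [← Metric.ball_union_sphere, measure_union hdisj hSm]
  have hSfin : ν (Metric.sphere x ρ) ≠ ∞ :=
    ((measure_mono (Metric.sphere_subset_closedBall.trans (Metric.closedBall_subset_ball
      (lt_add_one ρ)))).trans_lt (hνfin x (ρ + 1))).ne
  -- If the sphere is null then nothing remains to be placed, and $0/0=0$ is the right value.
  set θ : ℝ≥0∞ := (β - ν (Metric.ball x ρ)) / ν (Metric.sphere x ρ) with hθ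
  have hsub : β - ν (Metric.ball x ρ) ≤ ν (Metric.sphere x ρ) := by
    rw [tsub_le_iff_left, ← hcl]; exact hρ2
  have hθ1 : θ ≤ 1 := ENNReal.div_le_of_le_mul (by rwa [one_mul])
  have hθν : θ * ν (Metric.sphere x ρ) = β - ν (Metric.ball x ρ) :=
    ENNReal.div_mul_cancel' (fun h0 => le_antisymm (h0 ▸ hsub) zero_le) (fun h0 => (hSfin h0).elim)
  set w : X → ℝ≥0∞ := (Metric.ball x ρ).indicator (fun y => 1 - W y) +
    (Metric.sphere x ρ).indicator (fun y => θ * (1 - W y)) with hw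
  have hwb : ∀ y ∈ Metric.ball x ρ, w y = 1 - W y := fun y hy => by
    simp [hw, hy, hdisj.notMem_of_mem_left hy, -Metric.mem_ball, -Metric.mem_sphere]
  have hws : ∀ y ∈ Metric.sphere x ρ, w y = θ * (1 - W y) := fun y hy => by
    simp [hw, hy, hdisj.notMem_of_mem_right hy, -Metric.mem_ball, -Metric.mem_sphere]
  have hwo : ∀ y ∉ Metric.closedBall x ρ, w y = 0 := fun y hy => by
    rw [← Metric.ball_union_sphere, mem_union, not_or] at hy
    simp [hw, hy.1, hy.2, -Metric.mem_ball, -Metric.mem_sphere]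
  have hwle : ∀ y, w y ≤ 1 - W y := by
    intro y
    by_cases h1 : y ∈ Metric.ball x ρ
    · rw [hwb y h1]
    by_cases h2 : y ∈ Metric.sphere x ρ
    · rw [hws y h2]; exact mul_le_of_le_one_left zero_le hθ1
    · rw [hwo y]
      · exact zero_le
      · rw [← Metric.ball_union_sphere, mem_union, not_or]; exact ⟨h1, h2⟩
  refine ⟨ρ, hρ0, w, (hWm.indicator hBm).add ((hWm.const_mul θ).indicator hSm), fun y => ?_, ?_,
    hwo, fun y hy => ?_⟩
  · calc W y + w y ≤ W y + (1 - W y) := by gcongr; exact hwle y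
      _ = 1 := add_tsub_cancel_of_le (hW1 y)
  · simp only [hw, Pi.add_apply]
    rw [lintegral_add_left (hWm.indicator hBm), lintegral_indicator hBm, lintegral_indicator hSm,
      lintegral_const_mul _ hWm, ← withDensity_apply _ hBm, ← withDensity_apply _ hSm, ← hν, hθν]
    exact add_tsub_cancel_of_le hρ1
  · rw [hwb y hy]; exact add_tsub_cancel_of_le (hW1 y)

/-- Greedy induction: the $n$-th weight uses the capacity left by the earlier ones, enough because
the total mass stays below $\mu(X)$. A ball once saturated stays so, as later weights cannot push
the sum above $1$. -/
theorem exists_saturating_weights {μ : Measure X} (hμ : ∀ x r, μ (Metric.ball x r) < ∞)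
    (x : ℕ → X) (β : ℕ → ℝ≥0∞) (n : ℕ) (hβ : ∑ i ∈ Finset.range n, β i < μ univ) :
    ∃ (ρ : ℕ → ℝ) (w : ℕ → X → ℝ≥0∞), (∀ i, Measurable (w i)) ∧
      (∀ y, ∑ i ∈ Finset.range n, w i y ≤ 1) ∧
      ∀ i < n, 0 ≤ ρ i ∧ ∫⁻ y, w i y ∂μ = β i ∧ (∀ y ∉ Metric.closedBall (x i) (ρ i), w i y = 0) ∧
        ∀ y ∈ Metric.ball (x i) (ρ i), ∑ j ∈ Finset.range n, w j y = 1 := by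
  induction n with
  | zero => exact ⟨0, 0, fun _ => measurable_zero, by simp, by simp⟩
  | succ n ih =>
    rw [Finset.sum_range_succ] at hβ
    obtain ⟨ρ, w, hwm, hw1, hw⟩ := ih (lt_of_le_of_lt le_self_add hβ)
    set W : X → ℝ≥0∞ := fun y => ∑ i ∈ Finset.range n, w i y with hW
    have hWm : Measurable W := Finset.measurable_sum _ fun i _ => hwm i
    have hWint : ∫⁻ y, W y ∂μ = ∑ i ∈ Finset.range n, β i := by
      rw [hW, lintegral_finsetSum _ fun i _ => hwm i]
      exact Finset.sum_congr rfl fun i hi => (hw i (Finset.mem_range.1 hi)).2.1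
    have hlt : β n < ∫⁻ y, (1 - W y) ∂μ := by
      have h1 : μ univ = ∫⁻ y, W y ∂μ + ∫⁻ y, (1 - W y) ∂μ := by
        have h2 : ∀ y, W y + (1 - W y) = 1 := fun y => add_tsub_cancel_of_le (hw1 y)
        rw [← lintegral_add_left hWm]
        simp only [h2]
        simp
      rw [h1, hWint] at hβ
      exact lt_of_add_lt_add_left hβ
    obtain ⟨r, hr0, v, hvm, hv1, hvint, hvo, hvs⟩ := exists_saturating_weight hμ hWm hw1 (x n) hlt
    refine ⟨Function.update ρ n r, Function.update w n v, fun i => ?_, ?_, ?_⟩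
    · by_cases hi : i = n
      · subst hi; simpa using hvm
      · simpa [hi] using hwm i
    all_goals
      have hsum : ∀ y, ∑ i ∈ Finset.range (n + 1), Function.update w n v i y = W y + v y := by
        intro y
        rw [Finset.sum_range_succ, Function.update_self]
        congr 1
        exact Finset.sum_congr rfl fun i hi => by
          rw [Function.update_of_ne (Finset.mem_range.1 hi).ne]
    · intro y; rw [hsum]; exact hv1 y
    · intro i hi
      simp only [hsum]
      rcases (Nat.lt_succ_iff.1 hi).lt_or_eq with hlt' | rfl
      · rw [Function.update_of_ne hlt'.ne, Function.update_of_ne hlt'.ne]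
        obtain ⟨h1, h2, h3, h4⟩ := hw i hlt'
        refine ⟨h1, h2, h3, fun y hy => le_antisymm (hv1 y) ?_⟩
        have : W y = 1 := h4 y hy
        rw [this]; exact le_self_add
      · rw [Function.update_self, Function.update_self]
        exact ⟨hr0, hvint, hvo, hvs⟩

end Greedy

end NonHomog

namespace NonHomog

/-! ### The weak type `(1, 1)` estimate -/

section WeakType

variable {X 𝕜 : Type*} [MetricSpace X] [MeasurableSpace X] [RCLike 𝕜]
  {μ : Measure X} {lam : X → ℝ → ℝ} {K : X → X → 𝕜} {δ a : ℝ} {C : ℝ≥0}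
  [BorelSpace X] [SecondCountableTopology X]

omit [BorelSpace X] [SecondCountableTopology X] in
theorem IsDominating.setLIntegral_ball_le_of_enorm_le_one (h : IsDominating μ lam) {φ : X → 𝕜}
    (hφ : ∀ y, ‖φ y‖ₑ ≤ 1) (x : X) {ρ : ℝ} (hρ : 0 < ρ) :
    ∫⁻ y in Metric.ball x ρ, ‖φ y‖ₑ ∂μ ≤ 1 * edom lam x ρ := by
  calc ∫⁻ y in Metric.ball x ρ, ‖φ y‖ₑ ∂μ ≤ ∫⁻ y in Metric.ball x ρ, 1 ∂μ :=
        lintegral_mono fun y => hφ y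
    _ = μ (Metric.ball x ρ) := by simp
    _ ≤ 1 * edom lam x ρ := by rw [one_mul]; exact h.measure_ball_le x ρ hρ

/-- The integral at $y$ is split at distance $as$ from $x$. The inner annulus is bounded by size,
since $\varphi$ vanishes on $B(x,s)$; the outer part is compared with $x$ by smoothness. Thus the
integral is constant in $y$ up to $O(1)$. -/
theorem KernelBounds.exists_integral_sub_truncated_le (h : IsDominating μ lam)
    (hK : KernelBounds lam K δ a C) :
    ∃ C' : ℝ≥0, ∀ φ : X → 𝕜, Integrable φ μ → (∀ y, ‖φ y‖ₑ ≤ 1) → ∀ (x : X) (s : ℝ), 0 < s →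
      (∀ z ∈ Metric.ball x s, φ z = 0) → ∀ y, dist x y ≤ s / 2 →
        ‖∫ z, K y z * φ z ∂μ - truncated μ K (a * s) φ x‖ₑ ≤ C' := by
  have ha := hK.two_le
  -- Seen from $y$ with inner radius $s/2$, the annulus has outer radius $as+s/2=(2a+1)(s/2)$.
  obtain ⟨C₁, hann⟩ := hK.exists_annulus_bound h (b := 2 * a + 1) (by linarith)
  obtain ⟨C₂, hdiff⟩ := hK.exists_diff_bound h
  refine ⟨C₁ + C₂, fun φ hφi hφ1 x s hs hφ0 y hxy => ?_⟩
  set G : Set X := {z | s ≤ dist x z ∧ dist x z < a * s} with hG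
  set F : Set X := {z | a * s ≤ dist x z} with hF
  have hGm : MeasurableSet G := (measurableSet_le_dist x _).inter (measurableSet_dist_lt x _)
  have hFm : MeasurableSet F := measurableSet_le_dist x _
  have hGF : {z | s ≤ dist x z} = G ∪ F := by
    ext z
    simp only [hG, hF, mem_union, mem_ofPred_eq]
    constructor
    · intro hz
      rcases lt_or_ge (dist x z) (a * s) with h1 | h1
      · exact Or.inl ⟨hz, h1⟩
      · exact Or.inr h1
    · rintro (⟨h1, -⟩ | h1)
      · exact h1
      · nlinarith
  have hdisj : Disjoint G F := disjoint_left.2 fun z hz hz' => not_le.2 hz.2 hz'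
  have hsub : {z | s ≤ dist x z} ⊆ {z | s / 2 ≤ dist y z} := by
    intro z (hz : s ≤ dist x z)
    have := dist_triangle x y z
    change s / 2 ≤ dist y z
    linarith
  have hint : IntegrableOn (fun z => K y z * φ z) {z | s ≤ dist x z} μ :=
    (hK.integrableOn h hφi y (by positivity : 0 < s / 2)).mono_set hsub
  have hintx : IntegrableOn (fun z => K x z * φ z) F μ :=
    hK.integrableOn h hφi x (by positivity)
  have h1 : ∫ z, K y z * φ z ∂μ = ∫ z in {z | s ≤ dist x z}, K y z * φ z ∂μ := by
    refine (setIntegral_eq_integral_of_forall_compl_eq_zero fun z hz => ?_).symm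
    rw [hφ0 z ?_, mul_zero]
    rw [Metric.mem_ball, dist_comm]
    exact not_le.1 hz
  rw [hGF] at h1 hint
  rw [h1, setIntegral_union hdisj hFm (hint.mono_set subset_union_left)
    (hint.mono_set subset_union_right), truncated, add_sub_assoc,
    ← integral_sub (hint.mono_set subset_union_right) hintx]
  refine (enorm_add_le _ _).trans ?_
  rw [ENNReal.coe_add]
  refine add_le_add ?_ ?_
  · refine (enorm_integral_le_lintegral_enorm _).trans ?_
    have := hann φ 1 y (s / 2) (by positivity)
      (h.setLIntegral_ball_le_of_enorm_le_one hφ1 y (by positivity))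
    rw [mul_one] at this
    refine le_trans (lintegral_mono_set fun z hz => ?_) this
    have t1 := dist_triangle x y z
    have t2 := dist_triangle y x z
    rw [dist_comm y x] at t2
    exact ⟨hsub hz.1, by linarith [hz.2]⟩
  · refine (enorm_integral_le_lintegral_enorm _).trans ?_
    have := hdiff φ 1 x y s hs (by linarith)
      fun ρ hρ => h.setLIntegral_ball_le_of_enorm_le_one hφ1 x (hs.trans_le hρ)
    rw [mul_one] at this
    refine le_trans (le_of_eq (lintegral_congr fun z => ?_)) this
    rw [← enorm_neg, neg_sub]

/-- Moving the centre from $x$ to $y$ changes the kernel by a smooth error and the domain by a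
symmetric difference inside $s\le d(y,z)<(a+1)s$, where the size bound suffices. -/
theorem KernelBounds.exists_truncated_le (h : IsDominating μ lam)
    (hK : KernelBounds lam K δ a C) :
    ∃ C' : ℝ≥0, ∀ φ : X → 𝕜, Integrable φ μ → (∀ y, ‖φ y‖ₑ ≤ 1) → ∀ (x : X) (s : ℝ), 0 < s →
      ∀ y, dist x y ≤ s →
        ‖truncated μ K (a * s) φ x‖ₑ ≤ maximalTruncated μ K φ y + C' := by
  have ha := hK.two_le
  obtain ⟨C₁, hann⟩ := hK.exists_annulus_bound h (b := a + 1) (by linarith)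
  obtain ⟨C₂, hdiff⟩ := hK.exists_diff_bound h
  refine ⟨C₁ + C₁ + C₂, fun φ hφi hφ1 x s hs y hxy => ?_⟩
  set Fx : Set X := {z | a * s ≤ dist x z} with hFx
  set Fy : Set X := {z | a * s ≤ dist y z} with hFy
  have hFxm : MeasurableSet Fx := measurableSet_le_dist x _
  have hFym : MeasurableSet Fy := measurableSet_le_dist y _
  have has : 0 < a * s := by positivity
  have hix : IntegrableOn (fun z => K x z * φ z) Fx μ := hK.integrableOn h hφi x has
  have hiyy : IntegrableOn (fun z => K y z * φ z) Fy μ := hK.integrableOn h hφi y has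
  have hiyx : IntegrableOn (fun z => K y z * φ z) Fx μ := by
    refine (hK.integrableOn h hφi y hs).mono_set fun z hz => ?_
    have h1 : a * s ≤ dist x z := hz
    have := dist_triangle x y z
    change s ≤ dist y z
    nlinarith
  have e1 := integral_inter_add_sdiff (s := Fx) (t := Fy) hFym hiyx
  have e2 := integral_inter_add_sdiff (s := Fy) (t := Fx) hFxm hiyy
  have hA := hann φ 1 y s hs
      (h.setLIntegral_ball_le_of_enorm_le_one hφ1 y (by positivity))
  rw [mul_one] at hA
  have b1 : ‖∫ z in Fx \ Fy, K y z * φ z ∂μ‖ₑ ≤ C₁ := by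
    refine (enorm_integral_le_lintegral_enorm _).trans (le_trans (lintegral_mono_set ?_) hA)
    rintro z ⟨hz1, hz2⟩
    have h1 : a * s ≤ dist x z := hz1
    have h2 : dist y z < a * s := not_le.1 hz2
    have := dist_triangle x y z
    exact ⟨by nlinarith, by nlinarith⟩
  have b2 : ‖∫ z in Fy \ Fx, K y z * φ z ∂μ‖ₑ ≤ C₁ := by
    refine (enorm_integral_le_lintegral_enorm _).trans (le_trans (lintegral_mono_set ?_) hA)
    rintro z ⟨hz1, hz2⟩
    have h1 : a * s ≤ dist y z := hz1
    have h2 : dist x z < a * s := not_le.1 hz2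
    have := dist_triangle y x z
    rw [dist_comm y x] at this
    exact ⟨by nlinarith, by nlinarith⟩
  have b3 : ‖∫ z in Fx, K x z * φ z ∂μ - ∫ z in Fx, K y z * φ z ∂μ‖ₑ ≤ C₂ := by
    rw [← integral_sub hix hiyx]
    refine (enorm_integral_le_lintegral_enorm _).trans ?_
    have := hdiff φ 1 x y s hs hxy
      fun ρ hρ => h.setLIntegral_ball_le_of_enorm_le_one hφ1 x (hs.trans_le hρ)
    rwa [mul_one] at this
  have b4 : ‖∫ z in Fy, K y z * φ z ∂μ‖ₑ ≤ maximalTruncated μ K φ y :=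
    le_iSup_of_le (a * s) (le_iSup_of_le has le_rfl)
  have key : truncated μ K (a * s) φ x = ∫ z in Fy, K y z * φ z ∂μ
      + (∫ z in Fx \ Fy, K y z * φ z ∂μ - ∫ z in Fy \ Fx, K y z * φ z ∂μ)
      + (∫ z in Fx, K x z * φ z ∂μ - ∫ z in Fx, K y z * φ z ∂μ) := by
    rw [← e1, ← e2, inter_comm Fy Fx, truncated]; ring
  rw [key]
  calc _ ≤ ‖∫ z in Fy, K y z * φ z ∂μ‖ₑ
      + (‖∫ z in Fx \ Fy, K y z * φ z ∂μ‖ₑ + ‖∫ z in Fy \ Fx, K y z * φ z ∂μ‖ₑ)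
      + ‖∫ z in Fx, K x z * φ z ∂μ - ∫ z in Fx, K y z * φ z ∂μ‖ₑ := by
        refine (enorm_add_le _ _).trans (add_le_add_left ?_ _)
        exact (enorm_add_le _ _).trans (add_le_add_right enorm_sub_le _)
    _ ≤ maximalTruncated μ K φ y + (C₁ + C₁) + C₂ := by gcongr
    _ = _ := by push_cast; ring

omit [BorelSpace X] [SecondCountableTopology X] in
theorem maximalFun_one_le_one {ρ : ℝ} (hρ : 1 ≤ ρ) {φ : X → 𝕜} (hφ : ∀ y, ‖φ y‖ₑ ≤ 1) (x : X) :
    maximalFun μ 1 ρ φ x ≤ 1 := by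
  rw [maximalFun_eq one_pos]
  simp only [ENNReal.rpow_one, div_one]
  refine (ballAvgSup_le_add (fun y => ‖φ y‖ₑ) hρ (v := 0) measurable_zero (s := 1)
    (fun y => by simpa using hφ y) x).trans ?_
  simp [ballAvgSup]

omit [MetricSpace X] [BorelSpace X] [SecondCountableTopology X] in
-- Kolmogorov's inequality with exponents $1<2$ for the measure $W\mu\le\mu$. The free parameter
-- $s_0$ allows later absorption.
theorem lintegral_mul_weight_le_of_weakType [SFinite μ] {W g : X → ℝ≥0∞} (hW : Measurable W)
    (hW1 : ∀ y, W y ≤ 1) (hg : Measurable g) {P : ℝ≥0∞}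
    (hweak : ∀ s : ℝ, 0 < s → μ {x | ENNReal.ofReal s < g x} ≤ ENNReal.ofReal (s ^ (-2 : ℝ)) * P)
    {s₀ : ℝ} (hs₀ : 0 < s₀) :
    ∫⁻ x, W x * g x ∂μ ≤ ENNReal.ofReal s₀ * ∫⁻ x, W x ∂μ + ENNReal.ofReal s₀⁻¹ * P := by
  have hνμ : μ.withDensity W ≤ μ := by
    refine Measure.le_iff.2 fun s hs => ?_
    rw [withDensity_apply _ hs]
    calc ∫⁻ y in s, W y ∂μ ≤ ∫⁻ y in s, 1 ∂μ := lintegral_mono fun y => hW1 y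
      _ = μ s := by simp
  have h1 := lintegral_rpow_le_of_weakType (ν := μ.withDensity W) hg.aemeasurable
    (q := 2) (η := 1) one_pos one_lt_two (fun s hs => (hνμ _).trans (hweak s hs)) hs₀
  simp only [ENNReal.rpow_one, Real.rpow_one] at h1
  rw [lintegral_withDensity_eq_lintegral_mul _ hW hg, withDensity_apply _ MeasurableSet.univ,
    Measure.restrict_univ] at h1
  refine h1.trans (le_of_eq ?_)
  norm_num [Real.rpow_neg_one]

variable {T : Lp 𝕜 2 μ →L[𝕜] Lp 𝕜 2 μ}

/-- Cotlar with exponent $2$ dominates $T_*\varphi$ by maximal functions of weak type $(2,2)$ and a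
constant, since $|\varphi|\le1$. Large $s$ makes the coefficient of $\int|\varphi|^2$ as small as
desired. -/
theorem IsCZOperator.exists_lintegral_mul_weight_le (h : IsDominating μ lam)
    (hT : IsCZOperator μ lam K T) :
    ∃ C : ℝ≥0, ∀ (φ : X → 𝕜) (hφ2 : MemLp φ 2 μ), MemLp φ ∞ μ →
      Bornology.IsBounded (Function.support φ) → (∀ y, ‖φ y‖ₑ ≤ 1) →
      ∀ W : X → ℝ≥0∞, Measurable W → (∀ y, W y ≤ 1) → ∀ s : ℝ, 1 ≤ s →
      ∫⁻ y, W y * (‖T (hφ2.toLp φ) y‖ₑ + maximalTruncated μ K φ y) ∂μ ≤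
        C * (ENNReal.ofReal s * ∫⁻ y, W y ∂μ +
          ENNReal.ofReal s⁻¹ * ∫⁻ y, ‖φ y‖ₑ ^ (2 : ℝ) ∂μ) := by
  have := h.isLocallyFiniteMeasure
  obtain ⟨C, hC⟩ := hT.cotlar_two h
  obtain ⟨B, hB⟩ := lintegral_enorm_rpow_two_apply_le T
  refine ⟨(B + 1) + C * (B + 1) + C * 1 + C, fun φ hφ2 hφ hb hφ1 W hW hW1 s hs => ?_⟩
  have hs0 : 0 < s := by linarith
  set Tφ := T (hφ2.toLp φ) with hTφ
  have hTm : Measurable fun y => ‖Tφ y‖ₑ := (Lp.stronglyMeasurable _).enorm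
  set P : ℝ≥0∞ := ∫⁻ y, ‖φ y‖ₑ ^ (2 : ℝ) ∂μ with hP
  set w : ℝ≥0∞ := ∫⁻ y, W y ∂μ with hw
  have hBP : ∫⁻ y, ‖Tφ y‖ₑ ^ (2 : ℝ) ∂μ ≤ B * P := hB φ hφ2
  have hloc : ∀ {g : X → ℝ≥0∞}, Measurable g → ∀ {D : ℝ≥0},
      (∀ s : ℝ, 0 < s → μ {x | ENNReal.ofReal s < g x} ≤ ENNReal.ofReal (s ^ (-2 : ℝ)) * (D * P)) →
      1 ≤ D → ∫⁻ x, W x * g x ∂μ ≤ D * (ENNReal.ofReal s * w + ENNReal.ofReal s⁻¹ * P) := by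
    intro g hg D hD hD1
    refine (lintegral_mul_weight_le_of_weakType hW hW1 hg hD hs0).trans ?_
    rw [mul_add]
    refine add_le_add ?_ (le_of_eq (by ring))
    exact le_mul_of_one_le_left zero_le (by exact_mod_cast hD1)
  have hB1 : B * P ≤ ((B + 1 : ℝ≥0) : ℝ≥0∞) * P := by
    gcongr; exact_mod_cast le_self_add
  have i1 : ∫⁻ x, W x * ‖Tφ x‖ₑ ∂μ ≤
      (B + 1 : ℝ≥0) * (ENNReal.ofReal s * w + ENNReal.ofReal s⁻¹ * P) := by
    refine hloc hTm (fun r hr => ?_) le_add_self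
    have hr2 : (0 : ℝ) < r ^ (2 : ℝ) := by positivity
    have := meas_ge_le_lintegral_div (μ := μ) (hTm.pow_const (2 : ℝ)).aemeasurable
      (ε := ENNReal.ofReal (r ^ (2 : ℝ))) (by rwa [Ne, ENNReal.ofReal_eq_zero, not_le]) ENNReal.ofReal_ne_top
    calc μ {x | ENNReal.ofReal r < ‖Tφ x‖ₑ}
        ≤ μ {x | ENNReal.ofReal (r ^ (2 : ℝ)) ≤ ‖Tφ x‖ₑ ^ (2 : ℝ)} := by
          refine measure_mono fun x hx => ?_
          rw [mem_ofPred_eq] at hx ⊢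
          rw [← ENNReal.ofReal_rpow_of_pos hr]
          exact ENNReal.rpow_le_rpow hx.le zero_le_two
      _ ≤ _ := this
      _ = ENNReal.ofReal (r ^ (-2 : ℝ)) * ∫⁻ y, ‖Tφ y‖ₑ ^ (2 : ℝ) ∂μ := by
          rw [Real.rpow_neg hr.le, ENNReal.ofReal_inv_of_pos hr2, div_eq_mul_inv, mul_comm]
      _ ≤ _ := by gcongr; exact hBP.trans hB1
  have i2 : ∫⁻ x, W x * maximalFun μ 2 6 Tφ x ∂μ ≤
      (B + 1 : ℝ≥0) * (ENNReal.ofReal s * w + ENNReal.ofReal s⁻¹ * P) := by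
    refine hloc (measurable_maximalFun two_pos _ _) (fun r hr => ?_) le_add_self
    refine (meas_maximalFun_le two_pos (by norm_num) _ hr).trans ?_
    gcongr; exact hBP.trans hB1
  have i3 : ∫⁻ x, W x * maximalFun μ 2 5 φ x ∂μ ≤
      (1 : ℝ≥0) * (ENNReal.ofReal s * w + ENNReal.ofReal s⁻¹ * P) := by
    refine hloc (measurable_maximalFun two_pos _ _) (fun r hr => ?_) le_rfl
    refine (meas_maximalFun_le two_pos (by norm_num) _ hr).trans ?_
    rw [ENNReal.coe_one, one_mul]
  have i4 : w ≤ ENNReal.ofReal s * w + ENNReal.ofReal s⁻¹ * P :=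
    le_add_right (le_mul_of_one_le_left zero_le (by simpa using hs))
  calc ∫⁻ y, W y * (‖Tφ y‖ₑ + maximalTruncated μ K φ y) ∂μ
      ≤ ∫⁻ y, (W y * ‖Tφ y‖ₑ + C * (W y * maximalFun μ 2 6 Tφ y) +
          C * (W y * maximalFun μ 2 5 φ y) + C * W y) ∂μ := by
        refine lintegral_mono fun y => ?_
        calc W y * (‖Tφ y‖ₑ + maximalTruncated μ K φ y)
            ≤ W y * (‖Tφ y‖ₑ + C * (maximalFun μ 2 6 Tφ y + maximalFun μ 2 5 φ y + 1)) := by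
              gcongr
              refine (hC φ hφ hb hφ2 y).trans ?_
              gcongr
              exact maximalFun_one_le_one (by norm_num) hφ1 y
          _ = _ := by ring
    _ = ∫⁻ y, W y * ‖Tφ y‖ₑ ∂μ + C * ∫⁻ y, W y * maximalFun μ 2 6 Tφ y ∂μ +
          C * ∫⁻ y, W y * maximalFun μ 2 5 φ y ∂μ + C * w := by
        have m1 : Measurable fun y => W y * maximalFun μ 2 6 Tφ y :=
          hW.mul (measurable_maximalFun two_pos _ _)
        have m2 : Measurable fun y => W y * maximalFun μ 2 5 φ y :=
          hW.mul (measurable_maximalFun two_pos _ _)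
        rw [lintegral_add_right _ (hW.const_mul _), lintegral_add_right _ (m2.const_mul _),
          lintegral_add_right _ (m1.const_mul _), lintegral_const_mul _ m1,
          lintegral_const_mul _ m2, lintegral_const_mul _ hW]
    _ ≤ (B + 1 : ℝ≥0) * (ENNReal.ofReal s * w + ENNReal.ofReal s⁻¹ * P) +
        C * ((B + 1 : ℝ≥0) * (ENNReal.ofReal s * w + ENNReal.ofReal s⁻¹ * P)) +
        C * ((1 : ℝ≥0) * (ENNReal.ofReal s * w + ENNReal.ofReal s⁻¹ * P)) +
        C * (ENNReal.ofReal s * w + ENNReal.ofReal s⁻¹ * P) := by gcongr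
    _ = _ := by push_cast; ring

end WeakType

end NonHomog

namespace NonHomog

/-! ### The bad part by duality -/

section WeakType

variable {X 𝕜 : Type*} [MetricSpace X] [MeasurableSpace X] [RCLike 𝕜]
  {μ : Measure X} {lam : X → ℝ → ℝ} {K : X → X → 𝕜}
  [BorelSpace X] [SecondCountableTopology X] {T : Lp 𝕜 2 μ →L[𝕜] Lp 𝕜 2 μ}

omit [MetricSpace X] [BorelSpace X] [SecondCountableTopology X] in
-- Superadditivity of the lower integral needs no measurability; it is applied to integrands
-- containing the maximal truncation, whose measurability is not yet established.
theorem sum_lintegral_le_lintegral_sum {ι : Type*} (s : Finset ι) (f : ι → X → ℝ≥0∞) :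
    ∑ i ∈ s, ∫⁻ x, f i x ∂μ ≤ ∫⁻ x, ∑ i ∈ s, f i x ∂μ := by
  classical
  induction s using Finset.induction_on with
  | empty => simp
  | insert i s hi ih =>
    simp only [Finset.sum_insert hi]
    exact (add_le_add_right ih _).trans (le_lintegral_add _ _)

omit [MetricSpace X] [BorelSpace X] [SecondCountableTopology X] in
/-- Pairing with a function of mean zero is insensitive to subtracting a constant. -/
theorem enorm_inner_le_of_integral_eq {p h v : X → 𝕜} (hp2 : MemLp p 2 μ) (hh2 : MemLp h 2 μ)
    (hv2 : MemLp v 2 μ) (hh1 : Integrable h μ) (hv1 : Integrable v μ) {t : ℝ} (ht : 0 < t)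
    (hmean : ∫ y, h y ∂μ = t * ∫ y, v y ∂μ) (κ : 𝕜) :
    ‖inner 𝕜 (hp2.toLp p) (hh2.toLp h - (t : 𝕜) • hv2.toLp v)‖ₑ ≤
      ∫⁻ y, ‖h y‖ₑ * ‖p y - κ‖ₑ ∂μ + ENNReal.ofReal t * ∫⁻ y, ‖v y‖ₑ * ‖p y - κ‖ₑ ∂μ := by
  have hinner : ∀ (g : X → 𝕜) (hg2 : MemLp g 2 μ), Integrable g μ →
      inner 𝕜 (hp2.toLp p) (hg2.toLp g) = ∫ y, g y * (starRingEnd 𝕜) (p y - κ) ∂μ +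
        (∫ y, g y ∂μ) * (starRingEnd 𝕜) κ := by
    intro g hg2 hg1
    have hcongr : (fun y => inner 𝕜 (hp2.toLp p y) (hg2.toLp g y)) =ᵐ[μ]
        fun y => g y * (starRingEnd 𝕜) (p y) := by
      filter_upwards [hp2.coeFn_toLp, hg2.coeFn_toLp] with y hy1 hy2
      rw [hy1, hy2, RCLike.inner_apply]
    have hint := (L2.integrable_inner (𝕜 := 𝕜) (hp2.toLp p) (hg2.toLp g)).congr hcongr
    rw [L2.inner_def, integral_congr_ae hcongr]
    simp only [map_sub, mul_sub]
    rw [integral_sub hint (hg1.mul_const _), integral_mul_const]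
    ring
  rw [inner_sub_right, inner_smul_right, hinner h hh2 hh1, hinner v hv2 hv1, hmean]
  have e : ∫ y, h y * (starRingEnd 𝕜) (p y - κ) ∂μ + (t * ∫ y, v y ∂μ) * (starRingEnd 𝕜) κ -
      t * (∫ y, v y * (starRingEnd 𝕜) (p y - κ) ∂μ + (∫ y, v y ∂μ) * (starRingEnd 𝕜) κ) =
      ∫ y, h y * (starRingEnd 𝕜) (p y - κ) ∂μ -
        t * ∫ y, v y * (starRingEnd 𝕜) (p y - κ) ∂μ := by ring
  rw [e]
  refine enorm_sub_le.trans ?_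
  have hn : ∀ g : X → 𝕜, ‖∫ y, g y * (starRingEnd 𝕜) (p y - κ) ∂μ‖ₑ ≤
      ∫⁻ y, ‖g y‖ₑ * ‖p y - κ‖ₑ ∂μ := by
    intro g
    refine (enorm_integral_le_lintegral_enorm _).trans (le_of_eq (lintegral_congr fun y => ?_))
    rw [enorm_mul, ← ofReal_norm ((starRingEnd 𝕜) _), RCLike.norm_conj, ofReal_norm]
  refine add_le_add (hn h) ?_
  rw [enorm_mul]
  refine mul_le_mul' (le_of_eq ?_) (hn v)
  rw [← ofReal_norm, RCLike.norm_ofReal, abs_of_pos ht]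

/-- Testing $Tb$ on $S$ against its phase $\varphi$ gives $t\mu(S)\le|\langle T^*\varphi,b\rangle|$.
Each summand of $b$ has mean zero, so a truncation value $\kappa_i$ may be subtracted from
$T^*\varphi$. On $g_i$ the difference is $O(1)$; on $v_i$ it is at most
$|T^*\varphi|+T^*_*\varphi+O(1)$, with $T^*_*$ the maximal truncation of the adjoint kernel. Summed
against $\sum w_i\le1$, the latter is bounded by $O(m)$ and a small multiple of $\mu(S)$. -/
theorem IsCZOperator.exists_bad_part_bound (h : IsDominating μ lam)
    (hT : IsCZOperator μ lam K T) :
    ∃ C : ℝ≥0, ∀ {n : ℕ} {x : Fin n → X} {s : Fin n → ℝ} {g v : Fin n → X → 𝕜}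
      {w : Fin n → X → ℝ≥0∞} {t : ℝ} {m : ℝ≥0∞}, 0 < t → (∀ i, 0 < s i) →
      ∀ (hg2 : ∀ i, MemLp (g i) 2 μ) (hv2 : ∀ i, MemLp (v i) 2 μ),
      (∀ i, Integrable (g i) μ) → (∀ i, Integrable (v i) μ) →
      (∀ i, ∫ y, g i y ∂μ = t * ∫ y, v i y ∂μ) →
      (∀ i y, g i y ≠ 0 → dist (x i) y ≤ s i / 2) →
      (∀ i y, w i y ≠ 0 → dist (x i) y ≤ s i) →
      (∀ i y, ‖v i y‖ₑ ≤ w i y) → (∀ i, Measurable (w i)) → (∀ y, ∑ i, w i y ≤ 1) →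
      ∫⁻ y, ∑ i, w i y ∂μ ≤ m → ∑ i, ∫⁻ y, ‖g i y‖ₑ ∂μ ≤ ENNReal.ofReal t * m →
      ∀ S : Set X, MeasurableSet S → Bornology.IsBounded S →
      (∀ i, Disjoint S (Metric.ball (x i) (s i))) →
      (∀ y ∈ S, ENNReal.ofReal t ≤
        ‖T (∑ i, ((hg2 i).toLp (g i) - (t : 𝕜) • (hv2 i).toLp (v i))) y‖ₑ) →
      μ S ≤ C * m := by
  have hT' := hT.adjoint h
  set T' := ContinuousLinearMap.adjoint T with hT'def
  set K' : X → X → 𝕜 := fun x y => (starRingEnd 𝕜) (K y x) with hK'def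
  obtain ⟨δ, a, C₀, hK'⟩ := hT'.kernel.exists_kernelBounds h
  obtain ⟨C₁, hC₁⟩ := hK'.exists_integral_sub_truncated_le h
  obtain ⟨C₂, hC₂⟩ := hK'.exists_truncated_le h
  obtain ⟨C₃, hC₃⟩ := hT'.exists_lintegral_mul_weight_le h
  refine ⟨2 * (C₁ + C₂ + C₃ * (2 * C₃ + 1)), ?_⟩
  intro n x s g v w t m ht hs hg2 hv2 hg1 hv1 hmean hgs hws hvw hwm hw1 hwint hgint S hS hSb hSx hSt
  set bL : Lp 𝕜 2 μ := ∑ i, ((hg2 i).toLp (g i) - (t : 𝕜) • (hv2 i).toLp (v i)) with hbL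
  have ht0 : ENNReal.ofReal t ≠ 0 := by simpa using ht
  have hSfin : μ S < ∞ := h.measure_lt_top_of_isBounded hSb
  have hSfin' : IsFiniteMeasure (μ.restrict S) := ⟨by rwa [Measure.restrict_apply_univ]⟩
  -- Where $Tb=0$ the quotient is $0$; elsewhere on $S$ it has modulus one.
  set φ : X → 𝕜 := S.indicator fun y => T bL y / (‖T bL y‖ : 𝕜) with hφ
  have hTm : StronglyMeasurable (T bL) := Lp.stronglyMeasurable _
  have hφm : Measurable φ :=
    (hTm.measurable.div (RCLike.measurable_ofReal.comp hTm.measurable.norm)).indicator hS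
  have hφn : ∀ y, ‖φ y‖ ≤ 1 := by
    intro y
    by_cases hy : y ∈ S
    · rw [hφ, indicator_of_mem hy, norm_div, RCLike.norm_ofReal, abs_norm]
      exact div_self_le_one _
    · simp [hφ, hy]
  have hφ1 : ∀ y, ‖φ y‖ₑ ≤ 1 := by
    intro y
    rw [← ofReal_norm]
    exact (ENNReal.ofReal_le_ofReal (hφn y)).trans (by simp)
  have hφS : Function.support φ ⊆ S := support_indicator_subset
  have hφb : Bornology.IsBounded (Function.support φ) := hSb.subset hφS
  have hφtop : MemLp φ ∞ μ :=
    memLp_top_of_bound hφm.aestronglyMeasurable 1 (Eventually.of_forall hφn)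
  have hφ2 : MemLp φ 2 μ := h.memLp_of_isBounded_support hφtop hφb 2
  have hφi : Integrable φ μ :=
    memLp_one_iff_integrable.1 (h.memLp_of_isBounded_support hφtop hφb 1)
  have hP : ∫⁻ y, ‖φ y‖ₑ ^ (2 : ℝ) ∂μ ≤ μ S := by
    rw [← lintegral_indicator_one hS]
    refine lintegral_mono fun y => ?_
    by_cases hy : y ∈ S
    · rw [indicator_of_mem hy]
      exact ENNReal.rpow_le_one (hφ1 y) zero_le_two
    · simp [hφ, hy]
  set p := T' (hφ2.toLp φ) with hp
  set W : X → ℝ≥0∞ := fun y => ∑ i, w i y with hW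
  have hWm : Measurable W := Finset.measurable_sum _ fun i _ => hwm i
  set G : X → ℝ≥0∞ := fun y => ‖p y‖ₑ + maximalTruncated μ K' φ y with hG
  have hpL : (Lp.memLp p).toLp p = p := Lp.toLp_coeFn _ _
  have hterm : ∀ i, ‖inner 𝕜 p ((hg2 i).toLp (g i) - (t : 𝕜) • (hv2 i).toLp (v i))‖ₑ ≤
      C₁ * ∫⁻ y, ‖g i y‖ₑ ∂μ + ENNReal.ofReal t * ∫⁻ y, w i y * (G y + C₂) ∂μ := by
    intro i
    set κ := truncated μ K' (a * s i) φ (x i) with hκ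
    have hφ0 : ∀ z ∈ Metric.ball (x i) (s i), φ z = 0 := fun z hz =>
      indicator_of_notMem (fun hzS => disjoint_left.1 (hSx i) hzS hz) _
    have hmain := enorm_inner_le_of_integral_eq (Lp.memLp p) (hg2 i) (hv2 i) (hg1 i) (hv1 i) ht
      (hmean i) κ
    rw [hpL] at hmain
    refine hmain.trans (add_le_add ?_ (mul_le_mul_right ?_ _))
    · rw [← lintegral_const_mul' _ _ ENNReal.coe_ne_top]
      have hts : tsupport φ ⊆ (Metric.ball (x i) (s i))ᶜ :=
        closure_minimal (fun z hz hzb => hz (hφ0 z hzb)) Metric.isOpen_ball.isClosed_compl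
      refine lintegral_mono_ae ?_
      filter_upwards [hT'.representation φ hφ2 hφtop hφb] with y hy
      by_cases hgy : g i y = 0
      · simp [hgy]
      · have hd := hgs i y hgy
        rw [mul_comm]
        gcongr
        rw [hp, hy fun hc => hts hc ?_]
        · exact hC₁ φ hφi hφ1 (x i) (s i) (hs i) hφ0 y hd
        · rw [Metric.mem_ball, dist_comm]
          linarith [hs i]
    · refine lintegral_mono fun y => ?_
      by_cases hwy : w i y = 0
      · have : ‖v i y‖ₑ = 0 := le_antisymm (hwy ▸ hvw i y) zero_le
        simp [this]
      · refine mul_le_mul' (hvw i y) ?_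
        refine enorm_sub_le.trans ?_
        rw [hG, add_assoc]
        gcongr
        exact hC₂ φ hφi hφ1 (x i) (s i) (hs i) y (hws i y hwy)
  have hpair : ENNReal.ofReal t * μ S ≤ ‖inner 𝕜 p bL‖ₑ := by
    have e1 : inner 𝕜 p bL = ((∫ y in S, ‖T bL y‖ ∂μ : ℝ) : 𝕜) := by
      rw [hp, hT'def, ContinuousLinearMap.adjoint_inner_left, L2.inner_def, ← integral_ofReal,
        ← integral_indicator hS]
      refine integral_congr_ae ?_
      filter_upwards [hφ2.coeFn_toLp] with y hy
      rw [hy]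
      by_cases hyS : y ∈ S
      · rw [indicator_of_mem hyS, hφ, indicator_of_mem hyS, RCLike.inner_apply, map_div₀,
          RCLike.conj_ofReal, mul_div_assoc', RCLike.mul_conj]
        by_cases h0 : (‖T bL y‖ : 𝕜) = 0
        · rw [h0]; simp
        · rw [sq, mul_div_cancel_right₀ _ h0]
      · simp [hφ, hyS]
    have e2 : ‖inner 𝕜 p bL‖ₑ = ∫⁻ y in S, ‖T bL y‖ₑ ∂μ := by
      rw [e1, ← ofReal_norm, RCLike.norm_ofReal, abs_of_nonneg (integral_nonneg fun y => norm_nonneg _),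
        ofReal_integral_norm_eq_lintegral_enorm]
      exact ((Lp.memLp (T bL)).restrict S).integrable one_le_two
    rw [e2, ← setLIntegral_const]
    exact setLIntegral_mono' hS hSt
  have hsum : ENNReal.ofReal t * μ S ≤ ENNReal.ofReal t *
      (C₁ * m + (∫⁻ y, W y * G y ∂μ + C₂ * m)) := by
    calc ENNReal.ofReal t * μ S ≤ ‖inner 𝕜 p bL‖ₑ := hpair
      _ ≤ ∑ i, ‖inner 𝕜 p ((hg2 i).toLp (g i) - (t : 𝕜) • (hv2 i).toLp (v i))‖ₑ := by
          rw [hbL, inner_sum]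
          exact enorm_sum_le _ _
      _ ≤ ∑ i, (C₁ * ∫⁻ y, ‖g i y‖ₑ ∂μ +
            ENNReal.ofReal t * ∫⁻ y, w i y * (G y + C₂) ∂μ) := Finset.sum_le_sum fun i _ => hterm i
      _ = C₁ * ∑ i, ∫⁻ y, ‖g i y‖ₑ ∂μ +
            ENNReal.ofReal t * ∑ i, ∫⁻ y, w i y * (G y + C₂) ∂μ := by
          rw [Finset.sum_add_distrib, Finset.mul_sum, Finset.mul_sum]
      _ ≤ C₁ * (ENNReal.ofReal t * m) +
            ENNReal.ofReal t * ∫⁻ y, (W y * G y + C₂ * W y) ∂μ := by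
          gcongr
          refine (sum_lintegral_le_lintegral_sum _ _).trans (le_of_eq (lintegral_congr fun y => ?_))
          rw [← Finset.sum_mul]; ring
      _ = C₁ * (ENNReal.ofReal t * m) +
            ENNReal.ofReal t * (∫⁻ y, W y * G y ∂μ + C₂ * ∫⁻ y, W y ∂μ) := by
          rw [lintegral_add_right _ (hWm.const_mul _), lintegral_const_mul _ hWm]
      _ ≤ C₁ * (ENNReal.ofReal t * m) +
            ENNReal.ofReal t * (∫⁻ y, W y * G y ∂μ + C₂ * m) := by gcongr
      _ = _ := by ring
  have hsum2 := (ENNReal.mul_le_mul_iff_right ht0 ENNReal.ofReal_ne_top).1 hsum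
  -- Chosen so that $C_3/\sigma\le1/2$; the resulting $\mu(S)/2$ is absorbed on the left, legitimate
  -- because the bounded set $S$ has finite measure.
  set σ : ℝ := 2 * C₃ + 1 with hσ
  have hC₃0 : (0 : ℝ) ≤ C₃ := C₃.2
  have hσ1 : 1 ≤ σ := by linarith
  have hWG := hC₃ φ hφ2 hφtop hφb hφ1 W hWm hw1 σ hσ1
  have hσe : ENNReal.ofReal σ = ((2 * C₃ + 1 : ℝ≥0) : ℝ≥0∞) := by
    rw [hσ, ENNReal.ofReal]
    congr 1
    ext
    rw [Real.coe_toNNReal _ (by positivity)]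
    push_cast; ring
  have hhalf : (C₃ : ℝ≥0∞) * (ENNReal.ofReal σ⁻¹ * μ S) ≤ μ S / 2 := by
    rw [← mul_assoc, ENNReal.div_eq_inv_mul]
    gcongr
    have : (C₃ : ℝ≥0∞) = ENNReal.ofReal C₃ := by simp
    rw [this, ← ENNReal.ofReal_mul hC₃0]
    have e : (2 : ℝ≥0∞)⁻¹ = ENNReal.ofReal (2⁻¹) := by
      rw [ENNReal.ofReal_inv_of_pos two_pos]; simp
    rw [e]
    refine ENNReal.ofReal_le_ofReal ?_
    rw [← div_eq_mul_inv, div_le_iff₀ (by linarith)]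
    linarith
  have hfinal : μ S / 2 + μ S / 2 ≤
      (C₁ * m + C₂ * m + C₃ * (ENNReal.ofReal σ * m)) + μ S / 2 := by
    rw [ENNReal.add_halves]
    calc μ S ≤ C₁ * m + (∫⁻ y, W y * G y ∂μ + C₂ * m) := hsum2
      _ ≤ C₁ * m + (C₃ * (ENNReal.ofReal σ * m + ENNReal.ofReal σ⁻¹ * μ S) + C₂ * m) := by
          gcongr
          refine hWG.trans ?_
          gcongr
      _ = (C₁ * m + C₂ * m + C₃ * (ENNReal.ofReal σ * m)) +
            C₃ * (ENNReal.ofReal σ⁻¹ * μ S) := by ring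
      _ ≤ _ := by gcongr
  have hhalf2 : μ S / 2 ≤ C₁ * m + C₂ * m + C₃ * (ENNReal.ofReal σ * m) :=
    (ENNReal.add_le_add_iff_right (ENNReal.div_ne_top hSfin.ne two_ne_zero)).1 hfinal
  calc μ S = 2 * (μ S / 2) := (ENNReal.mul_div_cancel two_ne_zero ENNReal.ofNat_ne_top).symm
    _ ≤ 2 * (C₁ * m + C₂ * m + C₃ * (ENNReal.ofReal σ * m)) := by gcongr
    _ = _ := by rw [hσe]; push_cast; ring

end WeakType

end NonHomog

namespace NonHomog

/-! ### Calderón–Zygmund decomposition and the weak type bound -/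

section WeakType

variable {X 𝕜 : Type*} [MetricSpace X] [MeasurableSpace X] [RCLike 𝕜]
  {μ : Measure X} {lam : X → ℝ → ℝ} {K : X → X → 𝕜}
  [BorelSpace X] [SecondCountableTopology X] {T : Lp 𝕜 2 μ →L[𝕜] Lp 𝕜 2 μ}

/-- A measurable subset of an open set splits into countably many pieces, each lying in a ball
whose dilation stays inside the open set. -/
theorem exists_pieces {F U : Set X} (hF : F.Nonempty) (hFm : MeasurableSet F) (hU : IsOpen U)
    (hFU : F ⊆ U) {a : ℝ} (ha : 0 < a) :
    ∃ (x : ℕ → X) (r : ℕ → ℝ) (Q : ℕ → Set X), (∀ i, 0 < r i) ∧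
      (∀ i, Metric.ball (x i) (a * r i) ⊆ U) ∧ (∀ i, MeasurableSet (Q i)) ∧
      (∀ i, Q i ⊆ Metric.ball (x i) (r i)) ∧ Pairwise (Function.onFun Disjoint Q) ∧
      ⋃ i, Q i = F := by
  have hr : ∀ x : X, ∃ r, 0 < r ∧ (x ∈ F → Metric.ball x (a * r) ⊆ U) := by
    intro x
    by_cases hx : x ∈ F
    · obtain ⟨e, he, hsub⟩ := Metric.isOpen_iff.1 hU x (hFU hx)
      exact ⟨e / a, by positivity, fun _ => by rwa [mul_div_cancel₀ _ ha.ne']⟩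
    · exact ⟨1, one_pos, fun h => (hx h).elim⟩
  choose r hr0 hrU using hr
  obtain ⟨t, htF, htc, hcov⟩ := TopologicalSpace.countable_cover_nhdsWithin
    (f := fun x => Metric.ball x (r x)) (s := F)
    fun x _ => mem_nhdsWithin_of_mem_nhds (Metric.ball_mem_nhds x (hr0 x))
  have htn : t.Nonempty := by
    obtain ⟨y, hy⟩ := hF
    obtain ⟨z, hz, -⟩ := mem_iUnion₂.1 (hcov hy)
    exact ⟨z, hz⟩
  obtain ⟨x, hx⟩ := htc.exists_eq_range htn
  have hxt : ∀ i, x i ∈ F := fun i => htF (hx ▸ mem_range_self i)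
  refine ⟨x, fun i => r (x i), disjointed fun i => F ∩ Metric.ball (x i) (r (x i)),
    fun i => hr0 _, fun i => hrU _ (hxt i), fun i => ?_, fun i => ?_, disjoint_disjointed _, ?_⟩
  · exact MeasurableSet.disjointed (fun j => hFm.inter Metric.isOpen_ball.measurableSet) i
  · exact (disjointed_subset _ i).trans inter_subset_right
  · rw [iUnion_disjointed, ← inter_iUnion, inter_eq_left]
    refine hcov.trans (iUnion₂_subset fun z hz => ?_)
    rw [hx] at hz
    obtain ⟨i, rfl⟩ := hz
    exact subset_iUnion (fun i => Metric.ball (x i) (r (x i))) i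

omit [MetricSpace X] [BorelSpace X] [SecondCountableTopology X] in
-- The tails decrease to the empty set and the integral is finite. Only finitely many pieces are
-- thus needed in the decomposition.
theorem exists_setLIntegral_diff_le {u : X → ℝ≥0∞} (hu : ∫⁻ x, u x ∂μ ≠ ∞) {Q : ℕ → Set X}
    (hQ : ∀ i, MeasurableSet (Q i)) {ε : ℝ≥0∞} (hε : 0 < ε) :
    ∃ n, ∫⁻ x in (⋃ i, Q i) \ ⋃ i : Fin n, Q i, u x ∂μ ≤ ε := by
  set A : ℕ → Set X := fun n => (⋃ i, Q i) \ ⋃ i : Fin n, Q i with hA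
  have hAm : ∀ n, MeasurableSet (A n) := fun n =>
    (MeasurableSet.iUnion hQ).diff (MeasurableSet.iUnion fun i => hQ i)
  have hanti : Antitone A := by
    intro m n hmn y hy
    refine ⟨hy.1, fun hc => hy.2 ?_⟩
    obtain ⟨i, hi⟩ := mem_iUnion.1 hc
    exact mem_iUnion.2 ⟨⟨i, i.2.trans_le hmn⟩, hi⟩
  have hI : ⋂ n, A n = ∅ := by
    refine eq_empty_of_forall_notMem fun y hy => ?_
    rw [mem_iInter] at hy
    obtain ⟨i, hi⟩ := mem_iUnion.1 (hy 0).1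
    exact (hy (i + 1)).2 (mem_iUnion.2 ⟨⟨i, i.lt_succ_self⟩, hi⟩)
  have hlim := tendsto_measure_iInter_atTop (μ := μ.withDensity u)
    (fun n => (hAm n).nullMeasurableSet) hanti ⟨0, by
      rw [withDensity_apply _ (hAm 0)]
      exact ((setLIntegral_le_lintegral _ _).trans_lt hu.lt_top).ne⟩
  rw [hI, measure_empty] at hlim
  obtain ⟨n, hn⟩ := (hlim.eventually (gt_mem_nhds hε)).exists
  refine ⟨n, ?_⟩
  rw [← withDensity_apply _ (hAm n)]
  exact hn.le

/-- Calderón–Zygmund decomposition at height `t`, with bad parts concentrated near points. -/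
theorem exists_decomposition (h : IsDominating μ lam) {f : X → 𝕜} (hfm : StronglyMeasurable f)
    (hf2 : MemLp f 2 μ) (hf1 : Integrable f μ) {t : ℝ} (ht : 0 < t) {m : ℝ≥0∞}
    (hm : ∫⁻ y, ‖f y‖ₑ ∂μ = ENNReal.ofReal t * m) (hm0 : m ≠ 0) (hmμ : m < μ univ) :
    ∃ (n : ℕ) (x : Fin n → X) (s : Fin n → ℝ) (g v : Fin n → X → 𝕜) (w : Fin n → X → ℝ≥0∞)
      (O : Set X), MeasurableSet O ∧ μ O ≤ 3 * m ∧ (∀ i, 0 < s i) ∧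
      (∀ i, Metric.ball (x i) (s i) ⊆ O) ∧
      (∀ i, MemLp (g i) 2 μ) ∧ (∀ i, MemLp (v i) 2 μ) ∧
      (∀ i, Integrable (g i) μ) ∧ (∀ i, Integrable (v i) μ) ∧
      (∀ i, ∫ y, g i y ∂μ = t * ∫ y, v i y ∂μ) ∧
      (∀ i y, g i y ≠ 0 → dist (x i) y ≤ s i / 2) ∧
      (∀ i y, w i y ≠ 0 → dist (x i) y ≤ s i) ∧
      (∀ i y, ‖v i y‖ₑ ≤ w i y) ∧ (∀ i, Measurable (w i)) ∧ (∀ y, ∑ i, w i y ≤ 1) ∧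
      ∫⁻ y, ∑ i, w i y ∂μ ≤ m ∧ ∑ i, ∫⁻ y, ‖g i y‖ₑ ∂μ ≤ ENNReal.ofReal t * m ∧
      ∫⁻ y, ‖f y - ∑ i, (g i y - t * v i y)‖ₑ ^ (2 : ℝ) ∂μ ≤ 6 * ENNReal.ofReal t ^ 2 * m := by
  have := h.isLocallyFiniteMeasure
  have ht0 : ENNReal.ofReal t ≠ 0 := by simpa using ht
  have httop : ENNReal.ofReal t ≠ ∞ := ENNReal.ofReal_ne_top
  have hf1' : ∫⁻ y, ‖f y‖ₑ ∂μ < ∞ := hf1.2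
  have hf2' : ∫⁻ y, ‖f y‖ₑ ^ (2 : ℝ) ∂μ ≠ ∞ := by
    have := (eLpNorm_lt_top_iff_lintegral_rpow_enorm_lt_top two_ne_zero ENNReal.ofNat_ne_top).1 hf2.2
    simpa using this.ne
  have hmtop : m ≠ ∞ := by
    rintro rfl
    rw [ENNReal.mul_top ht0] at hm
    exact hf1'.ne hm
  set F : Set X := {y | ENNReal.ofReal t < ‖f y‖ₑ} with hF
  have hFm : MeasurableSet F := measurableSet_lt measurable_const hfm.enorm
  have hFμ : μ F ≤ m := by
    have h1 := mul_meas_ge_le_lintegral (μ := μ) hfm.enorm (ENNReal.ofReal t)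
    rw [hm] at h1
    refine le_trans (measure_mono fun y hy => ?_) ((ENNReal.mul_le_mul_iff_right ht0 httop).1 h1)
    exact (show ENNReal.ofReal t < ‖f y‖ₑ from hy).le
  have hgood : ∫⁻ y in Fᶜ, ‖f y‖ₑ ^ (2 : ℝ) ∂μ ≤ ENNReal.ofReal t ^ 2 * m := by
    calc ∫⁻ y in Fᶜ, ‖f y‖ₑ ^ (2 : ℝ) ∂μ ≤ ∫⁻ y in Fᶜ, ENNReal.ofReal t * ‖f y‖ₑ ∂μ := by
          refine setLIntegral_mono' hFm.compl fun y hy => ?_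
          have hy' : ‖f y‖ₑ ≤ ENNReal.ofReal t := not_lt.1 hy
          rw [ENNReal.rpow_two, sq]
          gcongr
      _ ≤ ∫⁻ y, ENNReal.ofReal t * ‖f y‖ₑ ∂μ := setLIntegral_le_lintegral _ _
      _ = ENNReal.ofReal t ^ 2 * m := by rw [lintegral_const_mul' _ _ httop, hm]; ring
  rcases F.eq_empty_or_nonempty with hFe | hFne
  · refine ⟨0, Fin.elim0, Fin.elim0, Fin.elim0, Fin.elim0, Fin.elim0, ∅, MeasurableSet.empty,
      by simp, by simp, by simp, by simp, by simp, by simp, by simp, by simp, by simp, by simp,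
      by simp, by simp, by simp, by simp, by simp, ?_⟩
    rw [hFe, compl_empty, Measure.restrict_univ] at hgood
    simp only [Finset.univ_eq_empty, Finset.sum_empty, sub_zero]
    refine hgood.trans ?_
    rw [mul_assoc]
    exact le_mul_of_one_le_left zero_le (by norm_num)
  -- Outer regularity with $\mu(F)\le m<2m$; the strictness uses $0<m<\infty$.
  obtain ⟨U, hFU, hUo, hUμ⟩ := F.exists_isOpen_lt_of_lt (2 * m)
    (lt_of_le_of_lt hFμ (by
      rw [two_mul]; exact ENNReal.lt_add_right hmtop hm0))
  obtain ⟨x, r, Q, hr0, hrU, hQm, hQr, hQd, hQF⟩ :=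
    exists_pieces hFne hFm hUo hFU (a := 2) two_pos
  obtain ⟨n, hn⟩ := exists_setLIntegral_diff_le hf2' hQm
    (ε := ENNReal.ofReal t ^ 2 * m) (pos_iff_ne_zero.2 (mul_ne_zero (pow_ne_zero _ ht0) hm0))
  rw [hQF] at hn
  set R : Set X := ⋃ i : Fin n, Q i with hR
  have hRm : MeasurableSet R := MeasurableSet.iUnion fun i => hQm i
  set α : ℕ → ℝ≥0∞ := fun i => ∫⁻ y in Q i, ‖f y‖ₑ ∂μ with hα
  have hαtop : ∀ i, α i ≠ ∞ := fun i => ((setLIntegral_le_lintegral _ _).trans_lt hf1').ne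
  have hαsum : ∑ i ∈ Finset.range n, α i ≤ ENNReal.ofReal t * m := by
    rw [← hm, ← lintegral_biUnion_finset (fun i _ j _ hij => hQd hij) fun i _ => hQm i]
    exact setLIntegral_le_lintegral _ _
  set β : ℕ → ℝ≥0∞ := fun i => (ENNReal.ofReal t)⁻¹ * α i with hβ
  have hβsum : ∑ i ∈ Finset.range n, β i ≤ m := by
    rw [hβ, ← Finset.mul_sum]
    calc _ ≤ (ENNReal.ofReal t)⁻¹ * (ENNReal.ofReal t * m) := by gcongr
      _ = m := by rw [← mul_assoc, ENNReal.inv_mul_cancel ht0 httop, one_mul]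
  obtain ⟨ρ, w, hwm, hw1, hw⟩ := exists_saturating_weights h.measure_ball_lt_top x β n
    (hβsum.trans_lt hmμ)
  have hwsum : ∀ y, ∑ i : Fin n, w i y = ∑ i ∈ Finset.range n, w i y := fun y =>
    (Finset.sum_range fun i => w i y).symm
  have hwle : ∀ (i : Fin n) y, w i y ≤ 1 := fun i y => by
    refine le_trans ?_ (hw1 y)
    exact Finset.single_le_sum (f := fun i => w i y) (fun _ _ => zero_le) (Finset.mem_range.2 i.2)
  have hwtop : ∀ (i : Fin n) y, w i y ≠ ∞ := fun i y => ((hwle i y).trans_lt ENNReal.one_lt_top).ne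
  have hwint : ∀ i : Fin n, ∫⁻ y, w i y ∂μ = β i := fun i => (hw i i.2).2.1
  have hWint : ∫⁻ y, ∑ i : Fin n, w i y ∂μ ≤ m := by
    rw [lintegral_finsetSum Finset.univ (fun (i : Fin n) _ => hwm i)]
    simp only [hwint]
    rwa [← Finset.sum_range fun i => β i]
  set E : Set X := {y | 1 ≤ ∑ i ∈ Finset.range n, w i y} with hE
  have hEm : MeasurableSet E :=
    measurableSet_le measurable_const (Finset.measurable_sum _ fun i _ => hwm i)
  have hEμ : μ E ≤ m := by
    have h1 := mul_meas_ge_le_lintegral (μ := μ)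
      (Finset.measurable_sum (Finset.range n) fun i _ => hwm i) 1
    rw [one_mul] at h1
    refine h1.trans (le_trans (le_of_eq ?_) hWint)
    exact lintegral_congr fun y => by rw [Finset.sum_range]
  set I : Fin n → 𝕜 := fun i => ∫ y in Q i, f y ∂μ with hI
  have hIα : ∀ i : Fin n, ‖I i‖ ≤ (α i).toReal := by
    intro i
    rw [← toReal_enorm]
    exact ENNReal.toReal_mono (hαtop i) (enorm_integral_le_lintegral_enorm _)
  -- The weight $w_i$ has mass $t^{-1}\int_{Q_i}|f|$; the factor $\theta_i$, of modulus at most $1$,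
  -- corrects this to $t\int v_i=\int_{Q_i}f$.
  set θ : Fin n → 𝕜 := fun i => I i / ((α i).toReal : 𝕜) with hθ
  have hθ1 : ∀ i, ‖θ i‖ ≤ 1 := by
    intro i
    rw [hθ, norm_div, RCLike.norm_ofReal, abs_of_nonneg ENNReal.toReal_nonneg]
    exact div_le_one_of_le₀ (hIα i) ENNReal.toReal_nonneg
  have hθα : ∀ i, θ i * ((α i).toReal : 𝕜) = I i := by
    intro i
    by_cases h0 : (α i).toReal = 0
    · have : I i = 0 := by
        rw [← norm_le_zero_iff, ← h0]; exact hIα i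
      rw [h0, this]; simp
    · exact div_mul_cancel₀ _ (by exact_mod_cast h0)
  set v : Fin n → X → 𝕜 := fun i y => θ i * ((w i y).toReal : 𝕜) with hv
  have hvw : ∀ i y, ‖v i y‖ₑ ≤ w i y := by
    intro i y
    rw [← ofReal_norm, hv, norm_mul, RCLike.norm_ofReal, abs_of_nonneg ENNReal.toReal_nonneg]
    calc ENNReal.ofReal (‖θ i‖ * (w i y).toReal) ≤ ENNReal.ofReal (w i y).toReal :=
          ENNReal.ofReal_le_ofReal (mul_le_of_le_one_left ENNReal.toReal_nonneg (hθ1 i))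
      _ = w i y := ENNReal.ofReal_toReal (hwtop i y)
  have hvm : ∀ i, AEStronglyMeasurable (v i) μ := fun i =>
    ((RCLike.measurable_ofReal.comp (hwm i).ennreal_toReal).const_mul _).aestronglyMeasurable
  have hβtop : ∀ i, β i ≠ ∞ := fun i => ENNReal.mul_ne_top (ENNReal.inv_ne_top.2 ht0) (hαtop i)
  have hvint : ∀ i, Integrable (v i) μ := fun i =>
    ⟨hvm i, (lintegral_mono (hvw i)).trans_lt ((hwint i).symm ▸ (hβtop i).lt_top)⟩
  have hv2 : ∀ i, MemLp (v i) 2 μ := by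
    intro i
    refine ⟨hvm i, ?_⟩
    rw [eLpNorm_lt_top_iff_lintegral_rpow_enorm_lt_top two_ne_zero ENNReal.ofNat_ne_top]
    refine lt_of_le_of_lt (lintegral_mono fun y => ?_) (hvint i).2
    rw [ENNReal.toReal_ofNat, ENNReal.rpow_two, sq]
    exact mul_le_of_le_one_left zero_le ((hvw i y).trans (hwle i y))
  -- The maximum dominates both the piece ($2r_i$) and the weight ($\rho_i$). Whichever attains it,
  -- the ball lies in the exceptional set: in $U$ by the choice of pieces, or in $E$ by saturation.
  refine ⟨n, fun i => x i, fun i => max (2 * r i) (ρ i), fun i => (Q i).indicator f, v,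
    fun i => w i, U ∪ E, hUo.measurableSet.union hEm, ?_, ?_, ?_, ?_, hv2, ?_, hvint, ?_, ?_, ?_,
    hvw, fun i => hwm i, fun y => by rw [hwsum]; exact hw1 y, hWint, ?_, ?_⟩
  · refine (measure_union_le _ _).trans ?_
    calc μ U + μ E ≤ 2 * m + m := add_le_add hUμ.le hEμ
      _ = 3 * m := by ring
  · exact fun i => lt_max_of_lt_left (by linarith [hr0 i])
  · intro i
    show Metric.ball (x i) (max (2 * r i) (ρ i)) ⊆ U ∪ E
    rcases max_choice (2 * r i) (ρ i) with h1 | h1 <;> rw [h1]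
    · exact (hrU i).trans subset_union_left
    · exact fun y hy => Or.inr ((hw i i.2).2.2.2 y hy).ge
  · exact fun i => hf2.indicator (hQm i)
  · exact fun i => hf1.indicator (hQm i)
  · intro i
    rw [integral_indicator (hQm i)]
    simp only [hv]
    rw [integral_const_mul, integral_ofReal, integral_toReal (hwm i).aemeasurable
      (Eventually.of_forall fun y => (hwtop i y).lt_top), hwint i, hβ]
    simp only [ENNReal.toReal_mul, ENNReal.toReal_inv, ENNReal.toReal_ofReal ht.le]
    push_cast
    have htk : (t : 𝕜) ≠ 0 := by exact_mod_cast ht.ne'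
    rw [mul_left_comm, ← mul_assoc (t : 𝕜), mul_inv_cancel₀ htk, one_mul, hθα]
  · intro i y hy
    have hyQ : y ∈ Q i := mem_of_indicator_ne_zero hy
    have := hQr i hyQ
    rw [Metric.mem_ball, dist_comm] at this
    linarith [le_max_left (2 * r i) (ρ i)]
  · intro i y hy
    by_contra hlt
    refine hy ((hw i i.2).2.2.1 y fun hc => hlt ?_)
    rw [Metric.mem_closedBall, dist_comm] at hc
    exact hc.trans (le_max_right _ _)
  · refine le_trans (le_of_eq ?_) hαsum
    rw [Finset.sum_range]
    refine Finset.sum_congr rfl fun i _ => ?_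
    change ∫⁻ y, ‖(Q i).indicator f y‖ₑ ∂μ = ∫⁻ y in Q i, ‖f y‖ₑ ∂μ
    rw [← lintegral_indicator (hQm i)]
    simp only [enorm_indicator_eq_indicator_enorm]
  · have hind : ∀ y, ∑ i : Fin n, (Q i).indicator f y = R.indicator f y := by
      intro y
      by_cases hy : y ∈ R
      · obtain ⟨i, hi⟩ := mem_iUnion.1 hy
        rw [indicator_of_mem hy, Finset.sum_eq_single i, indicator_of_mem hi]
        · intro j _ hji
          refine indicator_of_notMem (fun hj => ?_) _
          exact disjoint_left.1 (hQd fun hc => hji (Fin.ext hc)) hj hi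
        · simp
      · rw [indicator_of_notMem hy]
        refine Finset.sum_eq_zero fun i _ => indicator_of_notMem (fun hi => hy ?_) _
        exact mem_iUnion.2 ⟨i, hi⟩
    have hptw : ∀ y, ‖f y - ∑ i : Fin n, ((Q i).indicator f y - t * v i y)‖ₑ ^ (2 : ℝ) ≤
        2 * Rᶜ.indicator (fun y => ‖f y‖ₑ ^ (2 : ℝ)) y +
          2 * (ENNReal.ofReal t ^ 2 * ∑ i : Fin n, w i y) := by
      intro y
      have e1 : f y - ∑ i : Fin n, ((Q i).indicator f y - t * v i y) =
          Rᶜ.indicator f y + t * ∑ i, v i y := by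
        rw [Finset.sum_sub_distrib, hind, ← Finset.mul_sum]
        by_cases hy : y ∈ R <;> simp [hy]
      rw [e1, ENNReal.rpow_two]
      have h2 : ‖(t : 𝕜) * ∑ i, v i y‖ₑ ≤ ENNReal.ofReal t * ∑ i : Fin n, w i y := by
        rw [enorm_mul]
        refine mul_le_mul' (le_of_eq ?_) ((enorm_sum_le _ _).trans
          (Finset.sum_le_sum fun i _ => hvw i y))
        rw [← ofReal_norm, RCLike.norm_ofReal, abs_of_pos ht]
      have h3 : (∑ i : Fin n, w i y) ^ 2 ≤ ∑ i : Fin n, w i y := by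
        rw [sq]; exact mul_le_of_le_one_left zero_le (by rw [hwsum]; exact hw1 y)
      calc ‖Rᶜ.indicator f y + t * ∑ i, v i y‖ₑ ^ 2
          ≤ (‖Rᶜ.indicator f y‖ₑ + ENNReal.ofReal t * ∑ i : Fin n, w i y) ^ 2 := by
            gcongr
            exact (enorm_add_le _ _).trans (add_le_add_right h2 _)
        _ ≤ 2 * (‖Rᶜ.indicator f y‖ₑ ^ 2 + (ENNReal.ofReal t * ∑ i : Fin n, w i y) ^ 2) := by
            have := ENNReal.rpow_add_le_mul_rpow_add_rpow ‖Rᶜ.indicator f y‖ₑ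
              (ENNReal.ofReal t * ∑ i : Fin n, w i y) one_le_two
            simpa only [ENNReal.rpow_two, show (2 : ℝ) - 1 = 1 by norm_num, ENNReal.rpow_one]
              using this
        _ ≤ 2 * (Rᶜ.indicator (fun y => ‖f y‖ₑ ^ (2 : ℝ)) y +
              ENNReal.ofReal t ^ 2 * ∑ i : Fin n, w i y) := by
            rw [mul_pow]
            gcongr
            by_cases hy : y ∈ R <;> simp [hy]
        _ = _ := by ring
    have hRc : ∫⁻ y in Rᶜ, ‖f y‖ₑ ^ (2 : ℝ) ∂μ ≤ 2 * (ENNReal.ofReal t ^ 2 * m) := by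
      have hsub : Rᶜ ⊆ Fᶜ ∪ F \ R := by
        intro y hy
        by_cases hyF : y ∈ F
        · exact Or.inr ⟨hyF, hy⟩
        · exact Or.inl hyF
      calc _ ≤ ∫⁻ y in Fᶜ ∪ F \ R, ‖f y‖ₑ ^ (2 : ℝ) ∂μ := lintegral_mono_set hsub
        _ ≤ _ := lintegral_union_le _ _ _
        _ ≤ ENNReal.ofReal t ^ 2 * m + ENNReal.ofReal t ^ 2 * m := add_le_add hgood hn
        _ = _ := by ring
    refine (lintegral_mono hptw).trans ?_
    rw [lintegral_add_right _ (((Finset.measurable_sum Finset.univ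
      fun (i : Fin n) _ => hwm i).const_mul _).const_mul _),
      lintegral_const_mul' _ _ ENNReal.ofNat_ne_top, lintegral_const_mul' _ _ ENNReal.ofNat_ne_top,
      lintegral_const_mul' _ _ (ENNReal.pow_ne_top httop), lintegral_indicator hRm.compl]
    calc _ ≤ 2 * (2 * (ENNReal.ofReal t ^ 2 * m)) + 2 * (ENNReal.ofReal t ^ 2 * m) := by gcongr
      _ = _ := by ring

omit [MetricSpace X] [BorelSpace X] [SecondCountableTopology X] in
theorem meas_lt_le_of_lintegral_sq_le {u : X → ℝ≥0∞} (hu : AEMeasurable u μ) {t : ℝ} (ht : 0 < t)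
    {A : ℝ≥0∞} (hA : ∫⁻ y, u y ^ (2 : ℝ) ∂μ ≤ ENNReal.ofReal t ^ 2 * A) :
    μ {y | ENNReal.ofReal t < u y} ≤ A := by
  have ht0 : ENNReal.ofReal t ^ 2 ≠ 0 := pow_ne_zero _ (by simpa using ht)
  have h1 := mul_meas_ge_le_lintegral₀ (μ := μ) (hu.pow_const (2 : ℝ)) (ENNReal.ofReal t ^ 2)
  refine le_trans (measure_mono fun y hy => ?_) ((ENNReal.mul_le_mul_iff_right ht0
    (ENNReal.pow_ne_top ENNReal.ofReal_ne_top)).1 (h1.trans hA))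
  rw [mem_ofPred_eq] at hy ⊢
  rw [ENNReal.rpow_two]
  gcongr

/-- A Calderón–Zygmund operator is of weak type `(1, 1)`. -/
theorem IsCZOperator.weakType (h : IsDominating μ lam) (hT : IsCZOperator μ lam K T) :
    ∃ C : ℝ≥0, ∀ (f : X → 𝕜) (hf2 : MemLp f 2 μ), Integrable f μ → ∀ t : ℝ, 0 < t →
      μ {x | ENNReal.ofReal t < ‖T (hf2.toLp f) x‖ₑ} ≤
        C * (ENNReal.ofReal t⁻¹ * ∫⁻ y, ‖f y‖ₑ ∂μ) := by
  obtain ⟨C, hC⟩ := hT.exists_bad_part_bound h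
  obtain ⟨B, hB⟩ := lintegral_enorm_rpow_two_apply_le T
  have key : ∀ (f : X → 𝕜) (hf2 : MemLp f 2 μ), Integrable f μ → ∀ t : ℝ, 0 < t →
      μ {x | ENNReal.ofReal (2 * t) < ‖T (hf2.toLp f) x‖ₑ} ≤
        -- The good part contributes $6B$, the exceptional set $3$, and the bad part outside it $C$.
        (6 * B + 3 + C : ℝ≥0) * (ENNReal.ofReal t⁻¹ * ∫⁻ y, ‖f y‖ₑ ∂μ) := by
    intro f hf2 hf1 t ht
    wlog hfm : StronglyMeasurable f generalizing f
    · set f' := hf2.1.mk f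
      have hff' : f =ᵐ[μ] f' := hf2.1.ae_eq_mk
      have hf2' : MemLp f' 2 μ := (memLp_congr_ae hff').1 hf2
      have := this f' hf2' (hf1.congr hff') hf2.1.stronglyMeasurable_mk
      rw [MemLp.toLp_congr hf2 hf2' hff', lintegral_congr_ae (hff'.mono fun y hy => by rw [hy])]
      exact this
    have ht0 : ENNReal.ofReal t ≠ 0 := by simpa using ht
    set m : ℝ≥0∞ := ENNReal.ofReal t⁻¹ * ∫⁻ y, ‖f y‖ₑ ∂μ with hm
    have hm' : ∫⁻ y, ‖f y‖ₑ ∂μ = ENNReal.ofReal t * m := by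
      rw [hm, ← mul_assoc, ENNReal.ofReal_inv_of_pos ht,
        ENNReal.mul_inv_cancel ht0 ENNReal.ofReal_ne_top, one_mul]
    -- If $\mu(X)\le m$ there is no room for the weights, but the estimate is trivial since the
    -- constant is at least $1$.
    rcases le_or_gt (μ univ) m with hmμ | hmμ
    · refine (measure_mono (subset_univ _)).trans (hmμ.trans (le_mul_of_one_le_left zero_le ?_))
      exact_mod_cast (by norm_num : (1 : ℝ≥0) ≤ 3).trans (le_add_right le_add_self)
    rcases eq_or_ne m 0 with hm0 | hm0
    · have hf0 : f =ᵐ[μ] 0 := by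
        rw [hm0, mul_zero, lintegral_eq_zero_iff hfm.enorm] at hm'
        exact hm'.mono fun y hy => enorm_eq_zero.1 hy
      have e1 : hf2.toLp f = 0 := (MemLp.toLp_eq_toLp_iff hf2 MemLp.zero).2 hf0
      have e2 : ∀ᵐ y ∂μ, T (hf2.toLp f) y = 0 := by
        rw [e1, map_zero]; exact Lp.coeFn_zero _ _ _
      have e3 : μ {x | ENNReal.ofReal (2 * t) < ‖T (hf2.toLp f) x‖ₑ} = 0 := by
        rw [measure_eq_zero_iff_ae_notMem]
        filter_upwards [e2] with y hy hc
        rw [hy] at hc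
        simp at hc
      rw [e3]; exact zero_le
    obtain ⟨n, x, s, g, v, w, O, hOm, hOμ, hs, hsO, hg2, hv2, hg1, hv1, hmean, hgs, hws, hvw, hwm,
      hw1, hwint, hgint, hG⟩ := exists_decomposition h hfm hf2 hf1 ht hm' hm0 hmμ
    set bL : Lp 𝕜 2 μ := ∑ i, ((hg2 i).toLp (g i) - (t : 𝕜) • (hv2 i).toLp (v i)) with hbL
    set G : X → 𝕜 := fun y => f y - ∑ i, (g i y - t * v i y) with hGdef
    have hb2 : MemLp (fun y => ∑ i, (g i y - t * v i y)) 2 μ :=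
      memLp_finsetSum _ fun i _ => (hg2 i).sub ((hv2 i).const_mul _)
    have hG2 : MemLp G 2 μ := hf2.sub hb2
    have hbcoe : bL =ᵐ[μ] fun y => ∑ i, (g i y - t * v i y) := by
      have e1 : ∀ i, ((hg2 i).toLp (g i) - (t : 𝕜) • (hv2 i).toLp (v i) : Lp 𝕜 2 μ) =
          ((hg2 i).sub ((hv2 i).const_smul (t : 𝕜))).toLp _ := fun i => rfl
      have e2 : ∀ᵐ y ∂μ, ∀ i, ((hg2 i).toLp (g i) - (t : 𝕜) • (hv2 i).toLp (v i) : Lp 𝕜 2 μ) y =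
          g i y - t * v i y := ae_all_iff.2 fun i => by
        rw [e1 i]; exact MemLp.coeFn_toLp _
      have e3 : bL =ᵐ[μ] ∑ i, ⇑((hg2 i).toLp (g i) - (t : 𝕜) • (hv2 i).toLp (v i) : Lp 𝕜 2 μ) :=
        Lp.coeFn_finsetSum _ _
      filter_upwards [e2, e3] with y hy2 hy3
      rw [hy3, Finset.sum_apply]
      exact Finset.sum_congr rfl fun i _ => hy2 i
    have hsplit : hf2.toLp f = hG2.toLp G + bL := by
      refine Lp.ext ?_
      filter_upwards [hf2.coeFn_toLp, Lp.coeFn_add (hG2.toLp G) bL, hG2.coeFn_toLp, hbcoe]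
        with y h1 h2 h3 h4
      rw [h1, h2, Pi.add_apply, h3, h4, hGdef]
      ring
    have hTsplit : ∀ᵐ y ∂μ, T (hf2.toLp f) y = T (hG2.toLp G) y + T bL y := by
      rw [hsplit, map_add]; exact Lp.coeFn_add _ _
    have hgoodpart : μ {y | ENNReal.ofReal t < ‖T (hG2.toLp G) y‖ₑ} ≤ 6 * B * m := by
      refine meas_lt_le_of_lintegral_sq_le (Lp.aestronglyMeasurable _).enorm ht ?_
      refine (hB G hG2).trans ?_
      calc B * ∫⁻ y, ‖G y‖ₑ ^ (2 : ℝ) ∂μ ≤ B * (6 * ENNReal.ofReal t ^ 2 * m) := by gcongr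
        _ = _ := by ring
    have hbadpart : μ {y | ENNReal.ofReal t < ‖T bL y‖ₑ} ≤ 3 * m + C * m := by
      rcases isEmpty_or_nonempty X with hX | ⟨⟨x₀⟩⟩
      · rw [Set.eq_empty_of_isEmpty {y | ENNReal.ofReal t < ‖T bL y‖ₑ}]; simp
      set S : ℕ → Set X := fun k =>
        ({y | ENNReal.ofReal t < ‖T bL y‖ₑ} ∩ Oᶜ) ∩ Metric.ball x₀ k with hS
      have hSm : ∀ k, MeasurableSet (S k) := fun k =>
        ((measurableSet_lt measurable_const (Lp.stronglyMeasurable (T bL)).enorm).inter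
          hOm.compl).inter Metric.isOpen_ball.measurableSet
      have hSk : ∀ k, μ (S k) ≤ C * m := fun k =>
        hC ht hs hg2 hv2 hg1 hv1 hmean hgs hws hvw hwm hw1 hwint hgint (S k) (hSm k)
          (Metric.isBounded_ball.subset inter_subset_right)
          (fun i => disjoint_left.2 fun y hy hyb => hy.1.2 (hsO i hyb))
          (fun y hy => le_of_lt (show _ < _ from hy.1.1))
      have hmono : Monotone S := fun j k hjk => inter_subset_inter_right _
        (Metric.ball_subset_ball (by exact_mod_cast hjk))
      have hcov : {y | ENNReal.ofReal t < ‖T bL y‖ₑ} ⊆ O ∪ ⋃ k, S k := by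
        intro y hy
        by_cases hyO : y ∈ O
        · exact Or.inl hyO
        · obtain ⟨k, hk⟩ := exists_nat_gt (dist y x₀)
          exact Or.inr (mem_iUnion.2 ⟨k, ⟨hy, hyO⟩, hk⟩)
      refine (measure_mono hcov).trans ((measure_union_le _ _).trans (add_le_add hOμ ?_))
      rw [hmono.measure_iUnion]
      exact iSup_le hSk
    calc μ {x | ENNReal.ofReal (2 * t) < ‖T (hf2.toLp f) x‖ₑ}
        ≤ μ ({y | ENNReal.ofReal t < ‖T (hG2.toLp G) y‖ₑ} ∪
            {y | ENNReal.ofReal t < ‖T bL y‖ₑ}) := by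
          refine measure_mono_ae ?_
          filter_upwards [hTsplit] with y hy hlt
          have hlt' : ENNReal.ofReal (2 * t) < ‖T (hf2.toLp f) y‖ₑ := hlt
          by_contra hcon
          have hc := not_or.1 hcon
          have h1 : ‖T (hG2.toLp G) y‖ₑ ≤ ENNReal.ofReal t := not_lt.1 hc.1
          have h2 : ‖T bL y‖ₑ ≤ ENNReal.ofReal t := not_lt.1 hc.2
          refine absurd hlt' (not_lt.2 ?_)
          rw [hy, two_mul, ENNReal.ofReal_add ht.le ht.le]
          exact (enorm_add_le _ _).trans (add_le_add h1 h2)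
      _ ≤ 6 * B * m + (3 * m + C * m) := (measure_union_le _ _).trans (add_le_add hgoodpart hbadpart)
      _ = _ := by push_cast; ring
  refine ⟨2 * (6 * B + 3 + C), fun f hf2 hf1 t ht => ?_⟩
  have h1 := key f hf2 hf1 (t / 2) (by positivity)
  rw [mul_div_cancel₀ _ two_ne_zero, inv_div, div_eq_mul_inv, ENNReal.ofReal_mul zero_le_two,
    ENNReal.ofReal_ofNat] at h1
  refine h1.trans (le_of_eq ?_)
  push_cast; ring

end WeakType

end NonHomog

namespace NonHomog

/-! ### The Cotlar inequality with small exponents, and `L^p` bounds for exponents below two -/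

/-- Kolmogorov's inequality with cut-off $s_0=A$ balances both terms. As $A$ may be $0$ or $\infty$,
the cut-off is taken at any $S>A$ and then $S$ decreases to $A$. -/
theorem setLIntegral_rpow_le_of_weakType {X : Type*} [MeasurableSpace X] {μ : Measure X}
    {B : Set X} (hB0 : μ B ≠ 0) (hB : μ B ≠ ∞) {g : X → ℝ≥0∞} (hg : AEMeasurable g μ) {η : ℝ}
    (hη : 0 < η) (hη1 : η < 1) {A : ℝ≥0∞}
    (hweak : ∀ s : ℝ, 0 < s → μ {x | ENNReal.ofReal s < g x} ≤ ENNReal.ofReal s⁻¹ * (μ B * A)) :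
    ∫⁻ x in B, g x ^ η ∂μ ≤ μ B * (((1 + ENNReal.ofReal (η / (1 - η))) ^ η⁻¹ * A) ^ η) := by
  set c : ℝ≥0∞ := 1 + ENNReal.ofReal (η / (1 - η)) with hc
  have hc0 : c ≠ 0 := (zero_lt_one.trans_le le_self_add).ne'
  have hctop : c ≠ ∞ := ENNReal.add_ne_top.2 ⟨ENNReal.one_ne_top, ENNReal.ofReal_ne_top⟩
  have hμc0 : μ B * c ≠ 0 := mul_ne_zero hB0 hc0
  have hμct : μ B * c ≠ ∞ := ENNReal.mul_ne_top hB hctop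
  have : IsFiniteMeasure (μ.restrict B) := ⟨by simpa using hB.lt_top⟩
  have key : ∀ S : ℝ≥0∞, A < S → ((μ B * c)⁻¹ * ∫⁻ x in B, g x ^ η ∂μ) ^ η⁻¹ ≤ S := by
    intro S hS
    rcases eq_or_ne S ∞ with rfl | hS'
    · exact le_top
    have hS0 : 0 < S.toReal := ENNReal.toReal_pos (zero_le.trans_lt hS).ne' hS'
    have h1 := lintegral_rpow_le_of_weakType (ν := μ.restrict B) hg.restrict hη hη1
      (P := μ B * A) (fun s hs => by
        rw [Real.rpow_neg_one]
        exact (Measure.restrict_apply_le _ _).trans (hweak s hs)) hS0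
    rw [← ENNReal.ofReal_rpow_of_pos hS0, ← ENNReal.ofReal_rpow_of_pos hS0,
      ENNReal.ofReal_toReal hS', Measure.restrict_apply_univ] at h1
    have hS00 : S ≠ 0 := (zero_le.trans_lt hS).ne'
    have h2 : ∫⁻ x in B, g x ^ η ∂μ ≤ μ B * c * S ^ η := by
      refine h1.trans ?_
      calc S ^ η * μ B + ENNReal.ofReal (η / (1 - η)) * S ^ (η - 1) * (μ B * A)
          ≤ S ^ η * μ B + ENNReal.ofReal (η / (1 - η)) * S ^ (η - 1) * (μ B * S) := by gcongr
        _ = S ^ η * μ B + ENNReal.ofReal (η / (1 - η)) * μ B * (S ^ (η - 1) * S ^ (1 : ℝ)) := by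
            rw [ENNReal.rpow_one]; ring
        _ = _ := by
            rw [← ENNReal.rpow_add _ _ hS00 hS', sub_add_cancel, hc]; ring
    have h3 : (μ B * c)⁻¹ * ∫⁻ x in B, g x ^ η ∂μ ≤ S ^ η :=
      (ENNReal.inv_mul_le_iff hμc0 hμct).2 h2
    calc _ ≤ (S ^ η) ^ η⁻¹ := by gcongr
      _ = S := ENNReal.rpow_rpow_inv hη.ne' S
  have h4 := le_of_forall_gt_imp_ge_of_dense key
  have h5 := ENNReal.rpow_le_rpow h4 hη.le
  rw [ENNReal.rpow_inv_rpow hη.ne', ENNReal.inv_mul_le_iff hμc0 hμct] at h5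
  rw [ENNReal.mul_rpow_of_nonneg _ _ hη.le, ENNReal.rpow_inv_rpow hη.ne', ← mul_assoc]
  exact h5

variable {X 𝕜 : Type*} [MetricSpace X] [MeasurableSpace X] [RCLike 𝕜]
  {μ : Measure X} {lam : X → ℝ → ℝ} {K : X → X → 𝕜} [BorelSpace X] [SecondCountableTopology X]
  {T : Lp 𝕜 2 μ →L[𝕜] Lp 𝕜 2 μ}

/-- For $\eta<1$ the local bound follows from weak type $(1,1)$ by Kolmogorov: the $L^1$ norm of
$f1_{B(x,aR)}$ is at most $\Lambda\mu(B(x,R))M_{(5)}f(x)$. Only $M_{(5)}f$ then appears on the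
right. -/
theorem IsCZOperator.cotlar (h : IsDominating μ lam) (hT : IsCZOperator μ lam K T) {η : ℝ}
    (hη : 0 < η) (hη1 : η < 1) :
    ∃ C : ℝ≥0, ∀ (f : X → 𝕜), MemLp f ∞ μ → Bornology.IsBounded (Function.support f) →
      ∀ (hf2 : MemLp f 2 μ) (x : X), maximalTruncated μ K f x ≤
        C * (maximalFun μ η 6 (T (hf2.toLp f)) x + maximalFun μ 1 5 f x) := by
  obtain ⟨C₁, hC₁⟩ := hT.weakType h
  obtain ⟨C, hC⟩ := hT.cotlar_of_local h hη (fun f x => maximalFun μ 1 5 f x) fun a Λ ha => by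
    set c : ℝ≥0 := (1 + (η / (1 - η)).toNNReal) ^ η⁻¹ with hc
    have hc' : (c : ℝ≥0∞) = (1 + ENNReal.ofReal (η / (1 - η))) ^ η⁻¹ := by
      rw [hc, ENNReal.coe_rpow_of_nonneg _ (inv_pos.2 hη).le]; rfl
    refine ⟨c * (C₁ * Λ), fun f hf hb x R hR hR0 hRΛ hf1 => ?_⟩
    have haR : 0 < a * R := by positivity
    have hB := (h.measure_ball_lt_top x R).ne
    set M := maximalFun μ 1 5 f x
    have hint : ∫⁻ y, ‖(Metric.ball x (a * R)).indicator f y‖ₑ ∂μ ≤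
        Λ * μ (Metric.ball x R) * M := by
      calc ∫⁻ y, ‖(Metric.ball x (a * R)).indicator f y‖ₑ ∂μ
          = ∫⁻ y in Metric.ball x (a * R), ‖f y‖ₑ ^ (1 : ℝ) ∂μ := by
            rw [← lintegral_indicator Metric.isOpen_ball.measurableSet]
            congr 1 with y
            by_cases hy : y ∈ Metric.ball x (a * R) <;> simp [hy]
        _ ≤ μ (Metric.ball x (5 * (a * R))) * M ^ (1 : ℝ) :=
            setLIntegral_ball_le_maximalFun h one_pos (by norm_num) f (Metric.mem_ball_self haR)
        _ ≤ _ := by rw [ENNReal.rpow_one]; gcongr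
    have hf11 : Integrable ((Metric.ball x (a * R)).indicator f) μ :=
      memLp_one_iff_integrable.1
        ((h.memLp_of_isBounded_support hf hb 1).indicator Metric.isOpen_ball.measurableSet)
    have := setLIntegral_rpow_le_of_weakType hR0 hB (g := fun y => ‖T (hf1.toLp _) y‖ₑ)
      (Lp.aestronglyMeasurable _).enorm hη hη1 (A := C₁ * Λ * M) fun s hs => by
        refine (hC₁ _ hf1 hf11 s hs).trans ?_
        calc C₁ * (ENNReal.ofReal s⁻¹ * ∫⁻ y, ‖(Metric.ball x (a * R)).indicator f y‖ₑ ∂μ)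
            ≤ C₁ * (ENNReal.ofReal s⁻¹ * (Λ * μ (Metric.ball x R) * M)) := by gcongr
          _ = _ := by ring
    refine this.trans (le_of_eq ?_)
    rw [← hc']
    push_cast
    ring_nf
  refine ⟨2 * C, fun f hf hb hf2 x => (hC f hf hb hf2 x).trans ?_⟩
  calc _ ≤ (C : ℝ≥0∞) * (2 * (maximalFun μ η 6 (T (hf2.toLp f)) x + maximalFun μ 1 5 f x)) := by
        gcongr
        rw [add_assoc, two_mul, add_add_add_comm]
        exact add_le_add_left le_self_add _
    _ = _ := by push_cast; ring

/-- Marcinkiewicz interpolation: at each level $s$, the part of $f$ above $s$ is handled by weak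
type $(1,1)$ and the part below by $L^2$. The two level integrals converge because $p>1$ and $p<2$
respectively. -/
theorem IsCZOperator.lintegral_rpow_le_of_lt_two (h : IsDominating μ lam)
    (hT : IsCZOperator μ lam K T) {p : ℝ} (hp : 1 < p) (hp2 : p < 2) :
    ∃ C : ℝ≥0, ∀ (f : X → 𝕜) (hf2 : MemLp f 2 μ), Integrable f μ →
      ∫⁻ x, ‖T (hf2.toLp f) x‖ₑ ^ p ∂μ ≤ C * ∫⁻ x, ‖f x‖ₑ ^ p ∂μ := by
  have := h.isLocallyFiniteMeasure
  obtain ⟨C, hC⟩ := hT.weakType h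
  obtain ⟨B, hB⟩ := lintegral_enorm_rpow_two_apply_le T
  have hp0 : 0 < p := by linarith
  have hp1 : 0 < p - 1 := by linarith
  have hp2' : 0 < 2 - p := by linarith
  refine ⟨2 ^ p * (p.toNNReal * (C * (p - 1).toNNReal⁻¹ + B * (2 - p).toNNReal⁻¹)),
    fun f hf2 hf1 => ?_⟩
  wlog hfm : StronglyMeasurable f generalizing f
  · set f' := hf2.1.mk f
    have hff' : f =ᵐ[μ] f' := hf2.1.ae_eq_mk
    have hf2' : MemLp f' 2 μ := (memLp_congr_ae hff').1 hf2
    have := this f' hf2' (hf1.congr hff') hf2.1.stronglyMeasurable_mk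
    have hfp : ∫⁻ x, ‖f x‖ₑ ^ p ∂μ = ∫⁻ x, ‖f' x‖ₑ ^ p ∂μ :=
      lintegral_congr_ae (hff'.mono fun y hy => by simp only [hy])
    rw [MemLp.toLp_congr hf2 hf2' hff', hfp]
    exact this
  set u : X → ℝ≥0∞ := fun x => ‖f x‖ₑ with hu
  have hum : Measurable u := hfm.enorm
  have hutop : ∀ x, u x ≠ ∞ := fun x => enorm_ne_top
  -- Halving lets level $s$ of $g$ be shared as $s+s$ between the two parts of $f$.
  set g : X → ℝ≥0∞ := fun x => 2⁻¹ * ‖T (hf2.toLp f) x‖ₑ with hg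
  have hgm : AEMeasurable g μ := (Lp.aestronglyMeasurable _).enorm.const_mul _
  have hlevel : ∀ s : ℝ, 0 < s → μ {x | ENNReal.ofReal s < g x} ≤
      C * (ENNReal.ofReal s⁻¹ * ∫⁻ x in {x | ENNReal.ofReal s < u x}, u x ∂μ) +
        B * (ENNReal.ofReal (s ^ (-2 : ℝ)) *
          ∫⁻ x in {x | u x ≤ ENNReal.ofReal s}, u x ^ (2 : ℝ) ∂μ) := by
    intro s hs
    have hs0 : ENNReal.ofReal s ≠ 0 := by simpa using hs
    set E : Set X := {x | ENNReal.ofReal s < u x} with hE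
    have hEm : MeasurableSet E := measurableSet_lt measurable_const hum
    have hEc : Eᶜ = {x | u x ≤ ENNReal.ofReal s} := by
      ext x; exact (not_lt : ¬ ENNReal.ofReal s < u x ↔ _)
    have h12 : MemLp (E.indicator f) 2 μ := hf2.indicator hEm
    have h22 : MemLp (Eᶜ.indicator f) 2 μ := hf2.indicator hEm.compl
    have hsplit : hf2.toLp f = h12.toLp _ + h22.toLp _ := by
      rw [← MemLp.toLp_add]
      exact MemLp.toLp_congr _ _ (by rw [indicator_self_add_compl])
    have hT' : ∀ᵐ x ∂μ, T (hf2.toLp f) x = T (h12.toLp _) x + T (h22.toLp _) x := by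
      rw [hsplit, map_add]; exact Lp.coeFn_add _ _
    have h1 := hC _ h12 (hf1.indicator hEm) s hs
    have h2 : μ {x | ENNReal.ofReal s < ‖T (h22.toLp _) x‖ₑ} ≤
        B * (ENNReal.ofReal (s ^ (-2 : ℝ)) *
          ∫⁻ x in {x | u x ≤ ENNReal.ofReal s}, u x ^ (2 : ℝ) ∂μ) := by
      refine meas_lt_le_of_lintegral_sq_le (Lp.aestronglyMeasurable _).enorm hs ?_
      refine (hB _ h22).trans (le_of_eq ?_)
      have e1 : ENNReal.ofReal s ^ 2 * ENNReal.ofReal (s ^ (-2 : ℝ)) = 1 := by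
        rw [← ENNReal.ofReal_pow hs.le, ← ENNReal.ofReal_mul (by positivity),
          Real.rpow_neg hs.le, Real.rpow_two, mul_inv_cancel₀ (by positivity), ENNReal.ofReal_one]
      rw [← hEc, ← lintegral_indicator hEm.compl, mul_left_comm, ← mul_assoc (_ ^ 2), e1, one_mul]
      congr 2 with x
      by_cases hx : x ∈ Eᶜ
      · rw [indicator_of_mem hx, indicator_of_mem hx]
      · rw [indicator_of_notMem hx, indicator_of_notMem hx]; simp
    have h1' : ∫⁻ y, ‖E.indicator f y‖ₑ ∂μ = ∫⁻ x in E, u x ∂μ := by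
      rw [← lintegral_indicator hEm]
      simp only [enorm_indicator_eq_indicator_enorm, hu]
    rw [h1'] at h1
    refine le_trans ?_ (add_le_add h1 h2)
    refine le_trans (measure_mono_ae ?_) (measure_union_le _ _)
    filter_upwards [hT'] with x hx hlt
    have hlt' : ENNReal.ofReal s < 2⁻¹ * ‖T (hf2.toLp f) x‖ₑ := hlt
    by_contra hcon
    have hc := not_or.1 hcon
    have k1 : ‖T (h12.toLp _) x‖ₑ ≤ ENNReal.ofReal s := not_lt.1 hc.1
    have k2 : ‖T (h22.toLp _) x‖ₑ ≤ ENNReal.ofReal s := not_lt.1 hc.2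
    refine absurd hlt' (not_lt.2 ?_)
    rw [hx, ENNReal.inv_mul_le_iff two_ne_zero ENNReal.ofNat_ne_top, two_mul]
    exact (enorm_add_le _ _).trans (add_le_add k1 k2)
  have hmeas1 : Measurable fun s : ℝ => ∫⁻ x in {x | ENNReal.ofReal s < u x}, u x ∂μ := by
    refine Antitone.measurable fun s t hst => lintegral_mono_set fun x hx => ?_
    exact (ENNReal.ofReal_le_ofReal hst).trans_lt hx
  have hmain : ∫⁻ x, g x ^ p ∂μ ≤ ENNReal.ofReal p *
      (C * (ENNReal.ofReal (p - 1))⁻¹ + B * (ENNReal.ofReal (2 - p))⁻¹) * ∫⁻ x, u x ^ p ∂μ := by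
    rw [lintegral_rpow_eq_lintegral_meas hgm hp0, mul_assoc]
    gcongr
    calc ∫⁻ s in Ioi (0 : ℝ), ENNReal.ofReal (s ^ (p - 1)) * μ {x | ENNReal.ofReal s < g x}
        ≤ ∫⁻ s in Ioi (0 : ℝ), (C * (ENNReal.ofReal (s ^ ((p - 1) - 1)) *
            ∫⁻ x in {x | ENNReal.ofReal s < u x}, u x ∂μ) +
            B * (ENNReal.ofReal (s ^ (-(2 - p) - 1)) *
              ∫⁻ x in {x | u x ≤ ENNReal.ofReal s}, u x ^ (2 : ℝ) ∂μ)) := by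
          refine setLIntegral_mono' measurableSet_Ioi fun s (hs : 0 < s) => ?_
          have e1 : ENNReal.ofReal (s ^ ((p - 1) - 1)) =
              ENNReal.ofReal (s ^ (p - 1)) * ENNReal.ofReal s⁻¹ := by
            rw [← ENNReal.ofReal_mul (by positivity), Real.rpow_sub_one hs.ne', div_eq_mul_inv]
          have e2 : ENNReal.ofReal (s ^ (-(2 - p) - 1)) =
              ENNReal.ofReal (s ^ (p - 1)) * ENNReal.ofReal (s ^ (-2 : ℝ)) := by
            rw [← ENNReal.ofReal_mul (by positivity), ← Real.rpow_add hs]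
            congr 2; ring
          refine (mul_le_mul_right (hlevel s hs) _).trans (le_of_eq ?_)
          rw [e1, e2]
          ring
      _ = C * ∫⁻ x, u x ^ (p - 1) / ENNReal.ofReal (p - 1) * u x ∂μ +
          B * ∫⁻ x, (∫⁻ s in Ioi (0 : ℝ), {s : ℝ | u x ≤ ENNReal.ofReal s}.indicator
            (fun s => ENNReal.ofReal (s ^ (-(2 - p) - 1))) s) * u x ^ (2 : ℝ) ∂μ := by
          have hmeas2 : Measurable fun s : ℝ => (C : ℝ≥0∞) * (ENNReal.ofReal (s ^ ((p - 1) - 1)) *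
              ∫⁻ x in {x | ENNReal.ofReal s < u x}, u x ∂μ) :=
            ((measurable_ofReal_rpow _).mul hmeas1).const_mul _
          rw [lintegral_add_left hmeas2,
            lintegral_const_mul' _ _ ENNReal.coe_ne_top, lintegral_const_mul' _ _ ENNReal.coe_ne_top,
            lintegral_rpow_mul_setLIntegral_lt hum hum hp1,
            lintegral_rpow_mul_setLIntegral_le hum (hum.pow_const _)]
      _ ≤ C * ∫⁻ x, (ENNReal.ofReal (p - 1))⁻¹ * u x ^ p ∂μ +
          B * ∫⁻ x, (ENNReal.ofReal (2 - p))⁻¹ * u x ^ p ∂μ := by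
          refine add_le_add (mul_le_mul_right (lintegral_mono fun x => ?_) _)
            (mul_le_mul_right (lintegral_mono fun x => ?_) _)
          · rw [div_eq_mul_inv, mul_comm (_ ^ _), mul_assoc]
            gcongr
            rcases eq_or_ne (u x) 0 with h0 | h0
            · simp [h0]
            · nth_rewrite 2 [← ENNReal.rpow_one (u x)]
              rw [← ENNReal.rpow_add _ _ h0 (hutop x), sub_add_cancel]
          -- At $u=0$ the inner integral is infinite but is multiplied by $u^2=0$.
          · rcases eq_or_ne (u x) 0 with h0 | h0
            · simp [h0]
            · rw [lintegral_indicator_le_rpow hp2' h0 (hutop x), div_eq_mul_inv,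
                mul_comm (_ ^ _), mul_assoc, ← ENNReal.rpow_add _ _ h0 (hutop x),
                show -(2 - p) + 2 = p by ring]
      _ = _ := by
          rw [lintegral_const_mul _ (hum.pow_const _), lintegral_const_mul _ (hum.pow_const _)]
          ring
  have hgp : ∫⁻ x, ‖T (hf2.toLp f) x‖ₑ ^ p ∂μ = 2 ^ p * ∫⁻ x, g x ^ p ∂μ := by
    rw [← lintegral_const_mul' _ _ (ENNReal.rpow_ne_top_of_nonneg hp0.le ENNReal.ofNat_ne_top)]
    refine lintegral_congr fun x => ?_
    rw [← ENNReal.mul_rpow_of_nonneg _ _ hp0.le, hg, ← mul_assoc,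
      ENNReal.mul_inv_cancel two_ne_zero ENNReal.ofNat_ne_top, one_mul]
  rw [hgp]
  have e3 : ((2 ^ p * (p.toNNReal * (C * (p - 1).toNNReal⁻¹ + B * (2 - p).toNNReal⁻¹)) : ℝ≥0) :
      ℝ≥0∞) = 2 ^ p * (ENNReal.ofReal p *
      (C * (ENNReal.ofReal (p - 1))⁻¹ + B * (ENNReal.ofReal (2 - p))⁻¹)) := by
    rw [ENNReal.coe_mul, ENNReal.coe_mul, ENNReal.coe_add, ENNReal.coe_mul, ENNReal.coe_mul,
      ENNReal.coe_inv (by simpa using hp1), ENNReal.coe_inv (by simpa using hp2),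
      ENNReal.coe_rpow_of_nonneg _ hp0.le]
    rfl
  rw [e3, mul_assoc]
  gcongr

end NonHomog

namespace NonHomog

/-! ### `L^p` bounds by duality -/

/-- Raising to the power $p$ turns $I^{1/q}$ into $I^{p-1}$, which cancels provided $I$ is finite.
-/
theorem le_rpow_mul_of_le_rpow_mul_rpow {p q : ℝ} (hpq : p.HolderConjugate q) {I J c : ℝ≥0∞}
    (hI : I ≠ ∞) (hle : I ≤ (c * I) ^ (1 / q) * J ^ (1 / p)) : I ≤ c ^ (p - 1) * J := by
  rcases eq_or_ne I 0 with rfl | hI0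
  · exact zero_le
  have hp := hpq.pos
  have hp1 : 0 < p - 1 := hpq.sub_one_pos
  have e1 : 1 / q * p = p - 1 := by
    have := hpq.symm.pos
    have h2 := hpq.sub_one_mul_conj
    field_simp
    linarith
  have h1 := ENNReal.rpow_le_rpow hle hp.le
  rw [ENNReal.mul_rpow_of_nonneg _ _ hp.le, ← ENNReal.rpow_mul, ← ENNReal.rpow_mul,
    one_div_mul_cancel hp.ne', ENNReal.rpow_one, e1, ENNReal.mul_rpow_of_nonneg _ _ hp1.le] at h1
  have e2 : I ^ p = I ^ (p - 1) * I := by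
    nth_rewrite 3 [← ENNReal.rpow_one I]
    rw [← ENNReal.rpow_add _ _ hI0 hI, sub_add_cancel]
  rw [e2, mul_comm (c ^ _), mul_assoc] at h1
  exact (ENNReal.mul_le_mul_iff_right (ENNReal.rpow_pos (pos_iff_ne_zero.2 hI0) hI).ne'
    (ENNReal.rpow_ne_top_of_nonneg hp1.le hI)).1 h1

theorem enorm_inner_le_lintegral {X 𝕜 : Type*} [MeasurableSpace X] [RCLike 𝕜] {μ : Measure X}
    (f g : Lp 𝕜 2 μ) : ‖inner 𝕜 f g‖ₑ ≤ ∫⁻ x, ‖f x‖ₑ * ‖g x‖ₑ ∂μ := by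
  rw [L2.inner_def]
  refine (enorm_integral_le_lintegral_enorm _).trans (lintegral_mono fun x => ?_)
  simp only [← ofReal_norm]
  rw [← ENNReal.ofReal_mul (norm_nonneg _)]
  exact ENNReal.ofReal_le_ofReal (norm_inner_le_norm _ _)

variable {X 𝕜 : Type*} [MetricSpace X] [MeasurableSpace X] [RCLike 𝕜]
  {μ : Measure X} {lam : X → ℝ → ℝ} {K : X → X → 𝕜} [BorelSpace X] [SecondCountableTopology X]
  {T : Lp 𝕜 2 μ →L[𝕜] Lp 𝕜 2 μ}

omit [SecondCountableTopology X] in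
-- With $F=Tf$, test against $g=|F|^{p-2}F$: then $|g|^q=|F|^p$ and $\langle g,F\rangle=\int|F|^p$.
-- Moving $T$ to the adjoint and applying Hölder gives a self-improving inequality, which closes
-- once the integral is finite.
theorem exists_lintegral_rpow_le_of_adjoint (h : IsDominating μ lam) {p q : ℝ} (hp2 : 2 < p)
    (hpq : p.HolderConjugate q) {c : ℝ≥0}
    (hc : ∀ (f : X → 𝕜) (hf2 : MemLp f 2 μ), Integrable f μ →
      ∫⁻ x, ‖ContinuousLinearMap.adjoint T (hf2.toLp f) x‖ₑ ^ q ∂μ ≤ c * ∫⁻ x, ‖f x‖ₑ ^ q ∂μ)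
    (f : X → 𝕜) (hf2 : MemLp f 2 μ) :
    ∫⁻ x, ‖T (hf2.toLp f) x‖ₑ ^ p ∂μ ≤ c ^ (p - 1) * ∫⁻ x, ‖f x‖ₑ ^ p ∂μ := by
  rcases isEmpty_or_nonempty X with hX | ⟨⟨x₀⟩⟩
  · simp [Measure.eq_zero_of_isEmpty μ]
  have hp := hpq.pos
  set F : Lp 𝕜 2 μ := T (hf2.toLp f) with hF
  have hFm : StronglyMeasurable F := Lp.stronglyMeasurable F
  -- Bounding both position and $|F|$ makes the integral finite and $g$ bounded with bounded
  -- support; monotone convergence removes the restriction.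
  set A : ℕ → Set X := fun n => Metric.ball x₀ n ∩ {x | ‖F x‖ ≤ n} with hA
  have hAm : ∀ n, MeasurableSet (A n) := fun n =>
    Metric.isOpen_ball.measurableSet.inter (measurableSet_le hFm.norm.measurable measurable_const)
  have hAmono : Monotone A := by
    intro m n hmn x hx
    have hmn' : (m : ℝ) ≤ n := by exact_mod_cast hmn
    exact ⟨Metric.ball_subset_ball hmn' hx.1, le_trans (show ‖F x‖ ≤ m from hx.2) hmn'⟩
  have hAU : ⋃ n, A n = univ := by
    refine eq_univ_of_forall fun x => ?_
    obtain ⟨n, hn⟩ := exists_nat_gt (max (dist x x₀) ‖F x‖)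
    exact mem_iUnion.2 ⟨n, (le_max_left _ _).trans_lt hn, ((le_max_right _ _).trans_lt hn).le⟩
  have key : ∀ n, ∫⁻ x in A n, ‖F x‖ₑ ^ p ∂μ ≤ c ^ (p - 1) * ∫⁻ x, ‖f x‖ₑ ^ p ∂μ := by
    intro n
    have hAfin : μ (A n) < ∞ :=
      (measure_mono inter_subset_left).trans_lt (h.measure_ball_lt_top x₀ n)
    have : IsFiniteMeasure (μ.restrict (A n)) := ⟨by simpa using hAfin⟩
    have hIfin : ∫⁻ x in A n, ‖F x‖ₑ ^ p ∂μ < ∞ := by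
      calc ∫⁻ x in A n, ‖F x‖ₑ ^ p ∂μ ≤ ∫⁻ _ in A n, (n : ℝ≥0∞) ^ p ∂μ := by
            refine setLIntegral_mono' (hAm n) fun x hx => ?_
            gcongr
            rw [← ofReal_norm, ← ENNReal.ofReal_natCast]
            exact ENNReal.ofReal_le_ofReal hx.2
        _ < ∞ := by
            rw [setLIntegral_const]
            exact ENNReal.mul_lt_top
              (ENNReal.rpow_lt_top_of_nonneg hp.le (ENNReal.natCast_ne_top n)) hAfin
    set g : X → 𝕜 := (A n).indicator fun x => ((‖F x‖ ^ (p - 2) : ℝ) : 𝕜) * F x with hg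
    have hgm : StronglyMeasurable g :=
      ((RCLike.measurable_ofReal.comp
        (hFm.norm.measurable.pow_const _)).mul hFm.measurable).stronglyMeasurable.indicator (hAm n)
    have hgtop : MemLp g ∞ μ := by
      refine memLp_top_of_bound hgm.aestronglyMeasurable ((n : ℝ) ^ (p - 2) * n)
        (Eventually.of_forall fun x => ?_)
      by_cases hx : x ∈ A n
      · have hx2 : ‖F x‖ ≤ n := hx.2
        rw [hg, indicator_of_mem hx, norm_mul, RCLike.norm_ofReal,
          abs_of_nonneg (by positivity)]
        gcongr
      · rw [hg, indicator_of_notMem hx, norm_zero]; positivity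
    have hgb : Bornology.IsBounded (Function.support g) :=
      Metric.isBounded_ball.subset (support_indicator_subset.trans inter_subset_left)
    have hg2 : MemLp g 2 μ := h.memLp_of_isBounded_support hgtop hgb 2
    have hg1 : Integrable g μ :=
      memLp_one_iff_integrable.1 (h.memLp_of_isBounded_support hgtop hgb 1)
    have hgq : ∫⁻ x, ‖g x‖ₑ ^ q ∂μ = ∫⁻ x in A n, ‖F x‖ₑ ^ p ∂μ := by
      rw [← lintegral_indicator (hAm n)]
      refine lintegral_congr fun x => ?_
      by_cases hx : x ∈ A n
      · rw [hg, indicator_of_mem hx, indicator_of_mem hx, enorm_mul, ← ofReal_norm,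
          RCLike.norm_ofReal, abs_of_nonneg (by positivity)]
        rcases eq_or_ne (F x) 0 with h0 | h0
        · simp [h0, hp, hpq.symm.pos]
        · have hn0 : 0 < ‖F x‖ := norm_pos_iff.2 h0
          rw [← ENNReal.ofReal_rpow_of_pos hn0, ofReal_norm]
          have hne : ‖F x‖ₑ ≠ 0 := enorm_ne_zero.2 h0
          nth_rewrite 2 [← ENNReal.rpow_one ‖F x‖ₑ]
          rw [← ENNReal.rpow_add _ _ hne enorm_ne_top, ← ENNReal.rpow_mul]
          congr 1
          have := hpq.sub_one_mul_conj
          linarith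
      · rw [hg, indicator_of_notMem hx, indicator_of_notMem hx]
        simp [hpq.symm.pos]
    have hinner : ‖inner 𝕜 (hg2.toLp g) F‖ₑ = ∫⁻ x in A n, ‖F x‖ₑ ^ p ∂μ := by
      set v : X → ℝ := (A n).indicator fun x => ‖F x‖ ^ p with hv
      have hv0 : ∀ x, 0 ≤ v x := fun x => indicator_nonneg (fun x _ => by positivity) x
      have hvl : ∫⁻ x, ENNReal.ofReal (v x) ∂μ = ∫⁻ x in A n, ‖F x‖ₑ ^ p ∂μ := by
        rw [← lintegral_indicator (hAm n)]
        refine lintegral_congr fun x => ?_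
        by_cases hx : x ∈ A n
        · rw [hv, indicator_of_mem hx, indicator_of_mem hx,
            ← ENNReal.ofReal_rpow_of_nonneg (norm_nonneg _) hp.le, ofReal_norm]
        · rw [hv, indicator_of_notMem hx, indicator_of_notMem hx, ENNReal.ofReal_zero]
      have hvm : AEStronglyMeasurable v μ :=
        ((hFm.norm.measurable.pow_const p).stronglyMeasurable.indicator
          (hAm n)).aestronglyMeasurable
      have hvi : Integrable v μ := by
        refine ⟨hvm, ?_⟩
        rw [hasFiniteIntegral_iff_ofReal (Eventually.of_forall hv0), hvl]
        exact hIfin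
      have e1 : inner 𝕜 (hg2.toLp g) F = ((∫ x, v x ∂μ : ℝ) : 𝕜) := by
        rw [L2.inner_def, ← integral_ofReal]
        refine integral_congr_ae ?_
        filter_upwards [hg2.coeFn_toLp] with x hx
        rw [hx, RCLike.inner_apply, hg, hv]
        by_cases hxA : x ∈ A n
        · rw [indicator_of_mem hxA, indicator_of_mem hxA, map_mul, RCLike.conj_ofReal,
            mul_left_comm, RCLike.mul_conj, ← RCLike.ofReal_pow, ← RCLike.ofReal_mul]
          congr 1
          rcases eq_or_ne (F x) 0 with h0 | h0
          · simp [h0, hp.ne']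
          · rw [← Real.rpow_natCast, ← Real.rpow_add (norm_pos_iff.2 h0)]
            congr 1
            push_cast
            ring
        · rw [indicator_of_notMem hxA, indicator_of_notMem hxA]; simp
      rw [e1, ← hvl, ← ofReal_integral_eq_lintegral_ofReal hvi (Eventually.of_forall hv0),
        ← ofReal_norm, RCLike.norm_ofReal, abs_of_nonneg (integral_nonneg hv0)]
    refine le_rpow_mul_of_le_rpow_mul_rpow hpq hIfin.ne ?_
    calc ∫⁻ x in A n, ‖F x‖ₑ ^ p ∂μ
        = ‖inner 𝕜 (ContinuousLinearMap.adjoint T (hg2.toLp g)) (hf2.toLp f)‖ₑ := by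
          rw [← hinner, hF, ContinuousLinearMap.adjoint_inner_left]
      _ ≤ ∫⁻ x, ‖ContinuousLinearMap.adjoint T (hg2.toLp g) x‖ₑ * ‖(hf2.toLp f) x‖ₑ ∂μ :=
          enorm_inner_le_lintegral _ _
      _ ≤ (∫⁻ x, ‖ContinuousLinearMap.adjoint T (hg2.toLp g) x‖ₑ ^ q ∂μ) ^ (1 / q) *
          (∫⁻ x, ‖(hf2.toLp f) x‖ₑ ^ p ∂μ) ^ (1 / p) :=
          ENNReal.lintegral_mul_le_Lp_mul_Lq μ hpq.symm (Lp.aestronglyMeasurable _).enorm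
            (Lp.aestronglyMeasurable _).enorm
      _ ≤ (c * ∫⁻ x in A n, ‖F x‖ₑ ^ p ∂μ) ^ (1 / q) * (∫⁻ x, ‖f x‖ₑ ^ p ∂μ) ^ (1 / p) := by
          have e3 : ∫⁻ x, ‖(hf2.toLp f) x‖ₑ ^ p ∂μ = ∫⁻ x, ‖f x‖ₑ ^ p ∂μ :=
            lintegral_congr_ae (hf2.coeFn_toLp.mono fun x hx => by simp only [hx])
          rw [e3]
          have := hpq.symm.pos
          gcongr
          rw [← hgq]
          exact hc g hg2 hg1
  rw [← setLIntegral_univ, ← hAU, setLIntegral_iUnion_of_directed _ hAmono.directed_le]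
  exact iSup_le key

/-- A Calderón–Zygmund operator is bounded on `L^p` for `1 < p < ∞`. -/
theorem IsCZOperator.exists_lintegral_rpow_le (h : IsDominating μ lam)
    (hT : IsCZOperator μ lam K T) {p : ℝ} (hp : 1 < p) :
    ∃ C : ℝ≥0, ∀ (f : X → 𝕜) (hf2 : MemLp f 2 μ), Integrable f μ →
      ∫⁻ x, ‖T (hf2.toLp f) x‖ₑ ^ p ∂μ ≤ C * ∫⁻ x, ‖f x‖ₑ ^ p ∂μ := by
  rcases lt_trichotomy p 2 with hp2 | rfl | hp2
  · exact hT.lintegral_rpow_le_of_lt_two h hp hp2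
  · obtain ⟨B, hB⟩ := lintegral_enorm_rpow_two_apply_le T
    exact ⟨B, fun f hf2 _ => hB f hf2⟩
  · have hpq := Real.HolderConjugate.conjExponent hp
    have hq2 : p.conjExponent < 2 := by
      rw [Real.conjExponent, div_lt_iff₀ (by linarith)]; linarith
    obtain ⟨c, hc⟩ := (hT.adjoint h).lintegral_rpow_le_of_lt_two h hpq.symm.lt hq2
    refine ⟨c ^ (p - 1), fun f hf2 _ => ?_⟩
    rw [ENNReal.coe_rpow_of_nonneg _ (by linarith)]
    exact exists_lintegral_rpow_le_of_adjoint h hp2 hpq hc f hf2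

end NonHomog

namespace NonHomog

/-! ### The maximal truncated operator on `L^p` -/

section Kernel

variable {X 𝕜 : Type*} [MetricSpace X] [MeasurableSpace X] [RCLike 𝕜]
  {μ : Measure X} {lam : X → ℝ → ℝ} {K : X → X → 𝕜}

/-- On a bounded portion, pick a point of the set at more than half the maximal distance from $x$. A
fixed dilate of its distance covers the portion, and the ball has mass at most a constant times
$\lambda$ at that point, hence at most $DL$. The diagonal is excluded because only positive radii of
$\lambda$ matter. -/
theorem IsDominating.exists_measure_edom_lt_le (h : IsDominating μ lam) :
    ∃ D : ℝ≥0, ∀ (x : X) (L : ℝ≥0∞), μ {y | x ≠ y ∧ edom lam x (dist x y) < L} ≤ D * L := by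
  obtain ⟨D, -, hD⟩ := h.exists_dilation (a := 3) three_pos
  refine ⟨D, fun x L => ?_⟩
  set S : ℕ → Set X := fun k => {y | x ≠ y ∧ edom lam x (dist x y) < L} ∩ Metric.ball x k with hS
  have hmono : Monotone S := fun j k hjk => inter_subset_inter_right _
    (Metric.ball_subset_ball (by exact_mod_cast hjk))
  have hU : {y | x ≠ y ∧ edom lam x (dist x y) < L} = ⋃ k, S k := by
    refine Subset.antisymm (fun y hy => ?_) (iUnion_subset fun k => inter_subset_left)
    obtain ⟨k, hk⟩ := exists_nat_gt (dist y x)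
    exact mem_iUnion.2 ⟨k, hy, hk⟩
  rw [hU, hmono.measure_iUnion]
  refine iSup_le fun k => ?_
  rcases (S k).eq_empty_or_nonempty with he | ⟨y₁, hy₁⟩
  · simp [he]
  have hbdd : BddAbove ((fun y => dist x y) '' S k) := by
    refine ⟨k, ?_⟩
    rintro _ ⟨y, hy, rfl⟩
    have : dist y x < k := hy.2
    rw [dist_comm] at this
    exact this.le
  set R := sSup ((fun y => dist x y) '' S k) with hR
  have hR0 : 0 < R := (dist_pos.2 hy₁.1.1).trans_le (le_csSup hbdd (mem_image_of_mem _ hy₁))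
  obtain ⟨_, ⟨y₀, hy₀, rfl⟩, hlt⟩ := exists_lt_of_lt_csSup ⟨_, mem_image_of_mem _ hy₁⟩
    (half_lt_self hR0)
  have hd0 : 0 < dist x y₀ := dist_pos.2 hy₀.1.1
  have hsub : S k ⊆ Metric.ball x (3 * dist x y₀) := by
    intro y hy
    have h1 : dist x y ≤ R := le_csSup hbdd (mem_image_of_mem _ hy)
    have h2 : R / 2 < dist x y₀ := hlt
    rw [Metric.mem_ball, dist_comm]
    linarith
  calc μ (S k) ≤ μ (Metric.ball x (3 * dist x y₀)) := measure_mono hsub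
    _ ≤ edom lam x (3 * dist x y₀) := h.measure_ball_le x _ (by positivity)
    _ ≤ D * edom lam x (dist x y₀) := hD x _ hd0
    _ ≤ D * L := by gcongr; exact hy₀.1.2.le

variable [BorelSpace X] [SecondCountableTopology X] {δ a : ℝ} {C : ℝ≥0}

/-- Away from $x$ the kernel is bounded, and it is in weak $L^1$ by the preceding level set bound.
Dyadic annuli alone would not do, because $\lambda(x,\cdot)$ need not grow geometrically. -/
theorem KernelBounds.lintegral_rpow_lt_top (h : IsDominating μ lam)
    (hK : KernelBounds lam K δ a C) (x : X) {ε : ℝ} (hε : 0 < ε) {q : ℝ} (hq : 1 < q) :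
    ∫⁻ y in {y | ε ≤ dist x y}, ‖K x y‖ₑ ^ q ∂μ < ∞ := by
  have := h.isLocallyFiniteMeasure
  obtain ⟨D, hD⟩ := h.exists_measure_edom_lt_le
  set S : Set X := {y | ε ≤ dist x y} with hS
  have hSm : MeasurableSet S := measurableSet_le_dist x ε
  have hne : ∀ y ∈ S, x ≠ y := fun y hy => dist_pos.1 (hε.trans_le hy)
  set g : X → ℝ≥0∞ := S.indicator fun y => ‖K x y‖ₑ with hg
  have hgm : AEMeasurable g μ := (aemeasurable_indicator_iff hSm).2
    (hK.aestronglyMeasurable h x hSm fun hx => hne x hx rfl).enorm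
  have htop : (C : ℝ≥0∞) * (edom lam x ε)⁻¹ ≠ ∞ :=
    ENNReal.mul_ne_top ENNReal.coe_ne_top (ENNReal.inv_ne_top.2 (h.edom_ne_zero x hε))
  have hgC : ∀ y ∈ S, g y ≤ C * (edom lam x (dist x y))⁻¹ := fun y hy => by
    rw [hg, indicator_of_mem hy]; exact hK.size_left x y (hne y hy)
  have hfin := lintegral_rpow_lt_top_of_weakType_of_le hgm hq (P := D * C)
    (ENNReal.mul_ne_top ENNReal.coe_ne_top ENNReal.coe_ne_top) (fun s hs => by
      have hs0 : ENNReal.ofReal s ≠ 0 := by simpa using hs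
      calc μ {y | ENNReal.ofReal s < g y}
          ≤ μ {y | x ≠ y ∧ edom lam x (dist x y) < (ENNReal.ofReal s)⁻¹ * C} := by
            refine measure_mono fun y hy => ?_
            have hy' : ENNReal.ofReal s < g y := hy
            have hyS : y ∈ S := by
              by_contra hc
              rw [hg, indicator_of_notMem hc] at hy'
              exact not_lt_zero hy'
            refine ⟨hne y hyS, ?_⟩
            have h1 := hy'.trans_le (hgC y hyS)
            have hd : 0 < dist x y := hε.trans_le hyS
            rw [← div_eq_mul_inv, ENNReal.lt_div_iff_mul_lt (Or.inl (h.edom_ne_zero x hd))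
              (Or.inl (edom_ne_top x _))] at h1
            rwa [mul_comm, ← div_eq_mul_inv, ENNReal.lt_div_iff_mul_lt (Or.inl hs0)
              (Or.inl ENNReal.ofReal_ne_top), mul_comm]
        _ ≤ D * ((ENNReal.ofReal s)⁻¹ * C) := hD x _
        _ = ENNReal.ofReal s⁻¹ * (D * C) := by
            rw [ENNReal.ofReal_inv_of_pos hs]; ring)
    (b := ((C : ℝ≥0∞) * (edom lam x ε)⁻¹).toReal) ENNReal.toReal_nonneg (fun y => by
      rw [ENNReal.ofReal_toReal htop]
      by_cases hy : y ∈ S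
      · refine (hgC y hy).trans ?_
        gcongr
        exact h.edom_mono x hε hy
      · rw [hg, indicator_of_notMem hy]; exact zero_le)
  refine lt_of_eq_of_lt ?_ hfin
  rw [← lintegral_indicator hSm]
  refine lintegral_congr fun y => ?_
  by_cases hy : y ∈ S
  · rw [hg, indicator_of_mem hy, indicator_of_mem hy]
  · rw [hg, indicator_of_notMem hy, indicator_of_notMem hy, ENNReal.zero_rpow_of_pos (by linarith)]

theorem KernelBounds.integrableOn_of_lintegral_rpow_lt_top (h : IsDominating μ lam)
    (hK : KernelBounds lam K δ a C) {p : ℝ} (hp : 1 < p) {f : X → 𝕜}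
    (hf : AEStronglyMeasurable f μ) (hfp : ∫⁻ y, ‖f y‖ₑ ^ p ∂μ < ∞) (x : X) {ε : ℝ}
    (hε : 0 < ε) : IntegrableOn (fun y => K x y * f y) {y | ε ≤ dist x y} μ := by
  have hpq := Real.HolderConjugate.conjExponent hp
  have hKm := hK.aestronglyMeasurable h x (measurableSet_le_dist x ε) (by simpa using hε)
  refine ⟨hKm.mul hf.restrict, ?_⟩
  rw [hasFiniteIntegral_iff_enorm]
  simp only [enorm_mul]
  refine (ENNReal.lintegral_mul_le_Lp_mul_Lq _ hpq.symm hKm.enorm hf.restrict.enorm).trans_lt ?_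
  refine ENNReal.mul_lt_top ?_ ?_
  · exact ENNReal.rpow_lt_top_of_nonneg (one_div_nonneg.2 hpq.symm.pos.le)
      (hK.lintegral_rpow_lt_top h x hε hpq.symm.lt).ne
  · exact ENNReal.rpow_lt_top_of_nonneg (one_div_nonneg.2 hpq.pos.le)
      ((setLIntegral_le_lintegral _ _).trans_lt hfp).ne

theorem KernelBounds.stronglyMeasurable_truncated (h : IsDominating μ lam)
    (hK : KernelBounds lam K δ a C) {f : X → 𝕜} (hf : StronglyMeasurable f) {ε : ℝ}
    (hε : 0 < ε) : StronglyMeasurable (truncated μ K ε f) := by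
  have := h.isLocallyFiniteMeasure
  set S : Set (X × X) := {z | ε ≤ dist z.1 z.2} with hS
  have hSm : MeasurableSet S := (isClosed_le continuous_const (by fun_prop)).measurableSet
  have hKS : ContinuousOn (fun z : X × X => K z.1 z.2) S :=
    (hK.continuousOn h).mono fun z (hz : ε ≤ dist z.1 z.2) => dist_pos.1 (hε.trans_le hz)
  have hKm : Measurable (S.indicator fun z : X × X => K z.1 z.2) := by
    classical
    rw [← piecewise_eq_indicator]
    exact hKS.measurable_piecewise continuousOn_const hSm
  have hjoint : StronglyMeasurable
      (Function.uncurry fun x y => S.indicator (fun z : X × X => K z.1 z.2) (x, y) * f y) :=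
    (hKm.mul (hf.measurable.comp measurable_snd)).stronglyMeasurable
  have := hjoint.integral_prod_right (ν := μ)
  convert this using 2 with x
  rw [truncated, ← integral_indicator (measurableSet_le_dist x ε)]
  refine integral_congr_ae (Eventually.of_forall fun y => ?_)
  by_cases hy : ε ≤ dist x y
  · have h1 : y ∈ {y | ε ≤ dist x y} := hy
    have h2 : (x, y) ∈ S := hy
    simp only [indicator_of_mem h1, indicator_of_mem h2]
  · have h1 : y ∉ {y | ε ≤ dist x y} := hy
    have h2 : (x, y) ∉ S := hy
    simp only [indicator_of_notMem h1, indicator_of_notMem h2, zero_mul]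

end Kernel

/-! ### Measurability and $L^p$ bounds for the maximal truncation -/

section Truncated

variable {X 𝕜 : Type*} [MetricSpace X] [MeasurableSpace X] [RCLike 𝕜]
  {μ : Measure X} {lam : X → ℝ → ℝ} {K : X → X → 𝕜}

theorem maximalTruncated_congr {f g : X → 𝕜} (hfg : f =ᵐ[μ] g) :
    maximalTruncated μ K f = maximalTruncated μ K g := by
  funext x
  refine iSup_congr fun ε => iSup_congr fun _ => ?_
  have : truncated μ K ε f x = truncated μ K ε g x :=
    integral_congr_ae ((ae_restrict_of_ae hfg).mono fun y hy => by simp only [hy])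
  rw [this]

variable [BorelSpace X]

/-- The truncation $d(x,y)\ge\varepsilon$ is closed, so its indicators converge pointwise as
$t\uparrow\varepsilon$; from the right this could fail when the sphere carries mass. -/
theorem tendsto_truncated_nhdsLT {f : X → 𝕜} {x : X}
    (hint : ∀ ε : ℝ, 0 < ε → IntegrableOn (fun y => K x y * f y) {y | ε ≤ dist x y} μ)
    {ε : ℝ} (hε : 0 < ε) :
    Tendsto (fun t => truncated μ K t f x) (𝓝[<] ε) (𝓝 (truncated μ K ε f x)) := by
  have heq : ∀ t, truncated μ K t f x = ∫ y, {y | t ≤ dist x y}.indicator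
      (fun y => K x y * f y) y ∂μ := fun t => by
    rw [truncated, integral_indicator (measurableSet_le_dist x t)]
  simp only [heq]
  have hpos : ∀ᶠ t in 𝓝[<] ε, ε / 2 < t :=
    (eventually_gt_nhds (half_lt_self hε)).filter_mono nhdsWithin_le_nhds
  refine tendsto_integral_filter_of_dominated_convergence
    (fun y => ‖{y | ε / 2 ≤ dist x y}.indicator (fun y => K x y * f y) y‖) ?_ ?_ ?_ ?_
  · filter_upwards [hpos] with t ht
    exact ((integrable_indicator_iff (measurableSet_le_dist x t)).2
      (hint t ((half_pos hε).trans ht))).1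
  · filter_upwards [hpos] with t ht
    refine Eventually.of_forall fun y => ?_
    refine norm_indicator_le_of_subset (fun y (hy : t ≤ dist x y) => ?_) _ _
    exact ht.le.trans hy
  · exact ((integrable_indicator_iff (measurableSet_le_dist x _)).2 (hint _ (half_pos hε))).norm
  · refine Eventually.of_forall fun y => tendsto_nhds_of_eventually_eq ?_
    by_cases hy : ε ≤ dist x y
    · filter_upwards [self_mem_nhdsWithin] with t (ht : t < ε)
      have h1 : y ∈ {y | t ≤ dist x y} := ht.le.trans hy
      have h2 : y ∈ {y | ε ≤ dist x y} := hy
      rw [indicator_of_mem h1, indicator_of_mem h2]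
    · have : ∀ᶠ t in 𝓝[<] ε, dist x y < t :=
        (eventually_gt_nhds (not_le.1 hy)).filter_mono nhdsWithin_le_nhds
      filter_upwards [this] with t ht
      have h1 : y ∉ {y | t ≤ dist x y} := not_le.2 ht
      have h2 : y ∉ {y | ε ≤ dist x y} := hy
      rw [indicator_of_notMem h1, indicator_of_notMem h2]

/-- Left continuity in the truncation parameter lets rationals suffice, which makes the supremum
measurable. -/
theorem maximalTruncated_eq_iSup_rat {f : X → 𝕜} {x : X}
    (hint : ∀ ε : ℝ, 0 < ε → IntegrableOn (fun y => K x y * f y) {y | ε ≤ dist x y} μ) :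
    maximalTruncated μ K f x = ⨆ (q : ℚ) (_ : 0 < q), ‖truncated μ K q f x‖ₑ := by
  refine le_antisymm (iSup_le fun ε => iSup_le fun hε => ?_) (iSup_le fun q => iSup_le fun hq =>
    le_iSup_of_le (q : ℝ) (le_iSup_of_le (by exact_mod_cast hq) le_rfl))
  by_contra! hlt
  have hev : ∀ᶠ t in 𝓝[<] ε, (⨆ (q : ℚ) (_ : 0 < q), ‖truncated μ K q f x‖ₑ) <
      ‖truncated μ K t f x‖ₑ := (tendsto_truncated_nhdsLT hint hε).enorm.eventually_const_lt hlt
  obtain ⟨l, hl, hsub⟩ := mem_nhdsLT_iff_exists_Ioo_subset.1 hev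
  obtain ⟨q, hq1, hq2⟩ := exists_rat_btwn (max_lt (show l < ε from hl) hε)
  have hq0 : 0 < q := by exact_mod_cast (le_max_right _ _).trans_lt hq1
  have h1 := hsub ⟨(le_max_left _ _).trans_lt hq1, hq2⟩
  exact lt_irrefl _ ((show _ < ‖truncated μ K q f x‖ₑ from h1).trans_le
    (le_iSup_of_le q (le_iSup_of_le hq0 le_rfl)))

variable [SecondCountableTopology X]

theorem KernelBounds.measurable_maximalTruncated {δ a : ℝ} {C : ℝ≥0} (h : IsDominating μ lam)
    (hK : KernelBounds lam K δ a C) {p : ℝ} (hp : 1 < p) {f : X → 𝕜}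
    (hf : AEStronglyMeasurable f μ) (hfp : ∫⁻ y, ‖f y‖ₑ ^ p ∂μ < ∞) :
    Measurable (maximalTruncated μ K f) := by
  wlog hfm : StronglyMeasurable f generalizing f
  · rw [maximalTruncated_congr hf.ae_eq_mk]
    have h1 : ∫⁻ x, ‖f x‖ₑ ^ p ∂μ = ∫⁻ x, ‖hf.mk f x‖ₑ ^ p ∂μ :=
      lintegral_congr_ae (hf.ae_eq_mk.mono fun y hy => by simp only [← hy])
    exact this hf.stronglyMeasurable_mk.aestronglyMeasurable (h1 ▸ hfp) hf.stronglyMeasurable_mk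
  have : maximalTruncated μ K f = fun x => ⨆ (q : ℚ) (_ : 0 < q), ‖truncated μ K q f x‖ₑ :=
    funext fun x => maximalTruncated_eq_iSup_rat fun ε hε =>
      hK.integrableOn_of_lintegral_rpow_lt_top h hp hf hfp x hε
  rw [this]
  exact Measurable.iSup fun q => Measurable.iSup fun hq =>
    (hK.stronglyMeasurable_truncated h hfm (by exact_mod_cast hq)).enorm

theorem IsCZOperator.exists_lintegral_maximalTruncated_rpow_le_of_bounded (h : IsDominating μ lam)
    {T : Lp 𝕜 2 μ →L[𝕜] Lp 𝕜 2 μ} (hT : IsCZOperator μ lam K T) {p : ℝ} (hp : 1 < p) :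
    ∃ C : ℝ≥0, ∀ (f : X → 𝕜), MemLp f ∞ μ → Bornology.IsBounded (Function.support f) →
      ∫⁻ x, maximalTruncated μ K f x ^ p ∂μ ≤ C * ∫⁻ x, ‖f x‖ₑ ^ p ∂μ := by
  have := h.isLocallyFiniteMeasure
  have hp0 : 0 < p := by linarith
  -- Any fixed $\eta\in(0,1)$ works; $\eta<1<p$ puts $M_{\eta,6}$ in the range of the maximal
  -- theorem.
  obtain ⟨C₀, hC₀⟩ := hT.cotlar h (η := 2⁻¹) (by norm_num) (by norm_num)
  obtain ⟨C₁, hC₁⟩ := hT.exists_lintegral_rpow_le h hp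
  obtain ⟨C₂, hC₂⟩ := lintegral_maximalFun_rpow_le (μ := μ) (η := 2⁻¹) (p := p) (by norm_num)
    (by linarith [show (2⁻¹ : ℝ) < 1 by norm_num])
  obtain ⟨C₃, hC₃⟩ := lintegral_maximalFun_rpow_le (μ := μ) (η := 1) one_pos hp
  refine ⟨C₀ ^ p * 2 ^ (p - 1) * (C₂ * C₁ + C₃), fun f hf hb => ?_⟩
  have hf2 : MemLp f 2 μ := h.memLp_of_isBounded_support hf hb 2
  have hf1 : Integrable f μ := memLp_one_iff_integrable.1 (h.memLp_of_isBounded_support hf hb 1)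
  set J := ∫⁻ x, ‖f x‖ₑ ^ p ∂μ
  have e1 : ((C₀ ^ p * 2 ^ (p - 1) * (C₂ * C₁ + C₃) : ℝ≥0) : ℝ≥0∞) =
      C₀ ^ p * 2 ^ (p - 1) * (C₂ * C₁ + C₃) := by
    rw [ENNReal.coe_mul, ENNReal.coe_mul, ENNReal.coe_rpow_of_nonneg _ hp0.le,
      ENNReal.coe_rpow_of_nonneg _ (by linarith)]
    rfl
  have hne : (C₀ : ℝ≥0∞) ^ p * 2 ^ (p - 1) ≠ ∞ :=
    ENNReal.mul_ne_top (ENNReal.rpow_ne_top_of_nonneg hp0.le ENNReal.coe_ne_top)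
      (ENNReal.rpow_ne_top_of_nonneg (by linarith) ENNReal.ofNat_ne_top)
  rw [e1]
  set U : X → ℝ≥0∞ := maximalFun μ 2⁻¹ 6 (T (hf2.toLp f)) with hU
  set V : X → ℝ≥0∞ := maximalFun μ 1 5 f with hV
  calc ∫⁻ x, maximalTruncated μ K f x ^ p ∂μ
      ≤ ∫⁻ x, C₀ ^ p * 2 ^ (p - 1) * (U x ^ p + V x ^ p) ∂μ := by
        refine lintegral_mono fun x => ?_
        calc maximalTruncated μ K f x ^ p ≤ (C₀ * (U x + V x)) ^ p := by
              gcongr; exact hC₀ f hf hb hf2 x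
          _ = C₀ ^ p * (U x + V x) ^ p := ENNReal.mul_rpow_of_nonneg _ _ hp0.le
          _ ≤ C₀ ^ p * (2 ^ (p - 1) * (U x ^ p + V x ^ p)) := by
              gcongr; exact ENNReal.rpow_add_le_mul_rpow_add_rpow _ _ hp.le
          _ = _ := by ring
    _ = C₀ ^ p * 2 ^ (p - 1) * (∫⁻ x, U x ^ p ∂μ + ∫⁻ x, V x ^ p ∂μ) := by
        rw [lintegral_const_mul' _ _ hne, lintegral_add_left
          ((measurable_maximalFun (by norm_num) _ _).pow_const _)]
    _ ≤ C₀ ^ p * 2 ^ (p - 1) * (C₂ * (C₁ * J) + C₃ * J) := by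
        gcongr
        · exact (hC₂ (by norm_num) (Lp.aestronglyMeasurable _)).trans (by
            gcongr; exact hC₁ f hf2 hf1)
        · exact hC₃ le_rfl hf.1
    _ = _ := by ring

/-- The maximal truncated operator is bounded on `L^p` for `1 < p < ∞`. -/
theorem IsCZOperator.exists_lintegral_maximalTruncated_rpow_le (h : IsDominating μ lam)
    {T : Lp 𝕜 2 μ →L[𝕜] Lp 𝕜 2 μ} (hT : IsCZOperator μ lam K T) {p : ℝ} (hp : 1 < p) :
    ∃ C : ℝ≥0, ∀ (f : X → 𝕜), AEStronglyMeasurable f μ → ∫⁻ x, ‖f x‖ₑ ^ p ∂μ < ∞ →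
      ∫⁻ x, maximalTruncated μ K f x ^ p ∂μ ≤ C * ∫⁻ x, ‖f x‖ₑ ^ p ∂μ := by
  rcases isEmpty_or_nonempty X with hX | ⟨⟨x₀⟩⟩
  · exact ⟨0, fun f _ _ => by simp [Measure.eq_zero_of_isEmpty μ]⟩
  have hp0 : 0 < p := by linarith
  obtain ⟨C, hC⟩ := hT.exists_lintegral_maximalTruncated_rpow_le_of_bounded h hp
  obtain ⟨δ, a, C', hK⟩ := hT.kernel.exists_kernelBounds h
  refine ⟨C, fun f hf hfp => ?_⟩
  wlog hfm : StronglyMeasurable f generalizing f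
  · have h1 : ∫⁻ x, ‖f x‖ₑ ^ p ∂μ = ∫⁻ x, ‖hf.mk f x‖ₑ ^ p ∂μ :=
      lintegral_congr_ae (hf.ae_eq_mk.mono fun y hy => by simp only [← hy])
    rw [maximalTruncated_congr hf.ae_eq_mk, h1]
    exact this _ hf.stronglyMeasurable_mk.aestronglyMeasurable (h1 ▸ hfp) hf.stronglyMeasurable_mk
  set A : ℕ → Set X := fun n => Metric.ball x₀ n ∩ {x | ‖f x‖ ≤ n} with hA
  have hAm : ∀ n, MeasurableSet (A n) := fun n =>
    Metric.isOpen_ball.measurableSet.inter (measurableSet_le hfm.norm.measurable measurable_const)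
  have hmem : ∀ y, ∀ᶠ n in atTop, y ∈ A n := by
    intro y
    obtain ⟨n, hn⟩ := exists_nat_gt (max (dist y x₀) ‖f y‖)
    filter_upwards [eventually_ge_atTop n] with m hm
    have hm' : (n : ℝ) ≤ m := by exact_mod_cast hm
    exact ⟨((le_max_left _ _).trans_lt hn).trans_le hm',
      ((le_max_right _ _).trans hn.le).trans hm'⟩
  set F : ℕ → X → 𝕜 := fun n => (A n).indicator f with hF
  have hFle : ∀ n y, ‖F n y‖ₑ ≤ ‖f y‖ₑ := fun n y => by
    rw [hF, enorm_indicator_eq_indicator_enorm]; exact indicator_le_self _ _ _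
  have hFtop : ∀ n, MemLp (F n) ∞ μ := fun n => by
    refine memLp_top_of_bound (hf.indicator (hAm n)) (n : ℝ) (Eventually.of_forall fun x => ?_)
    by_cases hx : x ∈ A n
    · simp only [hF, indicator_of_mem hx]; exact hx.2
    · simp only [hF, indicator_of_notMem hx, norm_zero]; positivity
  have hFb : ∀ n, Bornology.IsBounded (Function.support (F n)) := fun n =>
    Metric.isBounded_ball.subset (support_indicator_subset.trans inter_subset_left)
  have hFp : ∀ n, ∫⁻ x, ‖F n x‖ₑ ^ p ∂μ ≤ ∫⁻ x, ‖f x‖ₑ ^ p ∂μ := fun n =>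
    lintegral_mono fun x => by gcongr; exact hFle n x
  have hlim : ∀ x ε, 0 < ε → Tendsto (fun n => truncated μ K ε (F n) x) atTop
      (𝓝 (truncated μ K ε f x)) := by
    intro x ε hε
    have hint := hK.integrableOn_of_lintegral_rpow_lt_top h hp hf hfp x hε
    refine tendsto_integral_of_dominated_convergence (fun y => ‖K x y * f y‖) (fun n => ?_)
      hint.norm (fun n => Eventually.of_forall fun y => ?_) (Eventually.of_forall fun y => ?_)
    · exact (hK.integrableOn_of_lintegral_rpow_lt_top h hp (hFtop n).1
        ((hFp n).trans_lt hfp) x hε).1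
    · rw [norm_mul, norm_mul]
      gcongr
      exact norm_indicator_le_norm_self _ _
    · refine tendsto_nhds_of_eventually_eq ?_
      filter_upwards [hmem y] with n hn
      simp only [hF, indicator_of_mem hn]
  -- Each single truncation converges along $f1_{A_n}$, so lower semicontinuity of the supremum and
  -- Fatou's lemma transfer the bound.
  have hle : ∀ x, maximalTruncated μ K f x ^ p ≤
      liminf (fun n => maximalTruncated μ K (F n) x ^ p) atTop := by
    intro x
    rw [← ENNReal.le_rpow_inv_iff hp0]
    refine iSup_le fun ε => iSup_le fun hε => ?_
    rw [ENNReal.le_rpow_inv_iff hp0, ← ((hlim x ε hε).enorm.ennrpow_const p).liminf_eq]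
    refine liminf_le_liminf (Eventually.of_forall fun n => ?_)
    gcongr
    exact le_iSup_of_le ε (le_iSup_of_le hε le_rfl)
  calc ∫⁻ x, maximalTruncated μ K f x ^ p ∂μ
      ≤ ∫⁻ x, liminf (fun n => maximalTruncated μ K (F n) x ^ p) atTop ∂μ := lintegral_mono hle
    _ ≤ liminf (fun n => ∫⁻ x, maximalTruncated μ K (F n) x ^ p ∂μ) atTop :=
        lintegral_liminf_le fun n => (hK.measurable_maximalTruncated h hp (hFtop n).1
          ((hFp n).trans_lt hfp)).pow_const _
    _ ≤ C * ∫⁻ x, ‖f x‖ₑ ^ p ∂μ := by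
        refine liminf_le_of_le (by isBoundedDefault) fun b hb => ?_
        obtain ⟨n, hn⟩ := hb.exists
        exact hn.trans ((hC _ (hFtop n) (hFb n)).trans (mul_le_mul_right (hFp n) _))

end Truncated

end NonHomog

/-! ### The main theorem -/

theorem mainTheorem7 {X 𝕜 : Type*} [MetricSpace X] [MeasurableSpace X] [BorelSpace X] [RCLike 𝕜]
    (hX : NonHomog.GeometricallyDoubling X) (μ : Measure X) (lam : X → ℝ → ℝ)
    (hlam : NonHomog.IsDominating μ lam) (K : X → X → 𝕜)
    (T : Lp 𝕜 2 μ →L[𝕜] Lp 𝕜 2 μ) (hT : NonHomog.IsCZOperator μ lam K T) :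
    (∀ η : ℝ, 0 < η → η < 1 → ∃ C : ℝ≥0,
      ∀ (f : X → 𝕜) (hf : MemLp f ∞ μ) (hs : HasCompactSupport f) (x : X),
        NonHomog.maximalTruncated μ K f x ≤
          C * (NonHomog.maximalFun μ η 6 (T ((hlam.memLp_two hf hs).toLp f)) x +
            NonHomog.maximalFun μ 1 5 f x)) ∧
    (∀ p : ℝ≥0∞, 1 < p → p < ∞ → ∃ C : ℝ≥0, ∀ f : X → 𝕜, MemLp f p μ →
      (∀ (x : X) (ε : ℝ), 0 < ε → IntegrableOn (fun y => K x y * f y) {y | ε ≤ dist x y} μ) ∧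
      AEMeasurable (NonHomog.maximalTruncated μ K f) μ ∧
      eLpNorm (NonHomog.maximalTruncated μ K f) p μ ≤ C * eLpNorm f p μ) := by
  have := hX.secondCountableTopology
  refine ⟨fun η hη hη1 => ?_, fun p hp hptop => ?_⟩
  · obtain ⟨C, hC⟩ := hT.cotlar hlam hη hη1
    exact ⟨C, fun f hf hs x => hC f hf
      (hs.isCompact.isBounded.subset (subset_tsupport f)) (hlam.memLp_two hf hs) x⟩
  · have hp0 : p ≠ 0 := (zero_lt_one.trans hp).ne'
    have hr : 1 < p.toReal := by
      rw [← ENNReal.toReal_one]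
      exact (ENNReal.toReal_lt_toReal ENNReal.one_ne_top hptop.ne).2 hp
    have hr0 : 0 < p.toReal := by linarith
    obtain ⟨C, hC⟩ := hT.exists_lintegral_maximalTruncated_rpow_le hlam hr
    obtain ⟨δ, a, C', hK⟩ := hT.kernel.exists_kernelBounds hlam
    refine ⟨C ^ (1 / p.toReal), fun f hf => ?_⟩
    have hfp := lintegral_rpow_enorm_lt_top_of_eLpNorm_lt_top hp0 hptop.ne hf.2
    refine ⟨fun x ε hε => hK.integrableOn_of_lintegral_rpow_lt_top hlam hr hf.1 hfp x hε,
      (hK.measurable_maximalTruncated hlam hr hf.1 hfp).aemeasurable, ?_⟩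
    rw [eLpNorm_eq_lintegral_rpow_enorm_toReal hp0 hptop.ne,
      eLpNorm_eq_lintegral_rpow_enorm_toReal hp0 hptop.ne,
      ENNReal.coe_rpow_of_nonneg _ (one_div_nonneg.2 hr0.le),
      ← ENNReal.mul_rpow_of_nonneg _ _ (one_div_nonneg.2 hr0.le)]
    refine ENNReal.rpow_le_rpow ?_ (one_div_nonneg.2 hr0.le)
    simpa only [enorm_eq_self] using hC f hf.1 hfp
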